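/- Let $n\ge 1$ and consider Minkowski space $\mathbb R_t\times\mathbb R^n_x$ with polar coordinates $x=r\omega$, $r>0$, $\omega\in\mathbb S^{n-1}$, and its wave operator $$\Box_g=-D_t^2+D_r^2-\tfrac{n-1}{r}\,i D_r+r^{-2}\Delta_{\mathbb S^{n-1}},\qquad D=-i\partial,$$ where $\Delta_{\mathbb S^{n-1}}\ge 0$. Let $V=r^{-2}V_0$, where $V_0=V_0(t,r,\omega)\in C^\infty(\mathbb R_t\times[0,\infty)_r\times\mathbb S^{n-1})$ is complex-valued and its restriction to $r=0$ is independent of $\omega$; write $V_0(t,0,\omega)=V_0(t)$. Let $t_0\in\mathbb R$ be such that $$V_0(t_0)\in\mathbb C\setminus\bigl(-\infty,-(\tfrac{n-2}{2})^2\bigr],$$ and set $\mu:=\operatorname{Re}\sqrt{(\tfrac{n-2}{2})^2+V_0(t_0)}$ (principal branch). Then for every $\ell\in(1-\mu,1+\mu)$, the operator $P=\Box_g+V$ is *spectrally admissible with weight $\ell$ at $t_0$*. Here spectral admissibility is defined as follows. Let $N$ be the edge normal operator of $r^2P$ at $t_0$, i.e. the operator on $\mathbb R_{t'}\times(0,\infty)_{r'}\times\mathbb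 S^{n-1}$ obtained by expressing $r^2P$ in terms of $rD_t$, $rD_r$ and $\omega$-derivatives, and freezing the coefficients at $t=t_0$, $r=0$ (equivalently, the limit of $r^2P$ under the dilations $(t',r',\omega)\mapsto(t_0+\epsilon t',\epsilon r',\omega)$ as $\epsilon\searrow 0$). For $\sigma\in\mathbb C$ put $N(\sigma)u:=e^{i\sigma t'}N(e^{-i\sigma t'}u)$ for $u=u(r',\omega)$, for $|\hat\sigma|=1$ put $\hat N(\hat\sigma):=\hat r^{-2}N(\hat\sigma)$ (with $r'$ renamed $\hat r$), and for $\xi\in\mathbb C$ let $N_{\mathrm b}(\xi)f:=r'^{-\xi}N(0)(r'^{\xi}f)$ for $f=f(\omega)$. The operator $P$ is spectrally admissible with weight $\ell$ at $t_0$ if $N_{\mathrm b}(\xi)\colon H^2(\mathbb S^{n-1})\to L^2(\mathbb S^{n-1})$ is invertible for all $\xi\in\mathbb C$ with $\operatorname{Re}\xi=\ell-\frac n2$, and if for all $\hat\sigma\in\mathbb C$ with $\operatorname{Im}\hat\sigma\ge 0$, $|\hat\sigma|=1$, and all $u\in C^\infty((0,\infty)_{\hat r}\times\mathbb S^{n-1};\mathbb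 C)$ the following two conditions hold. 1. (Injectivity.) Suppose that $\hat N(\hat\sigma)u=0$; that $|(\hat r\partial_{\hat r})^j\partial_\omega^\alpha u|\lesssim\hat r^{\ell-\frac n2}$ on $(0,1]$ for all $j,\alpha$; and that on $[1,\infty)$, if $\hat\sigma=\pm1$, there is a constant $C$ so that $|(\hat r\partial_{\hat r})^j\partial_\omega^\alpha(e^{-i\hat\sigma\hat r}u)|\lesssim\hat r^{C}$ for all $j,\alpha$, resp., if $\operatorname{Im}\hat\sigma>0$, $|\partial_{\hat r}^j\partial_\omega^\alpha u|\lesssim\hat r^{-N}$ for all $j,\alpha$ and all $N\in\mathbb R$. Then $u=0$. 2. (Injectivity of the adjoint.) Suppose that $\hat N(\hat\sigma)^*u=0$, where the formal adjoint is taken with respect to the volume density $\hat r^{n-1}\,d\hat r\,d\omega$; that $|(\hat r\partial_{\hat r})^j\partial_\omega^\alpha u|\lesssim\hat r^{-\frac{n-4}{2}-\ell}$ on $(0,1]$ for all $j,\alpha$; and that on $[1,\infty)$, if $\hat\sigma=\pm1$, there is a constant $C$ so that $|(\hat r\partial_{\hat r})^j\partial_\omega^\alpha(e^{i\hat\sigma\hat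 r}u)|\lesssim\hat r^{C}$ for all $j,\alpha$, resp., if $\operatorname{Im}\hat\sigma>0$, $|\partial_{\hat r}^j\partial_\omega^\alpha u|\lesssim\hat r^{-N}$ for all $j,\alpha$ and all $N\in\mathbb R$. Then $u=0$. -/

import Mathlib

open Set Filter Topology MeasureTheory
open scoped Manifold ContDiff ComplexConjugate

noncomputable section

/-! Throughout, `d : ℕ` and the spatial dimension is `n = d + 1 ≥ 1`. -/

/-- The unit sphere `𝕊^{n-1}` in `ℝ^n`, `n = d + 1`. -/
abbrev UnitSphere (d : ℕ) : Type :=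
  Metric.sphere (0 : EuclideanSpace ℝ (Fin (d + 1))) 1

/-- The standard surface measure on `𝕊^{n-1}` (the counting measure on two points if `n = 1`). -/
abbrev surfaceMeasure (d : ℕ) : Measure (UnitSphere d) :=
  (volume : Measure (EuclideanSpace ℝ (Fin (d + 1)))).toSphere

/-- Functions of `(r, θ)` on `(0,∞) × 𝕊^{n-1}`; values at `r ≤ 0` play no role. -/
abbrev RadFun (d : ℕ) : Type := ℝ → UnitSphere d → ℂ

/-- Functions of `(t, r, θ)` on `ℝ × (0,∞) × 𝕊^{n-1}`; values at `r ≤ 0` play no role. -/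
abbrev SpaceTimeFun (d : ℕ) : Type := ℝ → ℝ → UnitSphere d → ℂ

/-- Smooth complex functions on the sphere. -/
def SmoothSphere {d : ℕ} (f : UnitSphere d → ℂ) : Prop :=
  ContMDiff (𝓡 d) 𝓘(ℝ, ℂ) ∞ f

/-- Smoothness of `u = u(r, θ)` on `I × 𝕊^{n-1}`. -/
def SmoothRadOn {d : ℕ} (I : Set ℝ) (u : RadFun d) : Prop :=
  ContMDiffOn (𝓘(ℝ, ℝ).prod (𝓡 d)) 𝓘(ℝ, ℂ) ∞
    (fun q : ℝ × UnitSphere d => u q.1 q.2) (I ×ˢ univ)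

/-- Smoothness of `w = w(t, r, θ)` on `ℝ × I × 𝕊^{n-1}` (up to the boundary for `I = [0,∞)`). -/
def SmoothSpaceTimeOn {d : ℕ} (I : Set ℝ) (w : SpaceTimeFun d) : Prop :=
  ContMDiffOn (𝓘(ℝ, ℝ).prod (𝓘(ℝ, ℝ).prod (𝓡 d))) 𝓘(ℝ, ℂ) ∞
    (fun q : ℝ × ℝ × UnitSphere d => w q.1 q.2.1 q.2.2) (univ ×ˢ I ×ˢ univ)

/-! ### Differential operators on the sphere -/

/-- The extension of `f` to `ℝ^n ∖ {0}` which is homogeneous of degree `0`: `x ↦ f (x / |x|)`. -/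
def homExt {d : ℕ} (f : UnitSphere d → ℂ) (x : EuclideanSpace ℝ (Fin (d + 1))) : ℂ :=
  if h : x = 0 then 0
  else f ⟨‖x‖⁻¹ • x, by simp [norm_smul, h]⟩

/-- The nonnegative Laplacian of the round sphere: minus the Euclidean Laplacian of the
degree `0` homogeneous extension, restricted to the sphere. -/
def sphereLaplacian {d : ℕ} (f : UnitSphere d → ℂ) (θ : UnitSphere d) : ℂ :=
  -(Laplacian.laplacian (homExt f) (θ : EuclideanSpace ℝ (Fin (d + 1))))

/-- The rotation vector field `θ_i ∂_j - θ_j ∂_i` on the sphere. -/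
def rotDeriv {d : ℕ} (p : Fin (d + 1) × Fin (d + 1)) (f : UnitSphere d → ℂ)
    (θ : UnitSphere d) : ℂ :=
  fderiv ℝ (homExt f) (θ : EuclideanSpace ℝ (Fin (d + 1)))
    ((θ : EuclideanSpace ℝ (Fin (d + 1))) p.1 • EuclideanSpace.single p.2 (1 : ℝ)
      - (θ : EuclideanSpace ℝ (Fin (d + 1))) p.2 • EuclideanSpace.single p.1 (1 : ℝ))

/-- Iterated derivatives along rotation vector fields. These vector fields span every tangent
space of the (compact) sphere, so uniform bounds on all `angDeriv L f` are the same as uniform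
bounds on all local coordinate derivatives `∂_θ^α f` (on compact subsets of the charts). -/
def angDeriv {d : ℕ} (L : List (Fin (d + 1) × Fin (d + 1))) (f : UnitSphere d → ℂ) :
    UnitSphere d → ℂ :=
  L.foldr rotDeriv f

/-! ### Radial derivatives -/

/-- `∂_r`. -/
def radDeriv {d : ℕ} (u : RadFun d) : RadFun d :=
  fun r θ => deriv (fun s => u s θ) r

/-- `r ∂_r`. -/
def radEuler {d : ℕ} (u : RadFun d) : RadFun d :=
  fun r θ => (r : ℂ) * deriv (fun s => u s θ) r

/-! ### The wave operator of Minkowski space -/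

/-- `□_g = -D_t² + D_r² - ((n-1)/r) i D_r + r⁻² Δ` on Minkowski space in polar coordinates,
where `D = -i ∂` and `n - 1 = d`. -/
def minkowskiBox {d : ℕ} (w : SpaceTimeFun d) : SpaceTimeFun d :=
  fun t r θ =>
    iteratedDeriv 2 (fun s => w s r θ) t
      - iteratedDeriv 2 (fun s => w t s θ) r
      - ((d : ℂ) / (r : ℂ)) * deriv (fun s => w t s θ) r
      + ((r : ℂ) ^ 2)⁻¹ * sphereLaplacian (fun η => w t r η) θ

/-- The operator `□_g + V` with `V = r⁻² V₀`. -/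
def minkowskiBoxAddPotential {d : ℕ} (V₀ : SpaceTimeFun d) (w : SpaceTimeFun d) :
    SpaceTimeFun d :=
  fun t r θ => minkowskiBox w t r θ + ((r : ℂ) ^ 2)⁻¹ * V₀ t r θ * w t r θ

/-! ### Normal operators -/

/-- `N` is the edge normal operator `N_{e,t₀}(r² P)`: the limit, as `ε → 0+`, of the conjugates of
`r² P` by the dilations `(t', r', θ) ↦ (t₀ + ε t', ε r', θ)`. Since the edge vector fields
`r ∂_t`, `r ∂_r`, `∂_θ` are invariant under these dilations, for an operator
`∑ p_{jkβ}(t, r, θ) (r D_r)^j (r D_t)^k D_θ^β` the limit is obtained by freezing the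
coefficients at `(t, r) = (t₀, 0)`. This determines `N w` on `r' > 0` for all smooth `w`. -/
def IsEdgeNormalOperator {d : ℕ} (P : SpaceTimeFun d → SpaceTimeFun d) (t₀ : ℝ)
    (N : SpaceTimeFun d → SpaceTimeFun d) : Prop :=
  ∀ w : SpaceTimeFun d, SmoothSpaceTimeOn (Ioi 0) w →
    ∀ (t r : ℝ) (θ : UnitSphere d), 0 < r →
      Tendsto
        (fun ε : ℝ => ((ε * r : ℝ) : ℂ) ^ 2 *
          P (fun s ρ η => w ((s - t₀) / ε) (ρ / ε) η) (t₀ + ε * t) (ε * r) θ)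
        (𝓝[>] 0) (𝓝 (N w t r θ))

/-- The spectral family `N(σ) u = e^{iσt'} N (e^{-iσt'} u)` of a `t'`-translation invariant
operator, evaluated at `t' = 0`. -/
def spectralFamily {d : ℕ} (N : SpaceTimeFun d → SpaceTimeFun d) (σ : ℂ) (u : RadFun d) :
    RadFun d :=
  fun r θ => N (fun t ρ η => Complex.exp (-(Complex.I * σ * (t : ℂ))) * u ρ η) 0 r θ

/-- The reduced normal operator `r⁻² N(r² P, σ)` for `|σ| = 1` (for such `σ`, the rescaled variable
`r |σ|` is just `r`); here `N` is the edge normal operator of `r² P`. -/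
def reducedNormalOperator {d : ℕ} (N : SpaceTimeFun d → SpaceTimeFun d) (σ : ℂ) (u : RadFun d) :
    RadFun d :=
  fun r θ => ((r : ℂ) ^ 2)⁻¹ * spectralFamily N σ u r θ

/-- The Mellin transformed b-normal operator (indicial family). The b-normal operator is the
spectral family at `σ = 0`; it is dilation invariant, and `f ↦ r^{-ξ} N_b (r^ξ f)`, evaluated at
`r = 1`, replaces `r ∂_r` by `ξ`. -/
def indicialFamily {d : ℕ} (N : SpaceTimeFun d → SpaceTimeFun d) (ξ : ℂ)
    (f : UnitSphere d → ℂ) : UnitSphere d → ℂ :=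
  fun θ => spectralFamily N 0 (fun r η => (r : ℂ) ^ ξ * f η) 1 θ

/-- Invertibility of a differential operator on the sphere: its closure in `L²(𝕊^{n-1})`, starting
from the domain `C^∞(𝕊^{n-1})`, is a bijection onto `L²(𝕊^{n-1})`. For an elliptic operator of
order `2` the domain of the closure is `H²(𝕊^{n-1})`, so that this is the
invertibility of `H²(𝕊^{n-1}) → L²(𝕊^{n-1})`. -/
def InvertibleOnSphere {d : ℕ} (A : (UnitSphere d → ℂ) → (UnitSphere d → ℂ)) : Prop :=
  ∀ g : Lp ℂ 2 (surfaceMeasure d), ∃! f : Lp ℂ 2 (surfaceMeasure d),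
    (f, g) ∈ closure {p : Lp ℂ 2 (surfaceMeasure d) × Lp ℂ 2 (surfaceMeasure d) |
      ∃ φ : UnitSphere d → ℂ, SmoothSphere φ ∧
        p.1 =ᵐ[surfaceMeasure d] φ ∧ p.2 =ᵐ[surfaceMeasure d] A φ}

/-- `κ` is a non-indicial weight: the indicial family is invertible on the line `Re ξ = κ`. -/
def NonIndicialWeight {d : ℕ} (N : SpaceTimeFun d → SpaceTimeFun d) (κ : ℝ) : Prop :=
  ∀ ξ : ℂ, ξ.re = κ → InvertibleOnSphere (indicialFamily N ξ)

/-! ### Adjoints and bounds -/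

/-- Test functions: elements of `C_c^∞((0,∞) × 𝕊^{n-1})`. -/
def IsTestFunction {d : ℕ} (φ : RadFun d) : Prop :=
  SmoothRadOn univ φ ∧ ∃ a b : ℝ, 0 < a ∧ ∀ r θ, r ∉ Icc a b → φ r θ = 0

/-- The `L²` pairing `⟨u, v⟩` with respect to the volume density `r^{n-1} dr dθ`, where
`dθ` is the standard measure on the sphere. -/
def radPairing {d : ℕ} (u v : RadFun d) : ℂ :=
  ∫ r in Ioi (0 : ℝ), (∫ θ, u r θ * conj (v r θ) ∂(surfaceMeasure d)) * (r : ℂ) ^ d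

/-- `A* u = g`, where `A*` is the formal adjoint of `A`:
`⟨g, φ⟩ = ⟨u, A φ⟩` for all test functions `φ`. -/
def AdjointApplyEq {d : ℕ} (A : RadFun d → RadFun d) (u g : RadFun d) : Prop :=
  ∀ φ : RadFun d, IsTestFunction φ → radPairing g φ = radPairing u (A φ)

/-- `|(r∂_r)^j ∂_θ^α u| ≲ r^κ` on `(0,1]` for all `j, α`. -/
def ConormalNearZero {d : ℕ} (κ : ℝ) (u : RadFun d) : Prop :=
  ∀ (j : ℕ) (L : List (Fin (d + 1) × Fin (d + 1))), ∃ K : ℝ, ∀ r ∈ Ioc (0 : ℝ) 1, ∀ θ,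
    ‖angDeriv L (radEuler^[j] u r) θ‖ ≤ K * r ^ κ

/-- There is a `C` such that `|(r∂_r)^j ∂_θ^α u| ≲ r^C` on `[1,∞)` for all `j, α`. -/
def ConormalNearInfinity {d : ℕ} (u : RadFun d) : Prop :=
  ∃ C : ℝ, ∀ (j : ℕ) (L : List (Fin (d + 1) × Fin (d + 1))), ∃ K : ℝ, ∀ r ∈ Ici (1 : ℝ), ∀ θ,
    ‖angDeriv L (radEuler^[j] u r) θ‖ ≤ K * r ^ C

/-- `|∂_r^j ∂_θ^α u| ≲ r^{-N}` on `[1,∞)` for all `j, α` and all `N`. -/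
def RapidDecayNearInfinity {d : ℕ} (u : RadFun d) : Prop :=
  ∀ (j : ℕ) (L : List (Fin (d + 1) × Fin (d + 1))) (N : ℝ), ∃ K : ℝ, ∀ r ∈ Ici (1 : ℝ), ∀ θ,
    ‖angDeriv L (radDeriv^[j] u r) θ‖ ≤ K * r ^ (-N)

/-! ### Spectral admissibility -/

/-- `P` is spectrally admissible with weight `ℓ` at `t₀` (in spatial dimension `n = d + 1`). For
`|σ| = 1` and `Im σ ≥ 0`, the condition `Im σ = 0` means `σ = ±1`. The normal
operator `N` is determined by `P` and `t₀` on smooth functions on `r' > 0`, and is only ever applied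
to such functions. -/
def SpectrallyAdmissible {d : ℕ} (P : SpaceTimeFun d → SpaceTimeFun d) (t₀ ℓ : ℝ) : Prop :=
  ∃ N : SpaceTimeFun d → SpaceTimeFun d, IsEdgeNormalOperator P t₀ N ∧
    NonIndicialWeight N (ℓ - ((d : ℝ) + 1) / 2) ∧
    ∀ σ : ℂ, 0 ≤ σ.im → ‖σ‖ = 1 → ∀ u : RadFun d, SmoothRadOn (Ioi 0) u →
      -- injectivity
      ((∀ r θ, 0 < r → reducedNormalOperator N σ u r θ = 0) →
        ConormalNearZero (ℓ - ((d : ℝ) + 1) / 2) u →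
        (σ.im = 0 → ConormalNearInfinity
          (fun r θ => Complex.exp (-(Complex.I * σ * (r : ℂ))) * u r θ)) →
        (0 < σ.im → RapidDecayNearInfinity u) →
        ∀ r θ, 0 < r → u r θ = 0) ∧
      -- injectivity of the adjoint
      (AdjointApplyEq (reducedNormalOperator N σ) u (fun _ _ => 0) →
        ConormalNearZero (-((((d : ℝ) + 1) - 4) / 2) - ℓ) u →
        (σ.im = 0 → ConormalNearInfinity
          (fun r θ => Complex.exp (Complex.I * σ * (r : ℂ)) * u r θ)) →
        (0 < σ.im → RapidDecayNearInfinity u) →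
        ∀ r θ, 0 < r → u r θ = 0)

end

noncomputable section

/-! ### A recessive solution of the radial equation -/

/-! Freezing coefficients replaces `V₀` by the constant `Z = v₀ t₀`, so with `Δ ≥ 0` on the sphere
the reduced operator is `-∂_r² - (d/r)∂_r + r⁻²(Δ + Z) - σ²` and the indicial family is `Δ - (ξ² +
(d-1)ξ - Z)`. Both are diagonal in eigenfunctions of `Δ`. For an eigenvalue `λ ≥ 0` choose `ν² =
((d-1)/2)² + Z + λ` with `Re ν > 0`; the indicial roots are `-(d-1)/2 ± ν`. Adding `λ ≥ 0` to the
square of a number cannot decrease the absolute value of its real part (`abs_re_le_of_sq_eq_add`),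
so `Re ν ≥ μ` for every mode, and one interval of weights serves all modes.

Indicial family: if `ξ² + (d-1)ξ - Z = λ ≥ 0` on the line in question, then `|ℓ - 1| = |Re (ξ +
(d-1)/2)| ≥ μ`, which is excluded. So the spectral parameter avoids `[0,∞)`, and
`invertibleOnSphere_sphereLaplacian_sub` applies.

Injectivity: put `ζ = -iσ`, so that `Re ζ = Im σ ≥ 0`. Each mode of a kernel element solves a
Bessel-type equation and is smaller at `r = 0` than the singular root, because `ℓ > 1 - μ`. It is
compared with the recessive solution `K`, essentially `r^{-(d-1)/2} K_ν(ζr)`, which is built from an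
explicit integral (`exists_recessive_solution`). The Wronskian times `r^d` is constant. It vanishes
by decay if `Re ζ > 0`. If `Re ζ = 0`, its product with `e^{2ζr}` is a symbol, and a nonzero
multiple of an oscillating exponential is not a symbol. Hence the mode is a multiple of `K` near
`0`, where `K` has exactly the forbidden size; so it vanishes (`radial_solution_eq_zero`).

Adjoint: the complex conjugate of a mode of an adjoint kernel element solves the same radial
equation, at first weakly and then classically (`strong_of_weak_radial`). The weight condition
becomes `ℓ < 1 + μ`.

Sphere: Green's formula for degree `0` extensions shows that `Δ` is symmetric and nonnegative. It
preserves restrictions of homogeneous polynomials of each degree, so it is diagonalizable on these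
finite-dimensional spaces; Stone–Weierstrass makes the eigenfunctions complete. -/

theorem norm_cpow_le_rpow_mul_exp (x γ : ℂ) :
    ‖x ^ γ‖ ≤ ‖x‖ ^ γ.re * Real.exp (Real.pi * |γ.im|) := by
  refine (Complex.norm_cpow_le x γ).trans ?_
  rw [div_eq_mul_inv, ← Real.exp_neg]
  have h1 : -(x.arg * γ.im) ≤ Real.pi * |γ.im| := by
    refine (neg_le_abs _).trans ?_
    rw [abs_mul]
    exact mul_le_mul_of_nonneg_right (Complex.abs_arg_le_pi x) (abs_nonneg _)
  gcongr

/-- Half of the weight `e^{-t}` absorbs polynomial growth through this bound; the other half keeps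
the integrals convergent. -/
theorem exists_rpow_le_exp_half (g : ℝ) :
    ∃ C : ℝ, 0 < C ∧ ∀ y : ℝ, 1 ≤ y → y ^ g ≤ C * Real.exp (y / 2) := by
  set p : ℝ := |g| + 1
  have hp : 0 < p := by positivity
  refine ⟨Real.exp (-(p * (1 + Real.log (1 / (2 * p))))), Real.exp_pos _, fun y hy => ?_⟩
  have hy0 : 0 < y := by linarith
  have h1 : y ^ g ≤ y ^ p :=
    Real.rpow_le_rpow_of_exponent_le hy (by have := le_abs_self g; simp only [p]; linarith)
  refine h1.trans ?_
  rw [Real.rpow_def_of_pos hy0, ← Real.exp_add]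
  apply Real.exp_le_exp.mpr
  -- The tangent-line bound for the logarithm at `y / (2p)`, multiplied by `p`, gives slope exactly
  -- `1/2`. The `+ 1` in `p` keeps `p` positive when `g = 0`.
  have h2 := Real.log_le_sub_one_of_pos (x := 1 / (2 * p) * y) (by positivity)
  rw [Real.log_mul (by positivity) hy0.ne'] at h2
  have h3 : Real.log y * p ≤ (1 / (2 * p) * y - 1 - Real.log (1 / (2 * p))) * p := by
    apply mul_le_mul_of_nonneg_right _ hp.le; linarith
  have h4 : (1 / (2 * p) * y - 1 - Real.log (1 / (2 * p))) * p
      = -(p * (1 + Real.log (1 / (2 * p)))) + y / 2 := by field_simp; ring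
  linarith

/-- The cross term has the sign of `ζ.re`. For `0 ≤ ζ.re` the modulus therefore dominates both `t`
and `2r`, uniformly up to the imaginary axis; all bounds on the integrals rest on this. -/
theorem norm_ray_sq (ζ : ℂ) (hn : ‖ζ‖ = 1) (t r : ℝ) :
    ‖(t : ℂ) + 2 * ζ * r‖ ^ 2 = t ^ 2 + 4 * (t * r) * ζ.re + 4 * r ^ 2 := by
  have h : ζ.re ^ 2 + ζ.im ^ 2 = 1 := by
    have := Complex.sq_norm ζ
    rw [hn, Complex.normSq_apply] at this; nlinarith
  rw [Complex.sq_norm, Complex.normSq_apply]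
  simp
  linear_combination 4 * r ^ 2 * h

section ray
variable {ζ : ℂ} (hre : 0 ≤ ζ.re) (hn : ‖ζ‖ = 1) {t r : ℝ} (ht : 0 < t) (hr : 0 < r)
include hre hn ht hr

theorem le_norm_ray : t ≤ ‖(t : ℂ) + 2 * ζ * r‖ := by
  have h := norm_ray_sq ζ hn t r
  have : 0 ≤ (t * r) * ζ.re := by positivity
  refine le_of_sq_le_sq ?_ (norm_nonneg _)
  nlinarith

theorem two_mul_le_norm_ray : 2 * r ≤ ‖(t : ℂ) + 2 * ζ * r‖ := by
  have h := norm_ray_sq ζ hn t r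
  have : 0 ≤ (t * r) * ζ.re := by positivity
  refine le_of_sq_le_sq ?_ (norm_nonneg _)
  nlinarith

omit hre in
theorem norm_ray_le : ‖(t : ℂ) + 2 * ζ * r‖ ≤ t + 2 * r := by
  refine (norm_add_le _ _).trans ?_
  simp [hn, abs_of_pos ht, abs_of_pos hr]

omit hn in
theorem ray_mem_slitPlane : (t : ℂ) + 2 * ζ * r ∈ Complex.slitPlane := by
  left
  have : 0 ≤ 2 * ζ.re * r := by positivity
  simp; linarith

end ray

/-- The integrand `e^{-t} t^β (t + 2ζr)^γ`. -/
def rayIntegrand (β γ ζ : ℂ) (r t : ℝ) : ℂ :=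
  Complex.exp (-(t : ℂ)) * (t : ℂ) ^ β * ((t : ℂ) + 2 * ζ * r) ^ γ

/-- `∫₀^∞ e^{-t} t^β (t + 2ζr)^γ dt`; for `γ = β = ν - 1/2` this is, up to elementary factors, the
Macdonald function `K_ν(ζr)`. -/
def rayIntegral (β γ ζ : ℂ) (r : ℝ) : ℂ := ∫ t in Ioi (0 : ℝ), rayIntegrand β γ ζ r t

theorem norm_rayIntegrand_le (β γ ζ : ℂ) {t : ℝ} (ht : 0 < t) (r : ℝ) :
    ‖rayIntegrand β γ ζ r t‖ ≤ Real.exp (Real.pi * |γ.im|) *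
      (Real.exp (-t) * t ^ β.re * ‖(t : ℂ) + 2 * ζ * r‖ ^ γ.re) := by
  unfold rayIntegrand
  rw [norm_mul, norm_mul, Complex.norm_exp, Complex.norm_cpow_eq_rpow_re_of_pos ht]
  have := norm_cpow_le_rpow_mul_exp ((t : ℂ) + 2 * ζ * r) γ
  simp only [Complex.neg_re, Complex.ofReal_re]
  calc _ ≤ Real.exp (-t) * t ^ β.re * (‖(t : ℂ) + 2 * ζ * r‖ ^ γ.re * Real.exp (Real.pi * |γ.im|)) := by
        gcongr
    _ = _ := by ring

theorem integrableOn_exp_half_rpow {b : ℝ} (hb : -1 < b) :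
    IntegrableOn (fun t : ℝ => Real.exp (-t / 2) * t ^ b) (Ioi 0) := by
  have := integrableOn_rpow_mul_exp_neg_mul_rpow hb zero_lt_one (b := 1 / 2) (by norm_num)
  refine this.congr_fun (fun t _ => ?_) measurableSet_Ioi
  simp only [Real.rpow_one]
  rw [mul_comm]; congr 2; ring

section ray
variable {ζ : ℂ} (hre : 0 ≤ ζ.re) (hn : ‖ζ‖ = 1)
include hre hn

omit hn in
theorem continuousOn_rayIntegrand (β γ : ℂ) {r : ℝ} (hr : 0 < r) :
    ContinuousOn (rayIntegrand β γ ζ r) (Ioi 0) := by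
  unfold rayIntegrand
  intro t ht
  have h1 := ray_mem_slitPlane hre ht hr
  have h2 : (t : ℂ) ∈ Complex.slitPlane := Complex.ofReal_mem_slitPlane.mpr ht
  apply ContinuousAt.continuousWithinAt
  refine ContinuousAt.mul (ContinuousAt.mul (by fun_prop) ?_) ?_
  · exact (Complex.continuous_ofReal.continuousAt).cpow continuousAt_const h2
  · refine ContinuousAt.cpow (by fun_prop) continuousAt_const h1

theorem aestronglyMeasurable_rayIntegrand (β γ : ℂ) {r : ℝ} (hr : 0 < r) :
    AEStronglyMeasurable (rayIntegrand β γ ζ r) (volume.restrict (Ioi 0)) :=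
  (continuousOn_rayIntegrand hre β γ hr).aestronglyMeasurable measurableSet_Ioi

/-- A bound that is locally uniform in `r > 0`. -/
theorem exists_norm_rayIntegrand_le (β γ : ℂ) {a b : ℝ} (ha : 0 < a) :
    ∃ C : ℝ, ∀ r ∈ Icc a b, ∀ t ∈ Ioi (0 : ℝ),
      ‖rayIntegrand β γ ζ r t‖ ≤ C * (Real.exp (-t / 2) * t ^ β.re) := by
  obtain ⟨C, hC, h⟩ := exists_rpow_le_exp_half |γ.re|
  refine ⟨Real.exp (Real.pi * |γ.im|) *
    ((2 * a) ^ γ.re + C * Real.exp ((2 * b + 1) / 2)), fun r hr t ht => ?_⟩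
  have ht : 0 < t := ht
  have hr0 : 0 < r := ha.trans_le hr.1
  refine (norm_rayIntegrand_le β γ ζ ht r).trans ?_
  rw [mul_assoc (Real.exp (Real.pi * |γ.im|)) (_ + _)]
  refine mul_le_mul_of_nonneg_left ?_ (Real.exp_pos _).le
  set N := ‖(t : ℂ) + 2 * ζ * r‖ with hN
  have h1 : 2 * a ≤ N := (by linarith [hr.1]  : 2 * a ≤ 2 * r).trans (two_mul_le_norm_ray hre hn ht hr0)
  -- The extra `1` brings the base into the range `1 ≤ y` where the exponential bound is available.
  have h2 : N ≤ t + 2 * b + 1 := (norm_ray_le hn ht hr0).trans (by linarith [hr.2])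
  have h3 : N ^ γ.re ≤ (2 * a) ^ γ.re + C * Real.exp ((2 * b + 1) / 2) * Real.exp (t / 2) := by
    rcases le_total γ.re 0 with hg | hg
    · have : N ^ γ.re ≤ (2 * a) ^ γ.re :=
        Real.rpow_le_rpow_of_nonpos (by positivity) h1 hg
      have : 0 ≤ C * Real.exp ((2 * b + 1) / 2) * Real.exp (t / 2) := by positivity
      linarith
    · have h4 : N ^ γ.re ≤ (t + 2 * b + 1) ^ γ.re := by gcongr
      have h5 := h (t + 2 * b + 1) (by linarith [hr.1, hr.2])
      rw [abs_of_nonneg hg] at h5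
      have h6 : Real.exp ((t + 2 * b + 1) / 2) = Real.exp ((2 * b + 1) / 2) * Real.exp (t / 2) := by
        rw [← Real.exp_add]; congr 1; ring
      have : 0 ≤ (2 * a) ^ γ.re := by positivity
      rw [h6] at h5; nlinarith
  have e1 : Real.exp (-t) = Real.exp (-t / 2) * Real.exp (-t / 2) := by
    rw [← Real.exp_add]; congr 1; ring
  have e2 : Real.exp (-t / 2) * Real.exp (t / 2) = 1 := by
    rw [← Real.exp_add]; simp [neg_div]
  have e3 : Real.exp (-t / 2) ≤ 1 := Real.exp_le_one_iff.mpr (by linarith)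
  have e4 : Real.exp (-t / 2) * N ^ γ.re ≤ (2 * a) ^ γ.re + C * Real.exp ((2 * b + 1) / 2) := by
    calc _ ≤ Real.exp (-t / 2) * ((2 * a) ^ γ.re + C * Real.exp ((2 * b + 1) / 2) * Real.exp (t / 2)) := by
          gcongr
      _ = Real.exp (-t / 2) * (2 * a) ^ γ.re + C * Real.exp ((2 * b + 1) / 2) *
            (Real.exp (-t / 2) * Real.exp (t / 2)) := by ring
      _ ≤ _ := by
          rw [e2, mul_one]
          have : 0 ≤ (2 * a) ^ γ.re := by positivity
          nlinarith
  calc Real.exp (-t) * t ^ β.re * N ^ γ.re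
      = (Real.exp (-t / 2) * N ^ γ.re) * (Real.exp (-t / 2) * t ^ β.re) := by rw [e1]; ring
    _ ≤ _ := by gcongr

theorem integrableOn_rayIntegrand {β : ℂ} (hβ : -1 < β.re) (γ : ℂ) {r : ℝ} (hr : 0 < r) :
    IntegrableOn (rayIntegrand β γ ζ r) (Ioi 0) := by
  obtain ⟨C, h⟩ := exists_norm_rayIntegrand_le hre hn β γ (a := r) (b := r) hr
  refine Integrable.mono' ((integrableOn_exp_half_rpow hβ).const_mul C)
    (aestronglyMeasurable_rayIntegrand hre hn β γ hr) ?_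
  exact (ae_restrict_iff' measurableSet_Ioi).mpr (ae_of_all _ fun t ht => h r ⟨le_rfl, le_rfl⟩ t ht)

/-- Differentiation under the integral sign. Lowering `γ` does not affect the singularity `t^β` at
`t = 0`, since `t + 2ζr` stays away from `0` for `r` in a compact subset of `(0,∞)`. -/
theorem hasDerivAt_rayIntegral {β : ℂ} (hβ : -1 < β.re) (γ : ℂ) {r : ℝ} (hr : 0 < r) :
    HasDerivAt (rayIntegral β γ ζ) (2 * ζ * γ * rayIntegral β (γ - 1) ζ r) r := by
  obtain ⟨C, h⟩ := exists_norm_rayIntegrand_le hre hn β (γ - 1) (a := r / 2) (b := 2 * r)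
    (by positivity)
  have hs : Ioo (r / 2) (2 * r) ∈ 𝓝 r := Ioo_mem_nhds (by linarith) (by linarith)
  have hpos : ∀ x ∈ Ioo (r / 2) (2 * r), 0 < x := fun x hx => by have := hx.1; linarith
  have key := hasDerivAt_integral_of_dominated_loc_of_deriv_le
    (μ := volume.restrict (Ioi (0 : ℝ))) (F := fun x t => rayIntegrand β γ ζ x t)
    (F' := fun x t => 2 * ζ * γ * rayIntegrand β (γ - 1) ζ x t)
    (bound := fun t => ‖2 * ζ * γ‖ * (C * (Real.exp (-t / 2) * t ^ β.re))) hs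
    (by filter_upwards [hs] with x hx using
          aestronglyMeasurable_rayIntegrand hre hn β γ (hpos x hx))
    (integrableOn_rayIntegrand hre hn hβ γ hr)
    ((aestronglyMeasurable_rayIntegrand hre hn β (γ - 1) hr).const_mul _)
    ((ae_restrict_iff' measurableSet_Ioi).mpr (ae_of_all _ fun t ht x hx => by
      rw [norm_mul]
      exact mul_le_mul_of_nonneg_left (h x ⟨hx.1.le, hx.2.le⟩ t ht) (norm_nonneg _)))
    (((integrableOn_exp_half_rpow hβ).const_mul C).const_mul _)
    ((ae_restrict_iff' measurableSet_Ioi).mpr (ae_of_all _ fun t ht x hx => by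
      have h1 := ray_mem_slitPlane hre ht (hpos x hx)
      have h2 : HasDerivAt (fun x : ℂ => (t : ℂ) + 2 * ζ * x) (2 * ζ) x := by
        simpa using ((hasDerivAt_id (x : ℂ)).const_mul (2 * ζ)).const_add (t : ℂ)
      have h3 := ((h2.cpow_const (c := γ) h1).const_mul
        (Complex.exp (-(t : ℂ)) * (t : ℂ) ^ β)).comp_ofReal
      exact h3.congr_deriv (by simp only [rayIntegrand]; ring)))
  have h2 := key.2
  simp only [integral_const_mul] at h2
  exact h2

omit hn in
theorem hasDerivAt_rayIntegrand (β γ : ℂ) {r t : ℝ} (hr : 0 < r) (ht : 0 < t) :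
    HasDerivAt (rayIntegrand (β + 1) γ ζ r)
      (-rayIntegrand (β + 1) γ ζ r t + (β + 1) * rayIntegrand β γ ζ r t
        + γ * rayIntegrand (β + 1) (γ - 1) ζ r t) t := by
  have h1 := ray_mem_slitPlane hre ht hr
  have h2 : HasDerivAt (fun x : ℂ => x + 2 * ζ * r) 1 t := (hasDerivAt_id (t : ℂ)).add_const _
  have h3 := h2.cpow_const (c := γ) h1
  have h4 := (hasDerivAt_id' (t : ℂ)).cpow_const (c := β + 1)
    (Complex.ofReal_mem_slitPlane.mpr ht)
  have h5 := ((hasDerivAt_id' (t : ℂ)).fun_neg.cexp.fun_mul h4).fun_mul h3 |>.comp_ofReal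
  refine h5.congr_deriv ?_
  simp only [rayIntegrand, add_sub_cancel_right]
  ring

/-- The three-term relation expressing that the integrals solve a confluent hypergeometric
equation. -/
theorem rayIntegral_relation {β : ℂ} (hβ : -1 < β.re) {r : ℝ} (hr : 0 < r) :
    2 * (β - 1) * (ζ * r) * rayIntegral β (β - 2) ζ r
      - 2 * (β + ζ * r) * rayIntegral β (β - 1) ζ r + rayIntegral β β ζ r = 0 := by
  -- The relation is the integral of an exact `t`-derivative. With `y = t + 2ζr` and `ζr = (y -
  -- t)/2`, factoring out `e^{-t} t^β y^{β-2}` turns the pointwise claim into a polynomial identity.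
  have hpt : ∀ t ∈ Ioi (0 : ℝ), HasDerivAt (rayIntegrand (β + 1) (β - 1) ζ r)
      (-(2 * (β - 1) * (ζ * r) * rayIntegrand β (β - 2) ζ r t
        - 2 * (β + ζ * r) * rayIntegrand β (β - 1) ζ r t + rayIntegrand β β ζ r t)) t := by
    intro t ht
    have ht : 0 < t := ht
    have h0 : ((t : ℂ) + 2 * ζ * r) ≠ 0 :=
      Complex.slitPlane_ne_zero (ray_mem_slitPlane hre ht hr)
    have ht0 : (t : ℂ) ≠ 0 := by exact_mod_cast ht.ne'
    convert hasDerivAt_rayIntegrand hre β (β - 1) hr ht using 1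
    unfold rayIntegrand
    have e1 : (t : ℂ) ^ (β + 1) = t ^ β * t := by rw [Complex.cpow_add _ _ ht0, Complex.cpow_one]
    set y := (t : ℂ) + 2 * ζ * r with hy
    have e2 : y ^ (β - 1) = y ^ (β - 2) * y := by
      nth_rw 3 [← Complex.cpow_one y]
      rw [← Complex.cpow_add _ _ h0]; ring_nf
    have e3 : y ^ β = y ^ (β - 2) * y ^ 2 := by
      rw [← Complex.cpow_natCast, ← Complex.cpow_add _ _ h0]; simp
    have e4 : β - 1 - 1 = β - 2 := by ring
    have e5 : ζ * r = (y - t) / 2 := by rw [hy]; ring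
    rw [e4, e1, e2, e3, e5]
    ring
  have hint : IntegrableOn (fun t => -(2 * (β - 1) * (ζ * r) * rayIntegrand β (β - 2) ζ r t
        - 2 * (β + ζ * r) * rayIntegrand β (β - 1) ζ r t + rayIntegrand β β ζ r t)) (Ioi 0) :=
    ((((integrableOn_rayIntegrand hre hn hβ _ hr).const_mul _).sub
      ((integrableOn_rayIntegrand hre hn hβ _ hr).const_mul _)).add
      (integrableOn_rayIntegrand hre hn hβ _ hr)).neg
  obtain ⟨C, hC⟩ := exists_norm_rayIntegrand_le hre hn (β + 1) (β - 1) (a := r) (b := r) hr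
  have hC' : ∀ t ∈ Ioi (0 : ℝ), ‖rayIntegrand (β + 1) (β - 1) ζ r t‖ ≤
      C * (Real.exp (-t / 2) * t ^ (β.re + 1)) := by
    intro t ht
    simpa using hC r ⟨le_rfl, le_rfl⟩ t ht
  -- The exponent was raised to `β + 1` so that `-1 < β.re` kills the boundary term at `t = 0`.
  have h0 : rayIntegrand (β + 1) (β - 1) ζ r 0 = 0 := by
    have : β + 1 ≠ 0 := fun h => by
      have := congrArg Complex.re h; simp at this; linarith
    simp [rayIntegrand, Complex.zero_cpow this]
  have hcont : ContinuousWithinAt (rayIntegrand (β + 1) (β - 1) ζ r) (Ici 0) 0 := by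
    rw [← continuousWithinAt_Ioi_iff_Ici, ContinuousWithinAt, h0]
    apply squeeze_zero_norm' (a := fun t => C * (Real.exp (-t / 2) * t ^ (β.re + 1)))
    · filter_upwards [self_mem_nhdsWithin] with t ht using hC' t ht
    · have : ContinuousAt (fun t : ℝ => C * (Real.exp (-t / 2) * t ^ (β.re + 1))) 0 := by
        refine continuousAt_const.mul (ContinuousAt.mul (by fun_prop) ?_)
        exact (Real.continuousAt_rpow_const _ _ (Or.inr (by linarith)))
      have h := this.tendsto
      simp only [Real.zero_rpow (by linarith : β.re + 1 ≠ 0), mul_zero] at h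
      exact h.mono_left nhdsWithin_le_nhds
  have htop : Tendsto (rayIntegrand (β + 1) (β - 1) ζ r) atTop (𝓝 0) := by
    apply squeeze_zero_norm' (a := fun t => C * (Real.exp (-t / 2) * t ^ (β.re + 1)))
    · filter_upwards [Ioi_mem_atTop 0] with t ht using hC' t ht
    · have := tendsto_rpow_mul_exp_neg_mul_atTop_nhds_zero (β.re + 1) (1 / 2) (by norm_num)
      have h2 := this.const_mul C
      rw [mul_zero] at h2
      refine h2.congr fun t => ?_
      rw [mul_comm (Real.exp _)]; congr 3; ring
  have := integral_Ioi_of_hasDerivAt_of_tendsto hcont hpt hint htop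
  rw [h0, sub_zero, integral_neg, integral_add, integral_sub, integral_const_mul,
    integral_const_mul, neg_eq_zero] at this
  · exact this
  · exact (integrableOn_rayIntegrand hre hn hβ _ hr).const_mul _
  · exact (integrableOn_rayIntegrand hre hn hβ _ hr).const_mul _
  · exact ((integrableOn_rayIntegrand hre hn hβ _ hr).const_mul _).sub
      ((integrableOn_rayIntegrand hre hn hβ _ hr).const_mul _)
  · exact (integrableOn_rayIntegrand hre hn hβ _ hr)

/-- Because `2r ≤ |t + 2ζr|`, lowering the exponent by one gains a factor `r⁻¹`. The power on the
right is independent of `k`, which is what a symbol estimate demands. -/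
theorem exists_norm_rayIntegral_le {β : ℂ} (hβ : -1 < β.re) (k : ℕ) :
    ∃ C : ℝ, ∀ r : ℝ, 1 ≤ r → ‖(r : ℂ) ^ k * rayIntegral β (β - k) ζ r‖ ≤ C * r ^ |β.re| := by
  obtain ⟨C, hC, h⟩ := exists_rpow_le_exp_half |β.re|
  set A : ℝ := Real.exp (Real.pi * |β.im|) * (2 ^ |β.re| * (C * Real.exp (1 / 2)))
  refine ⟨A * ∫ t in Ioi (0 : ℝ), Real.exp (-t / 2) * t ^ β.re, fun r hr => ?_⟩
  have hr0 : 0 < r := by linarith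
  unfold rayIntegral
  rw [← integral_const_mul]
  have hb : ∀ t ∈ Ioi (0 : ℝ), ‖(r : ℂ) ^ k * rayIntegrand β (β - k) ζ r t‖ ≤
      A * r ^ |β.re| * (Real.exp (-t / 2) * t ^ β.re) := by
    intro t ht
    have ht : 0 < t := ht
    have h1 := norm_rayIntegrand_le β (β - k) ζ ht r
    simp only [Complex.sub_im, Complex.natCast_im, sub_zero, Complex.sub_re,
      Complex.natCast_re] at h1
    set N := ‖(t : ℂ) + 2 * ζ * r‖ with hN
    have hN1 : 2 * r ≤ N := two_mul_le_norm_ray hre hn ht hr0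
    have hN2 : N ≤ t + 2 * r := norm_ray_le hn ht hr0
    have hN0 : 0 < N := by linarith
    have h2 : r ^ k * N ^ (β.re - k) ≤ N ^ |β.re| := by
      calc r ^ k * N ^ (β.re - k) ≤ N ^ k * N ^ (β.re - k) := by
            gcongr; linarith
        _ = N ^ β.re := by
            rw [← Real.rpow_natCast N k, ← Real.rpow_add hN0]; congr 1; ring
        _ ≤ N ^ |β.re| := Real.rpow_le_rpow_of_exponent_le (by linarith) (le_abs_self _)
    have h3 : N ^ |β.re| ≤ 2 ^ |β.re| * r ^ |β.re| * (C * Real.exp (1 / 2) * Real.exp (t / 2)) := by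
      have h4 : N ≤ 2 * r * (t + 1) := by nlinarith
      have h5 := h (t + 1) (by linarith)
      have h6 : Real.exp ((t + 1) / 2) = Real.exp (1 / 2) * Real.exp (t / 2) := by
        rw [← Real.exp_add]; congr 1; ring
      calc N ^ |β.re| ≤ (2 * r * (t + 1)) ^ |β.re| := by gcongr
        _ = 2 ^ |β.re| * r ^ |β.re| * (t + 1) ^ |β.re| := by
            rw [Real.mul_rpow (by positivity) (by positivity), Real.mul_rpow (by positivity) hr0.le]
        _ ≤ _ := by rw [mul_assoc C, ← h6]; gcongr
    have e1 : Real.exp (-t) * Real.exp (t / 2) = Real.exp (-t / 2) := by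
      rw [← Real.exp_add]; congr 1; ring
    rw [norm_mul, norm_pow, Complex.norm_real, Real.norm_of_nonneg hr0.le]
    calc r ^ k * ‖rayIntegrand β (β - k) ζ r t‖
        ≤ r ^ k * (Real.exp (Real.pi * |β.im|) * (Real.exp (-t) * t ^ β.re * N ^ (β.re - k))) := by
          gcongr
      _ = Real.exp (Real.pi * |β.im|) * (Real.exp (-t) * t ^ β.re) * (r ^ k * N ^ (β.re - k)) := by
          ring
      _ ≤ Real.exp (Real.pi * |β.im|) * (Real.exp (-t) * t ^ β.re) *
          (2 ^ |β.re| * r ^ |β.re| * (C * Real.exp (1 / 2) * Real.exp (t / 2))) := by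
          exact mul_le_mul_of_nonneg_left (h2.trans h3) (by positivity)
      _ = _ := by rw [← e1]; simp only [A]; ring
  have := norm_integral_le_of_norm_le ((integrableOn_exp_half_rpow hβ).const_mul (A * r ^ |β.re|))
    ((ae_restrict_iff' measurableSet_Ioi).mpr (ae_of_all _ hb))
  refine this.trans (le_of_eq ?_)
  rw [integral_const_mul]; ring

/-- At `r = 0` the integrand becomes `e^{-t} t^{2β}`, an Euler integral convergent for `-(1/2) <
β.re`. Its nonvanishing fixes the exact size of the recessive solution at the origin. -/
theorem tendsto_rayIntegral {β : ℂ} (hβ : -(1 / 2) < β.re) :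
    Tendsto (rayIntegral β β ζ) (𝓝[>] 0) (𝓝 (Complex.Gamma (2 * β + 1))) := by
  obtain ⟨C, hC, h⟩ := exists_rpow_le_exp_half |β.re|
  have hlim : Complex.Gamma (2 * β + 1) =
      ∫ t in Ioi (0 : ℝ), Complex.exp (-(t : ℂ)) * (t : ℂ) ^ β * (t : ℂ) ^ β := by
    rw [Complex.Gamma_eq_integral (by simp; linarith), Complex.GammaIntegral]
    refine setIntegral_congr_fun measurableSet_Ioi fun t ht => ?_
    have ht0 : (t : ℂ) ≠ 0 := by exact_mod_cast (ne_of_gt ht)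
    simp only [mul_assoc, ← Complex.cpow_add _ _ ht0]
    push_cast
    congr 2
    ring
  rw [hlim]
  refine tendsto_integral_filter_of_dominated_convergence
    (fun t => Real.exp (Real.pi * |β.im|) * (C * Real.exp (3 / 2) * (Real.exp (-t / 2) * t ^ β.re)
      + Real.exp (-t / 2) * t ^ (2 * β.re))) ?_ ?_ ?_ ?_
  · filter_upwards [self_mem_nhdsWithin] with r hr
      using aestronglyMeasurable_rayIntegrand hre hn β β hr
  · have : Ioo (0 : ℝ) 1 ∈ 𝓝[>] (0 : ℝ) := Ioo_mem_nhdsGT one_pos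
    filter_upwards [this] with r hr
    refine (ae_restrict_iff' measurableSet_Ioi).mpr (ae_of_all _ fun t ht => ?_)
    have ht : 0 < t := ht
    have h1 := norm_rayIntegrand_le β β ζ ht r
    refine h1.trans ?_
    gcongr ?_ * ?_
    set N := ‖(t : ℂ) + 2 * ζ * r‖ with hN
    have hN1 : t ≤ N := le_norm_ray hre hn ht hr.1
    have hN2 : N ≤ t + 2 * r := norm_ray_le hn ht hr.1
    have e1 : Real.exp (-t) * Real.exp (t / 2) = Real.exp (-t / 2) := by
      rw [← Real.exp_add]; congr 1; ring
    -- A negative power is controlled by `t ≤ N`, a nonnegative one by `N ≤ t + 2r`; the dominating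
    -- function is the sum of the two resulting majorants.
    rcases le_total β.re 0 with hg | hg
    · have h2 : N ^ β.re ≤ t ^ β.re := Real.rpow_le_rpow_of_nonpos ht hN1 hg
      have h3 : t ^ (2 * β.re) = t ^ β.re * t ^ β.re := by rw [← Real.rpow_add ht]; ring_nf
      have h4 : Real.exp (-t) ≤ Real.exp (-t / 2) := Real.exp_le_exp.mpr (by linarith)
      have : 0 ≤ C * Real.exp (3 / 2) * (Real.exp (-t / 2) * t ^ β.re) := by positivity
      rw [h3]
      calc _ ≤ Real.exp (-t / 2) * t ^ β.re * t ^ β.re := by gcongr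
        _ ≤ _ := by linarith
    · have h2 : N ^ β.re ≤ (t + 3) ^ β.re := by
        gcongr; linarith [hr.2]
      have h5 := h (t + 3) (by linarith)
      rw [abs_of_nonneg hg] at h5
      have h6 : Real.exp ((t + 3) / 2) = Real.exp (3 / 2) * Real.exp (t / 2) := by
        rw [← Real.exp_add]; congr 1; ring
      have : 0 ≤ Real.exp (-t / 2) * t ^ (2 * β.re) := by positivity
      calc _ ≤ Real.exp (-t) * t ^ β.re * (C * Real.exp ((t + 3) / 2)) := by
            gcongr; exact h2.trans h5
        _ = C * Real.exp (3 / 2) * ((Real.exp (-t) * Real.exp (t / 2)) * t ^ β.re) := by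
            rw [h6]; ring
        _ ≤ _ := by rw [e1]; linarith
  · exact (((integrableOn_exp_half_rpow (by linarith)).const_mul _).add
      (integrableOn_exp_half_rpow (by linarith))).const_mul _
  · refine (ae_restrict_iff' measurableSet_Ioi).mpr (ae_of_all _ fun t ht => ?_)
    have ht : 0 < t := ht
    have h1 : ContinuousAt (fun r : ℝ => rayIntegrand β β ζ r t) 0 := by
      unfold rayIntegrand
      refine continuousAt_const.mul (ContinuousAt.cpow (by fun_prop) continuousAt_const ?_)
      simpa using ht
    have h2 := h1.tendsto.mono_left (nhdsWithin_le_nhds (s := Ioi 0))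
    simpa [rayIntegrand] using h2

end ray

/-! ### Symbols at infinity and the radial equation -/

/-- `f` lies in a linear space of functions which is invariant under `r ∂_r` on `(0,∞)` and whose
elements are `O(r^C)` on `[1,∞)`. -/
def IsSymbolAtTop (C : ℝ) (f : ℝ → ℂ) : Prop :=
  ∃ M : Submodule ℂ (ℝ → ℂ), f ∈ M ∧
    (∀ h ∈ M, ∃ h' ∈ M, ∀ r : ℝ, 0 < r → HasDerivAt h (h' r / r) r) ∧
    ∀ h ∈ M, ∃ K : ℝ, ∀ r : ℝ, 1 ≤ r → ‖h r‖ ≤ K * r ^ C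

/-- The span of the sequence serves as the invariant space: both requirements are linear, so they
need checking only on generators. -/
theorem isSymbolAtTop_of_seq {C : ℝ} (f f' : ℕ → ℝ → ℂ)
    (hf' : ∀ j, f' j ∈ Submodule.span ℂ (range f))
    (hd : ∀ j, ∀ r : ℝ, 0 < r → HasDerivAt (f j) (f' j r / r) r)
    (hb : ∀ j, ∃ K : ℝ, ∀ r : ℝ, 1 ≤ r → ‖f j r‖ ≤ K * r ^ C) (j : ℕ) :
    IsSymbolAtTop C (f j) := by
  refine ⟨Submodule.span ℂ (range f), Submodule.subset_span ⟨j, rfl⟩, fun h hh => ?_,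
    fun h hh => ?_⟩
  · induction hh using Submodule.span_induction with
    | mem x hx =>
      obtain ⟨i, rfl⟩ := hx
      exact ⟨f' i, hf' i, hd i⟩
    | zero => exact ⟨0, Submodule.zero_mem _, fun r _ => by simp⟩
    | add x y _ _ hx hy =>
      obtain ⟨x', hx', hxd⟩ := hx
      obtain ⟨y', hy', hyd⟩ := hy
      exact ⟨x' + y', Submodule.add_mem _ hx' hy', fun r hr =>
        ((hxd r hr).add (hyd r hr)).congr_deriv (by simp; ring)⟩
    | smul a x _ hx =>
      obtain ⟨x', hx', hxd⟩ := hx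
      exact ⟨a • x', Submodule.smul_mem _ _ hx', fun r hr =>
        ((hxd r hr).const_smul a).congr_deriv (by simp; ring)⟩
  · induction hh using Submodule.span_induction with
    | mem x hx =>
      obtain ⟨i, rfl⟩ := hx
      exact hb i
    | zero => exact ⟨0, fun r _ => by simp⟩
    | add x y _ _ hx hy =>
      obtain ⟨K, hK⟩ := hx
      obtain ⟨L, hL⟩ := hy
      exact ⟨K + L, fun r hr => (norm_add_le _ _).trans (by linarith [hK r hr, hL r hr])⟩
    | smul a x _ hx =>
      obtain ⟨K, hK⟩ := hx
      refine ⟨‖a‖ * K, fun r hr => ?_⟩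
      rw [Pi.smul_apply, norm_smul, mul_assoc]
      exact mul_le_mul_of_nonneg_left (hK r hr) (norm_nonneg _)

/-- The product of the two invariant spaces, taken inside the algebra of functions, is invariant by
the Leibniz rule, and the orders add. -/
theorem IsSymbolAtTop.mul {C D : ℝ} {f g : ℝ → ℂ} (hf : IsSymbolAtTop C f)
    (hg : IsSymbolAtTop D g) : IsSymbolAtTop (C + D) (f * g) := by
  obtain ⟨M, hfM, hMd, hMb⟩ := hf
  obtain ⟨N, hgN, hNd, hNb⟩ := hg
  refine ⟨M * N, Submodule.mul_mem_mul hfM hgN, fun h hh => ?_, fun h hh => ?_⟩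
  · induction hh using Submodule.mul_induction_on' with
    | mem_mul_mem x hx y hy =>
      obtain ⟨x', hx', hxd⟩ := hMd x hx
      obtain ⟨y', hy', hyd⟩ := hNd y hy
      exact ⟨x' * y + x * y', Submodule.add_mem _ (Submodule.mul_mem_mul hx' hy)
        (Submodule.mul_mem_mul hx hy'), fun r hr =>
        ((hxd r hr).mul (hyd r hr)).congr_deriv (by simp; ring)⟩
    | add x _ y _ hx hy =>
      obtain ⟨x', hx', hxd⟩ := hx
      obtain ⟨y', hy', hyd⟩ := hy
      exact ⟨x' + y', Submodule.add_mem _ hx' hy', fun r hr =>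
        ((hxd r hr).add (hyd r hr)).congr_deriv (by simp; ring)⟩
  · induction hh using Submodule.mul_induction_on' with
    | mem_mul_mem x hx y hy =>
      obtain ⟨K, hK⟩ := hMb x hx
      obtain ⟨L, hL⟩ := hNb y hy
      refine ⟨K * L, fun r hr => ?_⟩
      have hr0 : 0 < r := by linarith
      rw [Pi.mul_apply, norm_mul, Real.rpow_add hr0]
      calc _ ≤ (K * r ^ C) * (L * r ^ D) :=
            mul_le_mul (hK r hr) (hL r hr) (norm_nonneg _) ((norm_nonneg _).trans (hK r hr))
        _ = _ := by ring
    | add x _ y _ hx hy =>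
      obtain ⟨K, hK⟩ := hx
      obtain ⟨L, hL⟩ := hy
      exact ⟨K + L, fun r hr => (norm_add_le _ _).trans (by linarith [hK r hr, hL r hr])⟩

/-- A symbol cannot oscillate. -/
theorem IsSymbolAtTop.eq_zero_of_oscillating {C : ℝ} {f : ℝ → ℂ} (hf : IsSymbolAtTop C f)
    {ζ c : ℂ} (hζ : ζ ≠ 0) (hre : ζ.re = 0)
    (h : ∀ r : ℝ, 0 < r → f r = c * Complex.exp (ζ * r)) : c = 0 := by
  obtain ⟨M, hfM, hMd, hMb⟩ := hf
  -- Applying `r ∂_r` to `r^m c e^{ζr}` gives `m r^m c e^{ζr} + ζ r^{m+1} c e^{ζr}`, so every power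
  -- of `r` times the exponential lies in a space whose elements are all `O(r^C)`. As `|e^{ζr}| =
  -- 1`, a power `m > C` forces `c = 0`.
  have key : ∀ m : ℕ, ∃ g ∈ M, ∀ r : ℝ, 0 < r → g r = r ^ m * (c * Complex.exp (ζ * r)) := by
    intro m
    induction m with
    | zero => exact ⟨f, hfM, by simpa using h⟩
    | succ m ih =>
      obtain ⟨g, hgM, hg⟩ := ih
      obtain ⟨g', hg'M, hgd⟩ := hMd g hgM
      refine ⟨ζ⁻¹ • (g' - (m : ℂ) • g), Submodule.smul_mem _ _
        (Submodule.sub_mem _ hg'M (Submodule.smul_mem _ _ hgM)), fun r hr => ?_⟩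
      have hr0 : (r : ℂ) ≠ 0 := by exact_mod_cast hr.ne'
      have h1 : HasDerivAt (fun z : ℂ => z ^ m * (c * Complex.exp (ζ * z)))
          ((m * (r : ℂ) ^ (m - 1)) * (c * Complex.exp (ζ * r))
            + r ^ m * (c * (Complex.exp (ζ * r) * (ζ * 1)))) r :=
        (hasDerivAt_pow m (r : ℂ)).fun_mul
          ((((hasDerivAt_id' (r : ℂ)).const_mul ζ).cexp).const_mul c)
      have h2 : HasDerivAt g _ r := h1.comp_ofReal.congr_of_eventuallyEq (by
        filter_upwards [lt_mem_nhds hr] with x hx using hg x hx)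
      have h3 := (hgd r hr).unique h2
      rw [div_eq_iff hr0] at h3
      simp only [Pi.smul_apply, Pi.sub_apply, smul_eq_mul, hg r hr, h3]
      rcases m with _ | m
      · simp; field_simp
      · simp only [Nat.add_sub_cancel]; field_simp; ring
  by_contra hc
  have hcpos : 0 < ‖c‖ := norm_pos_iff.mpr hc
  obtain ⟨m, hm⟩ := exists_nat_gt C
  obtain ⟨g, hgM, hg⟩ := key m
  obtain ⟨K, hK⟩ := hMb g hgM
  have hlim : Tendsto (fun r : ℝ => r ^ ((m : ℝ) - C)) atTop atTop :=
    tendsto_rpow_atTop (by linarith)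
  obtain ⟨r, hr1, hr2⟩ := ((hlim.eventually_gt_atTop (K / ‖c‖)).and (Ici_mem_atTop 1)).exists
  have hr1' : 1 ≤ r := hr2
  have hr0 : 0 < r := by linarith
  have h1 := hK r hr1'
  rw [hg r hr0, norm_mul, norm_mul, Complex.norm_exp, norm_pow, Complex.norm_real,
    Real.norm_of_nonneg hr0.le] at h1
  simp only [Complex.mul_re, hre, Complex.ofReal_re, zero_mul, Complex.ofReal_im, mul_zero,
    sub_zero, Real.exp_zero, mul_one] at h1
  rw [div_lt_iff₀ hcpos, Real.rpow_sub hr0, Real.rpow_natCast] at hr1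
  have : 0 < r ^ C := by positivity
  rw [div_mul_eq_mul_div, lt_div_iff₀ this] at hr1
  linarith

theorem isSymbolAtTop_rpow (a : ℝ) : IsSymbolAtTop a (fun r : ℝ => ((r ^ a : ℝ) : ℂ)) := by
  refine isSymbolAtTop_of_seq (fun _ r => ((r ^ a : ℝ) : ℂ)) (fun _ r => a * ((r ^ a : ℝ) : ℂ))
    (fun j => Submodule.smul_mem _ (a : ℂ) (Submodule.subset_span ⟨0, rfl⟩)) (fun j r hr => ?_)
    (fun j => ⟨1, fun r hr => ?_⟩) 0
  · have := (Real.hasDerivAt_rpow_const (x := r) (p := a) (Or.inl hr.ne')).ofReal_comp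
    refine this.congr_deriv ?_
    rw [Real.rpow_sub_one hr.ne']
    push_cast; ring
  · have hr0 : 0 < r := by linarith
    rw [Complex.norm_real, Real.norm_of_nonneg (by positivity), one_mul]

/-- The element of a symbol space obtained by applying `r ∂_r`. -/
theorem IsSymbolAtTop.deriv {C : ℝ} {f f' : ℝ → ℂ} (hf : IsSymbolAtTop C f)
    (hd : ∀ r : ℝ, 0 < r → HasDerivAt f (f' r / r) r) :
    ∃ g, IsSymbolAtTop C g ∧ ∀ r : ℝ, 0 < r → g r = f' r := by
  obtain ⟨M, hfM, hMd, hMb⟩ := hf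
  obtain ⟨g, hg, hgd⟩ := hMd f hfM
  refine ⟨g, ⟨M, hg, hMd, hMb⟩, fun r hr => ?_⟩
  have hr0 : (r : ℂ) ≠ 0 := by exact_mod_cast hr.ne'
  have := (hgd r hr).unique (hd r hr)
  field_simp at this
  exact this

theorem IsSymbolAtTop.bound {C : ℝ} {f : ℝ → ℂ} (hf : IsSymbolAtTop C f) :
    ∃ K : ℝ, ∀ r : ℝ, 1 ≤ r → ‖f r‖ ≤ K * r ^ C := by
  obtain ⟨M, hfM, -, hMb⟩ := hf
  exact hMb f hfM

theorem IsSymbolAtTop.sub {C : ℝ} {f g : ℝ → ℂ} (hf : IsSymbolAtTop C f)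
    (hg : IsSymbolAtTop C g) : IsSymbolAtTop C (f - g) := by
  obtain ⟨M, hfM, hMd, hMb⟩ := hf
  obtain ⟨N, hgN, hNd, hNb⟩ := hg
  refine ⟨M ⊔ N, Submodule.sub_mem _ (Submodule.mem_sup_left hfM) (Submodule.mem_sup_right hgN),
    fun h hh => ?_, fun h hh => ?_⟩
  all_goals obtain ⟨x, hx, y, hy, rfl⟩ := Submodule.mem_sup.mp hh
  · obtain ⟨x', hx', hxd⟩ := hMd x hx
    obtain ⟨y', hy', hyd⟩ := hNd y hy
    exact ⟨x' + y', Submodule.add_mem_sup hx' hy', fun r hr =>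
      ((hxd r hr).add (hyd r hr)).congr_deriv (by simp; ring)⟩
  · obtain ⟨K, hK⟩ := hMb x hx
    obtain ⟨L, hL⟩ := hNb y hy
    exact ⟨K + L, fun r hr => (norm_add_le _ _).trans (by linarith [hK r hr, hL r hr])⟩

/-! ### Construction of the recessive solution -/

section recessive
variable {ζ : ℂ} (hre : 0 ≤ ζ.re) (hn : ‖ζ‖ = 1)

/-- The functions `r^{s+k} ∫ e^{-t} t^β (t + 2ζr)^{β-k} dt`. -/
def recessiveAmplitude (β s ζ : ℂ) (k : ℕ) (r : ℝ) : ℂ :=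
  (r : ℂ) ^ (s + k) * rayIntegral β (β - k) ζ r

include hre hn

/-- The factor `r` produced by `r ∂_r` is absorbed into `r^{s+k+1}`, so the amplitudes span a space
invariant under `r ∂_r`. -/
theorem hasDerivAt_recessiveAmplitude {β : ℂ} (hβ : -1 < β.re) (s : ℂ) (k : ℕ) {r : ℝ}
    (hr : 0 < r) :
    HasDerivAt (recessiveAmplitude β s ζ k)
      (((s + k) * recessiveAmplitude β s ζ k r
        + 2 * ζ * (β - k) * recessiveAmplitude β s ζ (k + 1) r) / r) r := by
  have hr0 : (r : ℂ) ≠ 0 := by exact_mod_cast hr.ne'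
  have h1 := ((hasDerivAt_id' (r : ℂ)).cpow_const (c := s + k)
    (Complex.ofReal_mem_slitPlane.mpr hr)).comp_ofReal
  have h2 := h1.fun_mul (hasDerivAt_rayIntegral hre hn hβ (β - k) hr)
  refine h2.congr_deriv ?_
  unfold recessiveAmplitude
  have e1 : β - ((k + 1 : ℕ) : ℂ) = β - k - 1 := by push_cast; ring
  have e2 : (r : ℂ) ^ (s + ((k + 1 : ℕ) : ℂ)) = r ^ (s + k) * r := by
    rw [Nat.cast_add, ← add_assoc, Complex.cpow_add _ _ hr0]; simp
  rw [e1, e2, Complex.cpow_sub _ _ hr0, Complex.cpow_one]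
  field_simp

theorem isSymbolAtTop_recessiveAmplitude {β : ℂ} (hβ : -1 < β.re) (s : ℂ) (k : ℕ) :
    IsSymbolAtTop (s.re + |β.re|) (recessiveAmplitude β s ζ k) := by
  refine isSymbolAtTop_of_seq (recessiveAmplitude β s ζ)
    (fun k => (s + k) • recessiveAmplitude β s ζ k
        + (2 * ζ * (β - k)) • recessiveAmplitude β s ζ (k + 1))
    (fun j => Submodule.add_mem _ (Submodule.smul_mem _ _ (Submodule.subset_span ⟨j, rfl⟩))
      (Submodule.smul_mem _ _ (Submodule.subset_span ⟨j + 1, rfl⟩)))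
    (fun j r hr => by simpa using hasDerivAt_recessiveAmplitude hre hn hβ s j hr)
    (fun j => ?_) k
  obtain ⟨C, hC⟩ := exists_norm_rayIntegral_le hre hn hβ j
  refine ⟨C, fun r hr => ?_⟩
  have hr0 : 0 < r := by linarith
  have hr0' : (r : ℂ) ≠ 0 := by exact_mod_cast hr0.ne'
  unfold recessiveAmplitude
  rw [Complex.cpow_add _ _ hr0', Complex.cpow_natCast, mul_assoc, norm_mul,
    Complex.norm_cpow_eq_rpow_re_of_pos hr0, Real.rpow_add hr0]
  calc _ ≤ r ^ s.re * (C * r ^ |β.re|) := by gcongr; exact hC r hr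
    _ = _ := by ring

/-- The radial equation for `e^{-ζr}` times the amplitude. -/
theorem exists_recessive_solution {ν : ℂ} (hν : 0 < ν.re) (d : ℕ) :
    ∃ K K₁ g : ℝ → ℂ, ∃ C : ℝ,
      (∀ r : ℝ, 0 < r → HasDerivAt K (K₁ r) r) ∧
      (∀ r : ℝ, 0 < r → HasDerivAt K₁
        (((ν ^ 2 - (((d : ℂ) - 1) / 2) ^ 2) / r ^ 2 + ζ ^ 2) * K r - d / r * K₁ r) r) ∧
      (∃ c > 0, ∀ᶠ r : ℝ in 𝓝[>] 0, c * r ^ (-(((d : ℝ) - 1) / 2) - ν.re) ≤ ‖K r‖) ∧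
      (∀ r : ℝ, K r = Complex.exp (-ζ * r) * g r) ∧ IsSymbolAtTop C g := by
  set β : ℂ := ν - 1 / 2 with hβdef
  -- This is `s = -(d-1)/2 - ν`, the more singular of the two indicial roots.
  set s : ℂ := -β - d / 2 with hsdef
  have hβre : β.re = ν.re - 1 / 2 := by simp [hβdef]
  have hsre : s.re = -(((d : ℝ) - 1) / 2) - ν.re := by
    have : ((d : ℂ) / 2).re = (d : ℝ) / 2 := by
      rw [← Complex.ofReal_natCast, ← Complex.ofReal_ofNat, ← Complex.ofReal_div, Complex.ofReal_re]
    rw [hsdef, Complex.sub_re, Complex.neg_re, hβre, this]; ring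
  have hβ : -1 < β.re := by rw [hβre]; linarith
  set A := recessiveAmplitude β s ζ
  have hE : ∀ r : ℝ, HasDerivAt (fun r : ℝ => Complex.exp (-ζ * r)) (-ζ * Complex.exp (-ζ * r)) r := by
    intro r
    have := ((hasDerivAt_id' (r : ℂ)).const_mul (-ζ)).cexp.comp_ofReal
    exact this.congr_deriv (by ring)
  have hA := fun k (r : ℝ) (hr : 0 < r) => hasDerivAt_recessiveAmplitude hre hn hβ s k hr
  set K₁ : ℝ → ℂ := fun r => Complex.exp (-ζ * r) *
    (((s + (0 : ℕ)) * A 0 r + 2 * ζ * (β - (0 : ℕ)) * A 1 r) / r - ζ * A 0 r) with hK₁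
  refine ⟨fun r => Complex.exp (-ζ * r) * A 0 r, K₁, A 0, s.re + |β.re|,
    fun r hr => ((hE r).fun_mul (hA 0 r hr)).congr_deriv (by rw [hK₁]; ring),
    fun r hr => ?_, ?_, fun r => rfl, isSymbolAtTop_recessiveAmplitude hre hn hβ s 0⟩
  · have hr0 : (r : ℂ) ≠ 0 := by exact_mod_cast hr.ne'
    have hinv : HasDerivAt (fun r : ℝ => ((r : ℂ))⁻¹) (-((r : ℂ) ^ 2)⁻¹) r :=
      (hasDerivAt_inv hr0).comp_ofReal
    have h1 := (hE r).fun_mul (((((hA 0 r hr).const_mul (s + (0 : ℕ))).fun_add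
      ((hA 1 r hr).const_mul (2 * ζ * (β - (0 : ℕ))))).fun_mul hinv).fun_sub
      ((hA 0 r hr).const_mul ζ))
    simp only [← div_eq_mul_inv] at h1
    refine h1.congr_deriv ?_
    -- The three-term relation multiplied by `r · r^s`. Once `ν² - ((d-1)/2)²` is written as `s² +
    -- (d-1)s`, the radial equation is a multiple of it.
    have hrel : 2 * (β - 1) * ζ * A 2 r - 2 * (β + ζ * r) * A 1 r + r * A 0 r = 0 := by
      have h := rayIntegral_relation hre hn hβ hr
      have e1 : (r : ℂ) ^ (s + ((1 : ℕ) : ℂ)) = r ^ s * r := by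
        rw [Complex.cpow_add _ _ hr0]; simp
      have e2 : (r : ℂ) ^ (s + ((2 : ℕ) : ℂ)) = r ^ s * r ^ 2 := by
        rw [Complex.cpow_add _ _ hr0, Complex.cpow_natCast]
      simp only [A, recessiveAmplitude, e1, e2]
      simp only [Nat.cast_zero, add_zero, sub_zero, Nat.cast_one, Nat.cast_ofNat]
      linear_combination (r : ℂ) * (r : ℂ) ^ s * h
    have hr' : (r : ℂ) * A 0 r = 2 * (β + ζ * r) * A 1 r - 2 * (β - 1) * ζ * A 2 r := by
      linear_combination hrel
    have hν' : ν ^ 2 - (((d : ℂ) - 1) / 2) ^ 2 = s ^ 2 + (d - 1) * s := by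
      rw [hsdef, hβdef]; ring
    have hd' : (d : ℂ) = -2 * s - 2 * β := by rw [hsdef]; ring
    rw [hν', hK₁]
    simp only [Nat.cast_zero, add_zero, sub_zero, Nat.cast_one, zero_add]
    norm_num
    rw [hd']
    field_simp
    linear_combination (2 * β * ζ) * hrel
  · have hlim := tendsto_rayIntegral hre hn (β := β) (by rw [hβre]; linarith)
    have hG : Complex.Gamma (2 * β + 1) ≠ 0 := by
      apply Complex.Gamma_ne_zero_of_re_pos
      simp [hβre]; linarith
    have h1 := hlim.norm
    have h2 := h1.eventually (lt_mem_nhds (half_lt_self (norm_pos_iff.mpr hG)))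
    have hIoo : Ioo (0 : ℝ) 1 ∈ 𝓝[>] (0 : ℝ) := Ioo_mem_nhdsGT one_pos
    refine ⟨Real.exp (-1) * (‖Complex.Gamma (2 * β + 1)‖ / 2), by positivity, ?_⟩
    filter_upwards [h2, hIoo] with r hr hr1
    simp only [A, recessiveAmplitude, Nat.cast_zero, add_zero, sub_zero]
    rw [norm_mul, norm_mul, Complex.norm_exp, Complex.norm_cpow_eq_rpow_re_of_pos hr1.1, hsre]
    have h3 : Real.exp (-1) ≤ Real.exp ((-ζ * r).re) := by
      apply Real.exp_le_exp.mpr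
      have : ζ.re ≤ 1 := (Complex.re_le_norm ζ).trans hn.le
      simp
      nlinarith [hr1.1, hr1.2]
    calc _ = Real.exp (-1) * (r ^ (-(((d : ℝ) - 1) / 2) - ν.re) *
            (‖Complex.Gamma (2 * β + 1)‖ / 2)) := by ring
      _ ≤ _ := by
          have := hr1.1
          gcongr

end recessive

/-- Uniqueness of the Cauchy problem for a linear second order equation on `(0,∞)`. -/
theorem eq_zero_of_linear_ode {p q : ℝ → ℂ} (hp : ContinuousOn p (Ioi 0))
    (hq : ContinuousOn q (Ioi 0)) {u u₁ : ℝ → ℂ}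
    (hu : ∀ r : ℝ, 0 < r → HasDerivAt u (u₁ r) r)
    (hu₁ : ∀ r : ℝ, 0 < r → HasDerivAt u₁ (p r * u r + q r * u₁ r) r)
    {a : ℝ} (ha : 0 < a) (h0 : u a = 0) (h1 : u₁ a = 0) {b : ℝ} (hb : a ≤ b) : u b = 0 := by
  have hsub : Icc a b ⊆ Ioi 0 := fun x hx => ha.trans_le hx.1
  obtain ⟨P, hP⟩ := isCompact_Icc.exists_bound_of_continuousOn (hp.mono hsub)
  obtain ⟨Q, hQ⟩ := isCompact_Icc.exists_bound_of_continuousOn (hq.mono hsub)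
  have hP0 : 0 ≤ P := (norm_nonneg _).trans (hP a ⟨le_rfl, hb⟩)
  have hQ0 : 0 ≤ Q := (norm_nonneg _).trans (hQ a ⟨le_rfl, hb⟩)
  -- The uniqueness theorem wants a Lipschitz bound at all times, so the field is set to zero
  -- outside `[a, b]`, where the coefficients are not controlled.
  set v : ℝ → ℂ × ℂ → ℂ × ℂ := fun t y =>
    if t ∈ Icc a b then (y.2, p t * y.1 + q t * y.2) else 0 with hv
  have hL : ∀ t, LipschitzWith (Real.toNNReal (1 + P + Q)) (v t) := by
    intro t
    refine LipschitzWith.of_dist_le_mul fun y z => ?_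
    rw [Real.coe_toNNReal _ (by positivity), dist_eq_norm, dist_eq_norm]
    by_cases ht : t ∈ Icc a b
    · simp only [hv, if_pos ht]
      have e1 : ‖(y - z).1‖ ≤ ‖y - z‖ := norm_fst_le _
      have e2 : ‖(y - z).2‖ ≤ ‖y - z‖ := norm_snd_le _
      have n0 := norm_nonneg (y - z)
      rw [Prod.norm_def]
      apply max_le
      · calc ‖(y - z).2‖ ≤ 1 * ‖y - z‖ := by linarith
          _ ≤ _ := by gcongr; linarith
      · have : (p t * y.1 + q t * y.2) - (p t * z.1 + q t * z.2)
            = p t * (y - z).1 + q t * (y - z).2 := by simp; ring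
        calc ‖(p t * y.1 + q t * y.2) - (p t * z.1 + q t * z.2)‖
            ≤ ‖p t‖ * ‖(y - z).1‖ + ‖q t‖ * ‖(y - z).2‖ := by
              rw [this]; exact (norm_add_le _ _).trans (by simp)
          _ ≤ P * ‖y - z‖ + Q * ‖y - z‖ := by
              gcongr
              · exact hP t ht
              · exact hQ t ht
          _ ≤ _ := by nlinarith
    · simp only [hv, if_neg ht, sub_self, norm_zero]; positivity
  have key := ODE_solution_unique (v := v) (f := fun t => (u t, u₁ t)) (g := fun _ => 0) (a := a) (b := b)
    hL (fun t ht => ((hu t (hsub ht)).continuousAt.prodMk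
      (hu₁ t (hsub ht)).continuousAt).continuousWithinAt)
    (fun t ht => by
      have ht' : t ∈ Icc a b := ⟨ht.1, ht.2.le⟩
      simp only [hv, if_pos ht']
      exact ((hu t (hsub ht')).prodMk (hu₁ t (hsub ht'))).hasDerivWithinAt)
    continuousOn_const
    (fun t ht => by
      have : v t 0 = 0 := by simp [hv]
      rw [this]; exact hasDerivWithinAt_const _ _ _)
    (by simp [h0, h1])
  exact congrArg Prod.fst (key ⟨hb, le_rfl⟩)

theorem eq_of_hasDerivAt_zero {s : Set ℝ} (hs : IsOpen s) (hc : IsPreconnected s) {W : ℝ → ℂ}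
    (h : ∀ r ∈ s, HasDerivAt W 0 r) {a b : ℝ} (ha : a ∈ s) (hb : b ∈ s) : W a = W b :=
  hs.is_const_of_deriv_eq_zero hc (fun r hr => (h r hr).differentiableAt.differentiableWithinAt)
    (fun r hr => (h r hr).deriv) ha hb

/-- A solution of the radial equation which is smaller than the singular solution at `0` and
recessive at infinity vanishes. -/
theorem radial_solution_eq_zero {ν ζ : ℂ} (hν : 0 < ν.re) (hre : 0 ≤ ζ.re) (hn : ‖ζ‖ = 1) (d : ℕ)
    {u u₁ : ℝ → ℂ} (hu : ∀ r : ℝ, 0 < r → HasDerivAt u (u₁ r) r)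
    (hu₁ : ∀ r : ℝ, 0 < r → HasDerivAt u₁
        (((ν ^ 2 - (((d : ℂ) - 1) / 2) ^ 2) / r ^ 2 + ζ ^ 2) * u r - d / r * u₁ r) r)
    {κ : ℝ} (hκ : -(((d : ℝ) - 1) / 2) - ν.re < κ)
    (hzero : ∃ B : ℝ, ∀ r ∈ Ioc (0 : ℝ) 1, ‖u r‖ ≤ B * r ^ κ)
    (hosc : ζ.re = 0 → ∃ C f, IsSymbolAtTop C f ∧
      ∀ r : ℝ, 0 < r → f r = Complex.exp (ζ * r) * u r)
    (hdec : 0 < ζ.re → ∀ N : ℝ, ∃ B : ℝ, ∀ r : ℝ, 1 ≤ r →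
      ‖u r‖ ≤ B * r ^ (-N) ∧ ‖u₁ r‖ ≤ B * r ^ (-N)) :
    ∀ r : ℝ, 0 < r → u r = 0 := by
  obtain ⟨K, K₁, g, C, hK, hK₁, ⟨c, hc, hlow⟩, hKg, hg⟩ := exists_recessive_solution hre hn hν d
  have hE : ∀ r : ℝ, HasDerivAt (fun r : ℝ => Complex.exp (ζ * r)) (ζ * Complex.exp (ζ * r)) r := by
    intro r
    have := ((hasDerivAt_id' (r : ℂ)).const_mul ζ).cexp.comp_ofReal
    exact this.congr_deriv (by ring)
  have hexp : ∀ r : ℝ, Complex.exp (-ζ * r) * Complex.exp (ζ * r) = 1 := fun r => by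
    rw [← Complex.exp_add]; simp
  have hgK : ∀ r : ℝ, g r = Complex.exp (ζ * r) * K r := fun r => by
    rw [hKg, ← mul_assoc, mul_comm (Complex.exp (ζ * r)), hexp, one_mul]
  have hamp : ∀ {f y y₁ : ℝ → ℂ}, (∀ r : ℝ, 0 < r → HasDerivAt y (y₁ r) r) →
      (∀ r : ℝ, 0 < r → f r = Complex.exp (ζ * r) * y r) → ∀ r : ℝ, 0 < r →
      HasDerivAt f ((r * (Complex.exp (ζ * r) * (y₁ r + ζ * y r))) / r) r := by
    intro f y y₁ hy hf r hr
    have hr0 : (r : ℂ) ≠ 0 := by exact_mod_cast hr.ne'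
    have h1 := ((hE r).fun_mul (hy r hr)).congr_of_eventuallyEq (f₁ := f) (by
      filter_upwards [lt_mem_nhds hr] with x hx using hf x hx)
    refine h1.congr_deriv ?_
    field_simp; ring
  obtain ⟨g₁, hg₁, hg₁'⟩ := hg.deriv (hamp hK (fun r _ => hgK r))
  -- Abel's identity: the factor `r^d` compensates the first-order term `-(d/r)∂_r`, so this
  -- weighted Wronskian is constant.
  set W : ℝ → ℂ := fun r => (r : ℂ) ^ d * (u r * K₁ r - u₁ r * K r) with hW
  have hWd : ∀ r ∈ Ioi (0 : ℝ), HasDerivAt W 0 r := by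
    intro r hr
    have hr : 0 < r := hr
    have hr0 : (r : ℂ) ≠ 0 := by exact_mod_cast hr.ne'
    have h1 : HasDerivAt (fun r : ℝ => (r : ℂ) ^ d) (d * (r : ℂ) ^ (d - 1)) r :=
      (hasDerivAt_pow d (r : ℂ)).comp_ofReal
    refine (h1.fun_mul (((hu r hr).fun_mul (hK₁ r hr)).fun_sub
      ((hu₁ r hr).fun_mul (hK r hr)))).congr_deriv ?_
    rcases d with _ | d
    · simp; ring
    · simp only [Nat.add_sub_cancel]; field_simp; ring
  have hconst : ∀ r : ℝ, 0 < r → W r = W 1 := fun r hr =>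
    eq_of_hasDerivAt_zero isOpen_Ioi isPreconnected_Ioi hWd hr (mem_Ioi.mpr one_pos)
  have hW1 : W 1 = 0 := by
    rcases hre.eq_or_lt with h0 | h0
    · obtain ⟨D, f, hf, hfu⟩ := hosc h0.symm
      obtain ⟨f₁, hf₁, hf₁'⟩ := hf.deriv (hamp hu hfu)
      -- With `f = e^{ζr} u` and `g = e^{ζr} K`, the terms containing `ζ` cancel in `f (r∂_r g) -
      -- (r∂_r f) g`. What remains, multiplied by `r^{d-1}`, is `e^{2ζr} W`.
      have hsym := ((hf.mul hg₁).sub (hf₁.mul hg)).mul (isSymbolAtTop_rpow ((d : ℝ) - 1))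
      have hζ : ζ ≠ 0 := by rintro rfl; simp at hn
      refine hsym.eq_zero_of_oscillating (ζ := 2 * ζ) (by simpa using hζ) (by simp [← h0])
        (fun r hr => ?_)
      have hr0 : (r : ℂ) ≠ 0 := by exact_mod_cast hr.ne'
      have hpow : (((r ^ ((d : ℝ) - 1) : ℝ)) : ℂ) = r ^ d / r := by
        rw [Real.rpow_sub_one hr.ne', Real.rpow_natCast]; push_cast; rfl
      have h2 : Complex.exp (2 * ζ * r) = Complex.exp (ζ * r) ^ 2 := by
        rw [← Complex.exp_nat_mul]; congr 1; push_cast; ring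
      simp only [Pi.mul_apply, Pi.sub_apply]
      rw [hpow, ← hconst r hr, hg₁' r hr, hf₁' r hr, hfu r hr, hgK r, h2, hW]
      field_simp; ring
    · obtain ⟨L, hL⟩ := hg.bound
      obtain ⟨L₁, hL₁⟩ := hg₁.bound
      -- The order is chosen to beat `r^d` from the Wronskian and `r^C` from `K` and `K₁`, with
      -- `r⁻¹` to spare.
      obtain ⟨B, hB⟩ := hdec h0 (C + d + 1)
      have hKb : ∀ r : ℝ, 1 ≤ r → ‖K r‖ ≤ L * r ^ C := by
        intro r hr
        rw [hKg, norm_mul, Complex.norm_exp]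
        have : Real.exp ((-ζ * r).re) ≤ 1 := by
          apply Real.exp_le_one_iff.mpr; simp; positivity
        calc _ ≤ 1 * ‖g r‖ := by gcongr
          _ ≤ _ := by rw [one_mul]; exact hL r hr
      have hK₁b : ∀ r : ℝ, 1 ≤ r → ‖K₁ r‖ ≤ (L₁ + L) * r ^ C := by
        intro r hr
        have hr0 : 0 < r := by linarith
        have hr0' : (r : ℂ) ≠ 0 := by exact_mod_cast hr0.ne'
        have e : K₁ r = Complex.exp (-ζ * r) * g₁ r / r - ζ * K r := by
          have e' : Complex.exp (-ζ * r) * (r * (Complex.exp (ζ * r) * (K₁ r + ζ * K r)))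
              = r * ((Complex.exp (-ζ * r) * Complex.exp (ζ * r)) * (K₁ r + ζ * K r)) := by ring
          rw [hg₁' r hr0, e', hexp, one_mul, mul_div_cancel_left₀ _ hr0']
          ring
        have h1 : Real.exp ((-ζ * r).re) ≤ 1 := by
          apply Real.exp_le_one_iff.mpr; simp; positivity
        rw [e]
        refine (norm_sub_le _ _).trans ?_
        rw [norm_div, norm_mul, norm_mul, hn, one_mul, Complex.norm_exp, Complex.norm_real,
          Real.norm_of_nonneg hr0.le]
        have h2 : Real.exp ((-ζ * r).re) * ‖g₁ r‖ / r ≤ ‖g₁ r‖ := by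
          rw [div_le_iff₀ hr0]
          have := norm_nonneg (g₁ r)
          nlinarith [mul_le_mul_of_nonneg_right h1 this]
        linarith [hL₁ r hr, hKb r hr]
      have hlim : Tendsto (fun r : ℝ => (B * (L₁ + L) + B * L) * r⁻¹) atTop (𝓝 0) := by
        simpa using tendsto_inv_atTop_zero.const_mul (B * (L₁ + L) + B * L)
      have hle : ∀ᶠ r : ℝ in atTop, ‖W 1‖ ≤ (B * (L₁ + L) + B * L) * r⁻¹ := by
        filter_upwards [Ici_mem_atTop 1] with r hr
        have hr : 1 ≤ r := hr
        have hr0 : 0 < r := by linarith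
        rw [← hconst r hr0, hW]
        simp only
        rw [norm_mul, norm_pow, Complex.norm_real, Real.norm_of_nonneg hr0.le]
        obtain ⟨b1, b2⟩ := hB r hr
        have hpow : r ^ d * (r ^ (-(C + d + 1)) * r ^ C) = r⁻¹ := by
          rw [← Real.rpow_add hr0, ← Real.rpow_natCast, ← Real.rpow_add hr0,
            ← Real.rpow_neg_one]; congr 1; ring
        calc _ ≤ r ^ d * (‖u r‖ * ‖K₁ r‖ + ‖u₁ r‖ * ‖K r‖) := by
              gcongr; exact (norm_sub_le _ _).trans (by simp)
          _ ≤ r ^ d * ((B * r ^ (-(C + d + 1))) * ((L₁ + L) * r ^ C)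
              + (B * r ^ (-(C + d + 1))) * (L * r ^ C)) := by
              have n1 := (norm_nonneg _).trans b1
              gcongr
              · exact hK₁b r hr
              · exact hKb r hr
          _ = (B * (L₁ + L) + B * L) * (r ^ d * (r ^ (-(C + d + 1)) * r ^ C)) := by ring
          _ = _ := by rw [hpow]
      exact norm_le_zero_iff.mp (ge_of_tendsto hlim hle)
  have hwr : ∀ r : ℝ, 0 < r → u r * K₁ r = u₁ r * K r := by
    intro r hr
    have hr0 : (r : ℂ) ≠ 0 := by exact_mod_cast hr.ne'
    have := (hconst r hr).trans hW1
    rw [hW] at this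
    simpa [hr0, sub_eq_zero] using this
  obtain ⟨δ, hδ, hδK⟩ := (mem_nhdsGT_iff_exists_Ioo_subset' (one_pos)).mp hlow
  have hδ : 0 < δ := hδ
  obtain ⟨B, hB⟩ := hzero
  have hKne : ∀ r ∈ Ioo 0 δ, K r ≠ 0 := by
    intro r hr h
    have h1 := hδK hr
    simp only [mem_ofPred_eq, h, norm_zero] at h1
    have : 0 < c * r ^ (-(((d : ℝ) - 1) / 2) - ν.re) := mul_pos hc (Real.rpow_pos_of_pos hr.1 _)
    linarith
  -- With zero Wronskian and `K ≠ 0` near the origin, `u / K` is constant there. The constant is `0`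
  -- because `u = O(r^κ)` with `κ` larger than the exponent of `K`.
  have hquot : ∀ r ∈ Ioo 0 δ, HasDerivAt (fun r => u r / K r) 0 r := by
    intro r hr
    refine ((hu r hr.1).fun_div (hK r hr.1) (hKne r hr)).congr_deriv ?_
    rw [hwr r hr.1, sub_self, zero_div]
  have hu0 : ∀ r ∈ Ioo 0 δ, u r = 0 := by
    intro r₀ hr₀
    have hlim : Tendsto (fun r : ℝ => B / c * r ^ (κ - (-(((d : ℝ) - 1) / 2) - ν.re)))
        (𝓝[>] 0) (𝓝 0) := by
      have h1 : ContinuousAt (fun r : ℝ => B / c * r ^ (κ - (-(((d : ℝ) - 1) / 2) - ν.re))) 0 :=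
        continuousAt_const.mul (Real.continuousAt_rpow_const _ _ (Or.inr (by linarith)))
      have h2 := h1.tendsto
      rw [Real.zero_rpow (by linarith), mul_zero] at h2
      exact h2.mono_left nhdsWithin_le_nhds
    have hle : ∀ᶠ r : ℝ in 𝓝[>] 0, ‖u r₀ / K r₀‖ ≤
        B / c * r ^ (κ - (-(((d : ℝ) - 1) / 2) - ν.re)) := by
      filter_upwards [Ioo_mem_nhdsGT hδ, Ioo_mem_nhdsGT one_pos] with r hr hr1
      have e : u r₀ / K r₀ = u r / K r :=
        eq_of_hasDerivAt_zero (W := fun r => u r / K r) isOpen_Ioo isPreconnected_Ioo hquot hr₀ hr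
      have h1 := hδK hr
      simp only [mem_ofPred_eq] at h1
      have h2 := hB r ⟨hr1.1, hr1.2.le⟩
      have hp : 0 < r ^ (-(((d : ℝ) - 1) / 2) - ν.re) := Real.rpow_pos_of_pos hr.1 _
      rw [e, norm_div, Real.rpow_sub hr.1]
      have n0 := (norm_nonneg _).trans h2
      calc ‖u r‖ / ‖K r‖ ≤ (B * r ^ κ) / (c * r ^ (-(((d : ℝ) - 1) / 2) - ν.re)) := by gcongr
        _ = _ := by field_simp
    have := norm_le_zero_iff.mp (ge_of_tendsto hlim hle)
    exact (div_eq_zero_iff.mp this).resolve_right (hKne r₀ hr₀)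
  intro r hr
  rcases lt_or_ge r δ with h | h
  · exact hu0 r ⟨hr, h⟩
  · have hmem : δ / 2 ∈ Ioo 0 δ := ⟨by linarith, by linarith⟩
    refine eq_zero_of_linear_ode (a := δ / 2) (b := r)
      (p := fun r : ℝ => (ν ^ 2 - (((d : ℂ) - 1) / 2) ^ 2) / (r : ℂ) ^ 2 + ζ ^ 2)
      (q := fun r : ℝ => -((d : ℂ) / r)) ?_ ?_ hu (fun r hr => (hu₁ r hr).congr_deriv (by ring))
      hmem.1 (hu0 _ hmem) ?_ (by linarith)
    · intro x hx
      have hx0 : (x : ℂ) ≠ 0 := by exact_mod_cast (ne_of_gt hx)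
      exact ContinuousAt.continuousWithinAt (by fun_prop (disch := simpa using hx0))
    · intro x hx
      have hx0 : (x : ℂ) ≠ 0 := by exact_mod_cast (ne_of_gt hx)
      exact ContinuousAt.continuousWithinAt (by fun_prop (disch := simpa using hx0))
    · have h1 : HasDerivAt u 0 (δ / 2) := (hasDerivAt_const _ (0 : ℂ)).congr_of_eventuallyEq (by
        filter_upwards [Ioo_mem_nhds hmem.1 hmem.2] with x hx using hu0 x hx)
      exact (hu _ hmem.1).unique h1

/-! ### Homogeneous extensions -/

/-- The ambient Euclidean space of `UnitSphere d`. -/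
abbrev Ambient (d : ℕ) : Type := EuclideanSpace ℝ (Fin (d + 1))

/-- Radial projection to the sphere, with an arbitrary value at the origin. -/
def radialProj {d : ℕ} (x : Ambient d) : UnitSphere d :=
  if h : x = 0 then ⟨EuclideanSpace.single 0 1, by simp⟩
  else ⟨‖x‖⁻¹ • x, by simp [norm_smul, h]⟩

theorem homExt_eq {d : ℕ} (f : UnitSphere d → ℂ) {x : Ambient d} (hx : x ≠ 0) :
    homExt f x = f (radialProj x) := by
  simp [homExt, radialProj, hx]

theorem radialProj_coe {d : ℕ} (θ : UnitSphere d) : radialProj (θ : Ambient d) = θ := by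
  have h1 : ‖(θ : Ambient d)‖ = 1 := by simp
  have h : (θ : Ambient d) ≠ 0 := fun h => by rw [h] at h1; simp at h1
  ext1
  simp [radialProj, h]

theorem sphere_ne_zero {d : ℕ} (θ : UnitSphere d) : (θ : Ambient d) ≠ 0 := by
  have h1 : ‖(θ : Ambient d)‖ = 1 := by simp
  exact fun h => by rw [h] at h1; simp at h1

theorem homExt_coe {d : ℕ} (f : UnitSphere d → ℂ) (θ : UnitSphere d) :
    homExt f (θ : Ambient d) = f θ := by
  rw [homExt_eq f (sphere_ne_zero θ), radialProj_coe]

theorem radialProj_smul {d : ℕ} {s : ℝ} (hs : 0 < s) (x : Ambient d) :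
    radialProj (s • x) = radialProj x := by
  by_cases hx : x = 0
  · simp [hx]
  · have : s • x ≠ 0 := smul_ne_zero hs.ne' hx
    ext1
    simp only [radialProj, hx, this, dif_neg, not_false_eq_true, norm_smul, Real.norm_of_nonneg hs.le]
    rw [smul_smul]
    congr 1
    field_simp

theorem homExt_smul {d : ℕ} (f : UnitSphere d → ℂ) {s : ℝ} (hs : 0 < s) (x : Ambient d) :
    homExt f (s • x) = homExt f x := by
  by_cases hx : x = 0
  · simp [hx]
  · rw [homExt_eq f hx, homExt_eq f (smul_ne_zero hs.ne' hx), radialProj_smul hs]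

/-- Smoothness into the sphere follows from smoothness of `x / |x|` as a map into the ambient space.
Working on the open submanifold `{0}ᶜ` gives a map that lands in the sphere everywhere, as
restriction of the codomain requires. -/
theorem contMDiffAt_radialProj {d : ℕ} {x : Ambient d} (hx : x ≠ 0) :
    ContMDiffAt 𝓘(ℝ, Ambient d) (𝓡 d) ∞ (radialProj (d := d)) x := by
  let U : TopologicalSpace.Opens (Ambient d) := ⟨{0}ᶜ, isOpen_compl_singleton⟩
  have h1 : ContMDiff 𝓘(ℝ, Ambient d) 𝓘(ℝ, Ambient d) ∞
      (fun y : U => (‖(y : Ambient d)‖⁻¹ • (y : Ambient d))) := by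
    intro y
    refine (contMDiffAt_subtype_iff (U := U)
      (f := fun z : Ambient d => ‖z‖⁻¹ • z)).mpr ?_
    have hy : (y : Ambient d) ≠ 0 := y.2
    exact (((contDiffAt_norm ℝ hy).inv (norm_ne_zero_iff.mpr hy)).smul contDiffAt_id).contMDiffAt
  have h2 : ∀ y : U, ‖(y : Ambient d)‖⁻¹ • (y : Ambient d) ∈ Metric.sphere (0 : Ambient d) 1 := by
    intro y
    have hy : (y : Ambient d) ≠ 0 := y.2
    simp [norm_smul, hy]
  have := Fact.mk (@finrank_euclideanSpace_fin ℝ _ (d + 1))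
  have h3 := ContMDiff.codRestrict_sphere (E := EuclideanSpace ℝ (Fin (d + 1))) (n := d) h1 h2
  have h4 := h3 ⟨x, hx⟩
  refine (contMDiffAt_subtype_iff (U := U) (f := radialProj (d := d)) (x := ⟨x, hx⟩)).mp ?_
  have h5 : (fun y : U => radialProj (y : Ambient d)) = codRestrict _ _ h2 := by
    funext y
    have hy : (y : Ambient d) ≠ 0 := y.2
    ext1
    simp [radialProj, hy]
  rw [h5]
  exact h4

theorem contDiffAt_homExt {d : ℕ} {f : UnitSphere d → ℂ} (hf : SmoothSphere f) {x : Ambient d}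
    (hx : x ≠ 0) : ContDiffAt ℝ ∞ (homExt f) x := by
  have h1 : ContMDiffAt 𝓘(ℝ, Ambient d) 𝓘(ℝ, ℂ) ∞ (f ∘ radialProj) x :=
    (hf (radialProj x)).comp x (contMDiffAt_radialProj hx)
  refine h1.contDiffAt.congr_of_eventuallyEq ?_
  filter_upwards [isOpen_ne.mem_nhds hx] with y hy using homExt_eq f hy

/-- Turns smoothness on the manifold `(0,∞) × 𝕊` into ordinary differentiability on an open subset
of a vector space, where later derivatives are taken. -/
theorem contDiffAt_homExt_rad {d : ℕ} {u : RadFun d} (hu : SmoothRadOn (Ioi 0) u) {r : ℝ}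
    (hr : 0 < r) {x : Ambient d} (hx : x ≠ 0) :
    ContDiffAt ℝ ∞ (fun p : ℝ × Ambient d => homExt (u p.1) p.2) (r, x) := by
  have h0 : ContMDiffAt (𝓘(ℝ, ℝ).prod (𝓡 d)) 𝓘(ℝ, ℂ) ∞
      (fun q : ℝ × UnitSphere d => u q.1 q.2) (r, radialProj x) :=
    (hu (r, radialProj x) ⟨hr, mem_univ _⟩).contMDiffAt
      ((isOpen_Ioi.prod isOpen_univ).mem_nhds ⟨hr, mem_univ _⟩)
  have h2 : ContMDiffAt 𝓘(ℝ, ℝ × Ambient d) (𝓘(ℝ, ℝ).prod (𝓡 d)) ∞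
      (fun p : ℝ × Ambient d => (p.1, radialProj p.2)) (r, x) :=
    (contDiff_fst.contMDiff (r, x)).prodMk
      (ContMDiffAt.comp (r, x) (g := radialProj (d := d)) (f := fun p : ℝ × Ambient d => p.2)
        (contMDiffAt_radialProj hx) (contDiff_snd.contMDiff (r, x)))
  have h1 := ContMDiffAt.comp (r, x) (g := fun q : ℝ × UnitSphere d => u q.1 q.2)
    (f := fun p : ℝ × Ambient d => (p.1, radialProj p.2)) h0 h2
  refine h1.contDiffAt.congr_of_eventuallyEq ?_
  have : ∀ᶠ p : ℝ × Ambient d in 𝓝 (r, x), p.2 ≠ 0 :=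
    (continuousAt_snd (p := (r, x))).eventually_ne hx
  filter_upwards [this] with p hp using homExt_eq _ hp

/-- The partial derivative in the direction of the `i`-th basis vector. -/
def partialDeriv {d : ℕ} (i : Fin (d + 1)) (F : Ambient d → ℂ) (x : Ambient d) : ℂ :=
  fderiv ℝ F x (EuclideanSpace.single i 1)

theorem laplacian_eq_sum_partialDeriv {d : ℕ} {F : Ambient d → ℂ} {x : Ambient d}
    (hF : ContDiffAt ℝ 2 F x) :
    Laplacian.laplacian F x = ∑ i, partialDeriv i (partialDeriv i F) x := by
  rw [InnerProductSpace.laplacian_eq_iteratedFDeriv_orthonormalBasis F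
    (EuclideanSpace.basisFun (Fin (d + 1)) ℝ)]
  refine Finset.sum_congr rfl fun i _ => ?_
  have h1 : DifferentiableAt ℝ (fderiv ℝ F) x :=
    (hF.fderiv_right (m := 1) le_rfl).differentiableAt one_ne_zero
  rw [iteratedFDeriv_two_apply]
  simp only [EuclideanSpace.basisFun_apply, Matrix.cons_val_zero, Matrix.cons_val_one]
  unfold partialDeriv
  rw [fderiv_clm_apply h1 (differentiableAt_const _)]
  simp

theorem ContDiffAt.partialDeriv {d : ℕ} {F : Ambient d → ℂ} {x : Ambient d} {n m : ℕ∞ω}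
    (hF : ContDiffAt ℝ n F x) (h : m + 1 ≤ n) (i : Fin (d + 1)) :
    ContDiffAt ℝ m (partialDeriv i F) x :=
  (hF.fderiv_right h).clm_apply contDiffAt_const

theorem partialDeriv_mul {d : ℕ} {F G : Ambient d → ℂ} {x : Ambient d}
    (hF : DifferentiableAt ℝ F x) (hG : DifferentiableAt ℝ G x) (i : Fin (d + 1)) :
    partialDeriv i (fun y => F y * G y) x = partialDeriv i F x * G x + F x * partialDeriv i G x := by
  unfold partialDeriv
  rw [fderiv_fun_mul hF hG]
  simp; ring

theorem partialDeriv_conj {d : ℕ} (F : Ambient d → ℂ) (x : Ambient d) (i : Fin (d + 1)) :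
    partialDeriv i (fun y => conj (F y)) x = conj (partialDeriv i F x) := by
  unfold partialDeriv
  have := (Complex.conjCLE : ℂ ≃L[ℝ] ℂ).comp_fderiv (f := F) (x := x)
  have h2 : (fun y => conj (F y)) = (Complex.conjCLE : ℂ ≃L[ℝ] ℂ) ∘ F := by ext; simp
  rw [h2, this]; simp

theorem fderiv_eq_sum_partialDeriv {d : ℕ} (F : Ambient d → ℂ) (x v : Ambient d) :
    fderiv ℝ F x v = ∑ i, (v i : ℂ) * partialDeriv i F x := by
  conv_lhs => rw [← (EuclideanSpace.basisFun (Fin (d + 1)) ℝ).sum_repr v]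
  rw [map_sum]
  refine Finset.sum_congr rfl fun i _ => ?_
  simp [partialDeriv]

theorem laplacian_mul {d : ℕ} {F G : Ambient d → ℂ} {x : Ambient d}
    (hF : ContDiffAt ℝ 2 F x) (hG : ContDiffAt ℝ 2 G x) :
    Laplacian.laplacian (fun y => F y * G y) x = Laplacian.laplacian F x * G x
      + 2 * ∑ i, partialDeriv i F x * partialDeriv i G x + F x * Laplacian.laplacian G x := by
  rw [laplacian_eq_sum_partialDeriv hF, laplacian_eq_sum_partialDeriv hG,
    laplacian_eq_sum_partialDeriv (hF.mul hG), Finset.mul_sum, Finset.sum_mul, Finset.mul_sum,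
    ← Finset.sum_add_distrib, ← Finset.sum_add_distrib]
  refine Finset.sum_congr rfl fun i _ => ?_
  have h1 : partialDeriv i (fun y => F y * G y) =ᶠ[𝓝 x]
      fun y => partialDeriv i F y * G y + F y * partialDeriv i G y := by
    filter_upwards [hF.eventually (by simp), hG.eventually (by simp)] with y hy1 hy2
    exact partialDeriv_mul (hy1.differentiableAt two_ne_zero) (hy2.differentiableAt two_ne_zero) i
  have dF := hF.differentiableAt two_ne_zero
  have dG := hG.differentiableAt two_ne_zero
  have dF' := (hF.partialDeriv (m := 1) le_rfl i).differentiableAt one_ne_zero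
  have dG' := (hG.partialDeriv (m := 1) le_rfl i).differentiableAt one_ne_zero
  conv_lhs => unfold partialDeriv
  have h2 : fderiv ℝ (fun z => fderiv ℝ (fun y => F y * G y) z (EuclideanSpace.single i 1)) x
      = fderiv ℝ (fun y => partialDeriv i F y * G y + F y * partialDeriv i G y) x := h1.fderiv_eq
  rw [h2, fderiv_fun_add (dF'.fun_mul dG) (dF.fun_mul dG'), add_apply]
  have h3 := partialDeriv_mul dF' dG i
  have h4 := partialDeriv_mul dF dG' i
  unfold partialDeriv at h3 h4 ⊢
  rw [h3, h4]; ring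

theorem partialDeriv_homExt_smul {d : ℕ} (f : UnitSphere d → ℂ) {s : ℝ} (hs : 0 < s)
    (x : Ambient d) (i : Fin (d + 1)) :
    partialDeriv i (homExt f) (s • x) = (s : ℂ)⁻¹ * partialDeriv i (homExt f) x := by
  have h : (fun y => homExt f (s • y)) = homExt f := funext fun y => homExt_smul f hs y
  have h2 := fderiv_comp_smul (𝕜 := ℝ) (f := homExt f) (x := x) (c := s)
  rw [h] at h2
  unfold partialDeriv
  have h3 := congrArg (fun L => L (EuclideanSpace.single i 1)) h2
  simp only [smul_apply] at h3
  rw [h3]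
  have : (s : ℂ) ≠ 0 := by exact_mod_cast hs.ne'
  simp [this]

theorem partialDeriv_partialDeriv_homExt_smul {d : ℕ} (f : UnitSphere d → ℂ) {s : ℝ} (hs : 0 < s)
    (x : Ambient d) (i j : Fin (d + 1)) :
    partialDeriv j (partialDeriv i (homExt f)) (s • x)
      = ((s : ℂ) ^ 2)⁻¹ * partialDeriv j (partialDeriv i (homExt f)) x := by
  have hs0 : (s : ℂ) ≠ 0 := by exact_mod_cast hs.ne'
  have h : (fun y => partialDeriv i (homExt f) (s • y))
      = (s : ℂ)⁻¹ • partialDeriv i (homExt f) := funext fun y => by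
    rw [partialDeriv_homExt_smul f hs]; rfl
  have h2 := fderiv_comp_smul (𝕜 := ℝ) (f := partialDeriv i (homExt f)) (x := x) (c := s)
  rw [h, fderiv_const_smul_field] at h2
  have h3 := congrArg (fun L => L (EuclideanSpace.single j 1)) h2
  simp only [smul_apply] at h3
  conv_lhs => unfold partialDeriv
  conv_rhs => unfold partialDeriv
  unfold partialDeriv at h3
  have h4 : (s : ℂ) * ((s : ℂ)⁻¹ * _) = (s : ℂ) * ((s : ℂ) * _) := congrArg ((s : ℂ) * ·) (by simpa using h3)
  field_simp at h4 ⊢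
  rw [h4]

/-- Euler's identity in degree `0`: the extension is constant along rays, so its gradient is
tangential. -/
theorem sum_mul_partialDeriv_homExt {d : ℕ} {f : UnitSphere d → ℂ} (hf : SmoothSphere f)
    {x : Ambient d} (hx : x ≠ 0) : ∑ i, (x i : ℂ) * partialDeriv i (homExt f) x = 0 := by
  rw [← fderiv_eq_sum_partialDeriv]
  have hd : DifferentiableAt ℝ (homExt f) x := (contDiffAt_homExt hf hx).differentiableAt (by simp)
  have h1 : HasDerivAt (fun s : ℝ => (1 + s) • x) x 0 := by
    simpa using (((hasDerivAt_id (0 : ℝ)).const_add 1).smul_const x)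
  have hd' : HasFDerivAt (homExt f) (fderiv ℝ (homExt f) x) ((1 + (0 : ℝ)) • x) := by
    simpa using hd.hasFDerivAt
  have h2 := hd'.comp_hasDerivAt (0 : ℝ) h1
  have h3 : HasDerivAt (homExt f ∘ fun s : ℝ => (1 + s) • x) 0 0 := by
    refine (hasDerivAt_const (0 : ℝ) (homExt f x)).congr_of_eventuallyEq ?_
    filter_upwards [lt_mem_nhds (show (-1 : ℝ) < 0 by norm_num)] with s hs
    exact homExt_smul f (by linarith) x
  exact h2.unique h3

/-! ### Green's formula on the sphere -/

theorem two_le_smooth : (2 : ℕ∞ω) ≤ ∞ := by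
  change ((2 : ℕ∞) : ℕ∞ω) ≤ _
  exact WithTop.coe_le_coe.mpr le_top

/-- A bump function on the line centered at `1`. -/
def cutoffBump : ContDiffBump (1 : ℝ) := ⟨1 / 4, 1 / 2, by norm_num, by norm_num⟩

/-- A smooth radial cutoff supported in an annulus containing the unit sphere. -/
def radialCutoff {d : ℕ} (x : Ambient d) : ℝ := cutoffBump (‖x‖ ^ 2)

theorem contDiff_radialCutoff (d : ℕ) : ContDiff ℝ ∞ (radialCutoff (d := d)) :=
  cutoffBump.contDiff.comp (contDiff_norm_sq ℝ)

theorem radialCutoff_eq_zero {d : ℕ} {x : Ambient d} (hx : ‖x‖ ^ 2 ≤ 1 / 2 ∨ 3 / 2 ≤ ‖x‖ ^ 2) :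
    radialCutoff x = 0 := by
  apply cutoffBump.zero_of_le_dist
  simp only [cutoffBump, Real.dist_eq]
  rcases hx with h | h
  · rw [abs_sub_comm]; exact le_trans (by linarith) (le_abs_self _)
  · exact le_trans (by linarith) (le_abs_self _)

theorem radialCutoff_nonneg {d : ℕ} (x : Ambient d) : 0 ≤ radialCutoff x := cutoffBump.nonneg

theorem hasCompactSupport_radialCutoff (d : ℕ) : HasCompactSupport (radialCutoff (d := d)) := by
  refine HasCompactSupport.intro (isCompact_closedBall (0 : Ambient d) 2) fun x hx => ?_
  apply radialCutoff_eq_zero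
  right
  simp only [Metric.mem_closedBall, dist_zero_right, not_le] at hx
  nlinarith

theorem radialCutoff_eventually_zero (d : ℕ) : ∀ᶠ x : Ambient d in 𝓝 0, radialCutoff x = 0 := by
  filter_upwards [Metric.ball_mem_nhds (0 : Ambient d) (show (0 : ℝ) < 1 / 2 by norm_num)] with x hx
  apply radialCutoff_eq_zero
  left
  simp only [Metric.mem_ball, dist_zero_right] at hx
  nlinarith [norm_nonneg x]

theorem contDiff_radialCutoff_mul {d : ℕ} {n : ℕ∞ω} (hn : n ≤ ∞) {k : Ambient d → ℂ}
    (hk : ∀ x ≠ 0, ContDiffAt ℝ n k x) :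
    ContDiff ℝ n (fun x => (radialCutoff x : ℂ) * k x) := by
  rw [contDiff_iff_contDiffAt]
  intro x
  by_cases hx : x = 0
  · subst hx
    refine (contDiffAt_const (c := (0 : ℂ))).congr_of_eventuallyEq ?_
    filter_upwards [radialCutoff_eventually_zero d] with y hy
    simp [hy]
  · exact (Complex.ofRealCLM.contDiff.comp
      ((contDiff_radialCutoff d).of_le hn)).contDiffAt.mul (hk x hx)

theorem hasCompactSupport_radialCutoff_mul {d : ℕ} (k : Ambient d → ℂ) :
    HasCompactSupport (fun x => (radialCutoff x : ℂ) * k x) :=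
  ((hasCompactSupport_radialCutoff d).comp_left (g := fun x : ℝ => (x : ℂ)) (by simp)).mul_right

theorem integrable_radialCutoff_mul {d : ℕ} {k : Ambient d → ℂ}
    (hk : ∀ x ≠ 0, ContinuousAt k x) :
    Integrable (fun x => (radialCutoff x : ℂ) * k x) := by
  refine Continuous.integrable_of_hasCompactSupport ?_ (hasCompactSupport_radialCutoff_mul k)
  exact (contDiff_radialCutoff_mul (n := 0) (by simp) fun x hx =>
    by
      rw [contDiffAt_zero]
      exact ⟨{0}ᶜ, isOpen_compl_singleton.mem_nhds hx, fun y hy => (hk y hy).continuousWithinAt⟩).continuous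

theorem integral_partialDeriv_eq_zero {d : ℕ} {G : Ambient d → ℂ} (hG : ContDiff ℝ 1 G)
    (hc : HasCompactSupport G) (i : Fin (d + 1)) : ∫ x, partialDeriv i G x = 0 := by
  have h1 : Integrable (fun x => partialDeriv i G x) := by
    refine Continuous.integrable_of_hasCompactSupport ?_ ?_
    · exact (hG.continuous_fderiv one_ne_zero).clm_apply continuous_const
    · exact (hc.fderiv (𝕜 := ℝ)).comp_left (g := fun L : Ambient d →L[ℝ] ℂ => L (EuclideanSpace.single i 1)) (by simp)
  have := integral_mul_fderiv_eq_neg_fderiv_mul_of_integrable (μ := (volume : Measure (Ambient d)))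
    (f := fun _ => (1 : ℂ)) (g := G) (v := EuclideanSpace.single i 1)
    (by simp) (by simpa [partialDeriv] using h1)
    (by simpa using hG.continuous.integrable_of_hasCompactSupport hc)
    (fun x _ => differentiableAt_const _) (fun x _ => hG.differentiable one_ne_zero x)
  simpa [partialDeriv] using this

/-- The gradient of the cutoff is a multiple of `x`, hence orthogonal to gradients of degree `0`
extensions. -/
theorem partialDeriv_radialCutoff {d : ℕ} (i : Fin (d + 1)) (x : Ambient d) :
    partialDeriv i (fun y => (radialCutoff y : ℂ)) x
      = (2 * deriv cutoffBump (‖x‖ ^ 2) : ℝ) * (x i : ℂ) := by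
  have h1 : HasFDerivAt (fun y : Ambient d => ‖y‖ ^ 2) (2 • innerSL ℝ x) x :=
    (hasStrictFDerivAt_norm_sq x).hasFDerivAt
  have h2 : HasDerivAt cutoffBump (deriv cutoffBump (‖x‖ ^ 2)) (‖x‖ ^ 2) :=
    ((cutoffBump.contDiff (n := 1)).differentiable one_ne_zero _).hasDerivAt
  have h3 := Complex.ofRealCLM.hasFDerivAt.comp x (h2.comp_hasFDerivAt x h1)
  have h4 : fderiv ℝ (fun y : Ambient d => (radialCutoff y : ℂ)) x = _ := h3.fderiv
  unfold partialDeriv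
  rw [h4]
  simp [EuclideanSpace.inner_single_right]
  ring

/-- The energy form `∫ ψ ∇F · ∇\bar H` of homogeneous extensions. -/
def energyForm {d : ℕ} (f h : UnitSphere d → ℂ) : ℂ :=
  ∫ x : Ambient d, (radialCutoff x : ℂ) *
    ∑ i, partialDeriv i (homExt f) x * conj (partialDeriv i (homExt h) x)

theorem energyForm_conj {d : ℕ} (f h : UnitSphere d → ℂ) :
    conj (energyForm f h) = energyForm h f := by
  unfold energyForm
  rw [← integral_conj]
  congr 1
  funext x
  simp only [map_mul, map_sum, Complex.conj_ofReal, Complex.conj_conj]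
  congr 1
  exact Finset.sum_congr rfl fun i _ => mul_comm _ _

theorem exists_energyForm_self_eq {d : ℕ} (f : UnitSphere d → ℂ) :
    ∃ e : ℝ, 0 ≤ e ∧ energyForm f f = e := by
  refine ⟨∫ x : Ambient d, radialCutoff x * ∑ i, ‖partialDeriv i (homExt f) x‖ ^ 2,
    integral_nonneg fun x => mul_nonneg (radialCutoff_nonneg x) (by positivity), ?_⟩
  unfold energyForm
  rw [← integral_complex_ofReal]
  congr 1
  funext x
  push_cast
  congr 1
  refine Finset.sum_congr rfl fun i _ => ?_
  rw [Complex.mul_conj, Complex.normSq_eq_norm_sq]; push_cast; rfl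

section green
variable {d : ℕ} {f h : UnitSphere d → ℂ} (hf : SmoothSphere f) (hh : SmoothSphere h)
include hf

theorem contDiffAt_partialDeriv_homExt (i : Fin (d + 1)) {x : Ambient d} (hx : x ≠ 0) :
    ContDiffAt ℝ ∞ (partialDeriv i (homExt f)) x :=
  (contDiffAt_homExt hf hx).partialDeriv (by simp) i

theorem continuousAt_laplacian_homExt {x : Ambient d} (hx : x ≠ 0) :
    ContinuousAt (Laplacian.laplacian (homExt f)) x := by
  have h1 : ContinuousAt (fun y => ∑ i, partialDeriv i (partialDeriv i (homExt f)) y) x := by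
    have : ∀ i, ContinuousAt (partialDeriv i (partialDeriv i (homExt f))) x := fun i =>
      ((contDiffAt_partialDeriv_homExt hf i hx).partialDeriv (m := 0) (by simp) i).continuousAt
    fun_prop
  refine h1.congr ?_
  filter_upwards [isOpen_ne.mem_nhds hx] with y hy
  exact (laplacian_eq_sum_partialDeriv ((contDiffAt_homExt hf hy).of_le two_le_smooth)).symm

/-- Second derivatives of a degree `0` extension are homogeneous of degree `-2`, so they are
determined by their values on the sphere. -/
theorem laplacian_homExt_eq {x : Ambient d} (hx : x ≠ 0) :
    Laplacian.laplacian (homExt f) x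
      = ((‖x‖ : ℂ) ^ 2)⁻¹ * -sphereLaplacian f (radialProj x) := by
  have hx' : 0 < ‖x‖ := norm_pos_iff.mpr hx
  have e : x = ‖x‖ • (radialProj x : Ambient d) := by
    simp only [radialProj, hx, dif_neg, not_false_eq_true]
    rw [smul_smul, mul_inv_cancel₀ hx'.ne', one_smul]
  unfold sphereLaplacian
  rw [neg_neg, laplacian_eq_sum_partialDeriv ((contDiffAt_homExt hf hx).of_le two_le_smooth),
    laplacian_eq_sum_partialDeriv ((contDiffAt_homExt hf (sphere_ne_zero _)).of_le two_le_smooth),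
    Finset.mul_sum]
  refine Finset.sum_congr rfl fun i _ => ?_
  conv_lhs => rw [e]
  exact partialDeriv_partialDeriv_homExt_smul f hx' _ i i

theorem continuous_sphereLaplacian : Continuous (sphereLaplacian f) := by
  rw [continuous_iff_continuousAt]
  intro θ
  exact ((continuousAt_laplacian_homExt hf (sphere_ne_zero θ)).comp
    continuous_subtype_val.continuousAt).neg

include hh

/-- The divergence theorem for the compactly supported field `ψ H̄ ∇F`, where `ψ` is the cutoff and
`F`, `H` are the extensions. Differentiating `ψ` contributes nothing, since `∇ψ` is radial and `∇F`
is tangential. -/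
theorem integral_laplacian_homExt :
    ∫ x : Ambient d, (radialCutoff x : ℂ) *
      (Laplacian.laplacian (homExt f) x * conj (homExt h x)) = -energyForm f h := by
  have hH : ∀ x : Ambient d, x ≠ 0 → ContDiffAt ℝ ∞ (fun y => conj (homExt h y)) x := fun x hx =>
    (Complex.conjCLE : ℂ ≃L[ℝ] ℂ).contDiff.contDiffAt.comp x (contDiffAt_homExt hh hx)
  have hcd : ∀ i, ∀ x : Ambient d, x ≠ 0 →
      ContDiffAt ℝ ∞ (fun y => partialDeriv i (homExt f) y * conj (homExt h y)) x := fun i x hx =>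
    (contDiffAt_partialDeriv_homExt hf i hx).mul (hH x hx)
  set G : Fin (d + 1) → Ambient d → ℂ := fun i x =>
    (radialCutoff x : ℂ) * (partialDeriv i (homExt f) x * conj (homExt h x)) with hG
  have hGc : ∀ i, ContDiff ℝ ∞ (G i) := fun i => contDiff_radialCutoff_mul le_rfl (hcd i)
  have hGs : ∀ i, HasCompactSupport (G i) := fun i => hasCompactSupport_radialCutoff_mul _
  have h0 : ∫ x : Ambient d, ∑ i, partialDeriv i (G i) x = 0 := by
    rw [integral_finsetSum]
    · exact Finset.sum_eq_zero fun i _ =>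
        integral_partialDeriv_eq_zero ((hGc i).of_le (by simp)) (hGs i) i
    · intro i _
      refine Continuous.integrable_of_hasCompactSupport ?_ ?_
      · exact ((hGc i).continuous_fderiv (by simp)).clm_apply continuous_const
      · exact ((hGs i).fderiv (𝕜 := ℝ)).comp_left
          (g := fun L : Ambient d →L[ℝ] ℂ => L (EuclideanSpace.single i 1)) (by simp)
  have hpt : ∀ x : Ambient d, x ≠ 0 → ∑ i, partialDeriv i (G i) x =
      (radialCutoff x : ℂ) * (Laplacian.laplacian (homExt f) x * conj (homExt h x))
      + (radialCutoff x : ℂ) *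
        ∑ i, partialDeriv i (homExt f) x * conj (partialDeriv i (homExt h) x) := by
    intro x hx
    have hψ : DifferentiableAt ℝ (fun y : Ambient d => (radialCutoff y : ℂ)) x :=
      (Complex.ofRealCLM.contDiff.comp (contDiff_radialCutoff d)).contDiffAt.differentiableAt
        (by simp)
    have h1 : ∀ i, partialDeriv i (G i) x =
        (2 * deriv cutoffBump (‖x‖ ^ 2) : ℝ) * conj (homExt h x)
          * ((x i : ℂ) * partialDeriv i (homExt f) x)
        + (radialCutoff x : ℂ) * conj (homExt h x) * partialDeriv i (partialDeriv i (homExt f)) x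
        + (radialCutoff x : ℂ) *
          (partialDeriv i (homExt f) x * conj (partialDeriv i (homExt h) x)) := by
      intro i
      rw [hG]
      simp only
      rw [partialDeriv_mul hψ ((hcd i x hx).differentiableAt (by simp)),
        partialDeriv_mul ((contDiffAt_partialDeriv_homExt hf i hx).differentiableAt (by simp))
          ((hH x hx).differentiableAt (by simp)), partialDeriv_conj, partialDeriv_radialCutoff]
      ring
    simp only [h1, Finset.sum_add_distrib, ← Finset.mul_sum]
    rw [sum_mul_partialDeriv_homExt hf hx,
      laplacian_eq_sum_partialDeriv ((contDiffAt_homExt hf hx).of_le two_le_smooth)]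
    ring
  have hae : ∀ᵐ x : Ambient d, x ≠ 0 := by
    simp [ae_iff]
  rw [integral_congr_ae (hae.mono hpt), integral_add] at h0
  · exact eq_neg_of_add_eq_zero_left h0
  · exact integrable_radialCutoff_mul fun x hx =>
      (continuousAt_laplacian_homExt hf hx).mul (hH x hx).continuousAt
  · refine integrable_radialCutoff_mul fun x hx => ?_
    have h1 : ∀ i, ContinuousAt (partialDeriv i (homExt f)) x := fun i =>
      (contDiffAt_partialDeriv_homExt hf i hx).continuousAt
    have h2 : ∀ i, ContinuousAt (fun y => conj (partialDeriv i (homExt h) y)) x := fun i =>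
      Complex.continuous_conj.continuousAt.comp
        (contDiffAt_partialDeriv_homExt hh i hx).continuousAt
    fun_prop

end green

/-- Integration in polar coordinates against the cutoff. -/
theorem exists_polar_integral (d : ℕ) : ∃ c : ℝ, 0 < c ∧ ∀ q : UnitSphere d → ℂ,
    ∫ x : Ambient d, (radialCutoff x : ℂ) * (((‖x‖ : ℂ) ^ 2)⁻¹ * q (radialProj x))
      = (∫ θ, q θ ∂(surfaceMeasure d)) * c := by
  set c : ℝ := ∫ r : Ioi (0 : ℝ), cutoffBump ((r : ℝ) ^ 2) * ((r : ℝ) ^ 2)⁻¹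
    ∂(Measure.volumeIoiPow (Module.finrank ℝ (Ambient d) - 1)) with hc
  have key : ∀ q : UnitSphere d → ℂ,
      ∫ x : Ambient d, (radialCutoff x : ℂ) * (((‖x‖ : ℂ) ^ 2)⁻¹ * q (radialProj x))
      = (∫ θ, q θ ∂(surfaceMeasure d)) * c := by
    intro q
    set F : Ambient d → ℂ := fun x =>
      (radialCutoff x : ℂ) * (((‖x‖ : ℂ) ^ 2)⁻¹ * q (radialProj x)) with hF
    calc ∫ x : Ambient d, F x
        = ∫ x : ({(0 : Ambient d)}ᶜ : Set (Ambient d)), F x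
            ∂((volume : Measure (Ambient d)).comap Subtype.val) := by
          rw [integral_subtype_comap (measurableSet_singleton _).compl F,
            restrict_compl_singleton]
      _ = ∫ p : UnitSphere d × Ioi (0 : ℝ), q p.1 *
            ((cutoffBump ((p.2 : ℝ) ^ 2) * ((p.2 : ℝ) ^ 2)⁻¹ : ℝ) : ℂ)
            ∂((volume : Measure (Ambient d)).toSphere.prod
              (.volumeIoiPow (Module.finrank ℝ (Ambient d) - 1))) := by
          rw [← (volume : Measure (Ambient d)).measurePreserving_homeomorphUnitSphereProd.integral_comp
            (Homeomorph.measurableEmbedding _)]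
          congr 1
          funext x
          have hx : (x : Ambient d) ≠ 0 := x.2
          have h1 : (homeomorphUnitSphereProd (Ambient d) x).1 = radialProj (x : Ambient d) := by
            ext1; simp [radialProj, hx]
          rw [hF, h1]
          simp only [homeomorphUnitSphereProd_apply_snd_coe, radialCutoff]
          push_cast
          ring
      _ = _ := by
          rw [integral_prod_mul (L := ℂ) q (fun r : Ioi (0 : ℝ) =>
            ((cutoffBump ((r : ℝ) ^ 2) * ((r : ℝ) ^ 2)⁻¹ : ℝ) : ℂ)), hc, integral_complex_ofReal]
  refine ⟨c, ?_, key⟩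
  -- Positivity of `c` is read off from the identity with `q = 1`, whose left side is the integral
  -- of a continuous nonnegative function that equals `1` at a unit vector.
  have h1 := key (fun _ => 1)
  have h2 : ∀ x : Ambient d, (radialCutoff x : ℂ) * (((‖x‖ : ℂ) ^ 2)⁻¹ * 1)
      = ((radialCutoff x * (‖x‖ ^ 2)⁻¹ : ℝ) : ℂ) := fun x => by push_cast; ring
  simp_rw [h2] at h1
  rw [integral_complex_ofReal, integral_const] at h1
  have h3 : (∫ x : Ambient d, radialCutoff x * (‖x‖ ^ 2)⁻¹) = (surfaceMeasure d).real univ * c := by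
    apply Complex.ofReal_injective; rw [h1]; simp
  have hcont : Continuous (fun x : Ambient d => radialCutoff x * (‖x‖ ^ 2)⁻¹) := by
    rw [continuous_iff_continuousAt]
    intro x
    by_cases hx : x = 0
    · subst hx
      refine (continuousAt_const (y := (0 : ℝ))).congr ?_
      filter_upwards [radialCutoff_eventually_zero d] with y hy
      simp [hy]
    · have h0 : ‖x‖ ^ 2 ≠ 0 := by simpa using hx
      exact (contDiff_radialCutoff d).continuous.continuousAt.mul
        (ContinuousAt.inv₀ (by fun_prop) h0)
  have hpos : 0 < ∫ x : Ambient d, radialCutoff x * (‖x‖ ^ 2)⁻¹ := by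
    refine hcont.integral_pos_of_hasCompactSupport_nonneg_nonzero
      (hasCompactSupport_radialCutoff d).mul_right
      (fun x => mul_nonneg (radialCutoff_nonneg x) (by positivity)) (x := EuclideanSpace.single 0 1) ?_
    have : cutoffBump (1 : ℝ) = 1 := cutoffBump.one_of_mem_closedBall (by simp [cutoffBump])
    simp [radialCutoff, this]
  rw [h3] at hpos
  exact pos_of_mul_pos_right hpos measureReal_nonneg

/-- Green's formula: the Laplacian of the sphere is the operator of a nonnegative form. -/
theorem exists_integral_sphereLaplacian_eq (d : ℕ) : ∃ c : ℝ, 0 < c ∧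
    ∀ f h : UnitSphere d → ℂ, SmoothSphere f → SmoothSphere h →
      ∫ θ, sphereLaplacian f θ * conj (h θ) ∂(surfaceMeasure d) = c * energyForm f h := by
  obtain ⟨c, hc, key⟩ := exists_polar_integral d
  refine ⟨c⁻¹, inv_pos.mpr hc, fun f h hf hh => ?_⟩
  have h1 := key (fun θ => sphereLaplacian f θ * conj (h θ))
  have hae : ∀ᵐ x : Ambient d, x ≠ 0 := by
    simp [ae_iff]
  have h2 : ∫ x : Ambient d, (radialCutoff x : ℂ) * (((‖x‖ : ℂ) ^ 2)⁻¹ *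
      (sphereLaplacian f (radialProj x) * conj (h (radialProj x)))) = energyForm f h := by
    rw [← neg_neg (energyForm f h), ← integral_laplacian_homExt hf hh, ← integral_neg]
    refine integral_congr_ae (hae.mono fun x hx => ?_)
    simp only
    rw [laplacian_homExt_eq hf hx, homExt_eq h hx]
    ring
  rw [h2] at h1
  have hc0 : (c : ℂ) ≠ 0 := by exact_mod_cast hc.ne'
  rw [h1]; push_cast; field_simp

theorem integral_sphereLaplacian_symm {d : ℕ} {f h : UnitSphere d → ℂ} (hf : SmoothSphere f)
    (hh : SmoothSphere h) : ∫ θ, sphereLaplacian f θ * conj (h θ) ∂(surfaceMeasure d)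
      = ∫ θ, f θ * conj (sphereLaplacian h θ) ∂(surfaceMeasure d) := by
  obtain ⟨c, hc, key⟩ := exists_integral_sphereLaplacian_eq d
  have h1 := congrArg conj (key h f hh hf)
  rw [← integral_conj, map_mul, Complex.conj_ofReal, energyForm_conj, ← key f h hf hh] at h1
  rw [← h1]
  congr 1
  funext θ
  simp [mul_comm]

theorem exists_integral_sphereLaplacian_self {d : ℕ} {f : UnitSphere d → ℂ}
    (hf : SmoothSphere f) : ∃ e : ℝ, 0 ≤ e ∧
      ∫ θ, sphereLaplacian f θ * conj (f θ) ∂(surfaceMeasure d) = e := by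
  obtain ⟨c, hc, key⟩ := exists_integral_sphereLaplacian_eq d
  obtain ⟨e, he, h⟩ := exists_energyForm_self_eq f
  exact ⟨c * e, by positivity, by rw [key f f hf hf, h]; push_cast; rfl⟩

/-! ### Spherical polynomials -/

theorem contMDiff_sphere_coe (d : ℕ) :
    ContMDiff (𝓡 d) 𝓘(ℝ, Ambient d) ∞ (Subtype.val : UnitSphere d → Ambient d) := by
  have := Fact.mk (@finrank_euclideanSpace_fin ℝ _ (d + 1))
  exact contMDiff_coe_sphere (E := EuclideanSpace ℝ (Fin (d + 1))) (n := d)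

theorem SmoothSphere.continuous {d : ℕ} {f : UnitSphere d → ℂ} (hf : SmoothSphere f) :
    Continuous f := ContMDiff.continuous hf

theorem integrable_sphere {d : ℕ} {f : UnitSphere d → ℂ} (hf : Continuous f) :
    Integrable f (surfaceMeasure d) :=
  hf.integrable_of_hasCompactSupport (HasCompactSupport.of_compactSpace f)

theorem eq_zero_of_integral_mul_conj_self {d : ℕ} {f : UnitSphere d → ℂ} (hf : Continuous f)
    (h : ∫ θ, f θ * conj (f θ) ∂(surfaceMeasure d) = 0) : f = 0 := by
  have h1 : ∀ θ, f θ * conj (f θ) = ((‖f θ‖ ^ 2 : ℝ) : ℂ) := fun θ => by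
    rw [Complex.mul_conj, Complex.normSq_eq_norm_sq]
  simp_rw [h1] at h
  rw [integral_complex_ofReal, Complex.ofReal_eq_zero] at h
  have hc : Continuous fun θ => ‖f θ‖ ^ 2 := by fun_prop
  have h2 := (integral_eq_zero_iff_of_nonneg (fun θ => by positivity)
    (hc.integrable_of_hasCompactSupport (HasCompactSupport.of_compactSpace _))).mp h
  have h3 := (hc.ae_eq_iff_eq (surfaceMeasure d) (continuous_const (y := (0 : ℝ)))).mp h2
  funext θ
  have : ‖f θ‖ ^ 2 = 0 := congrFun h3 θ
  simpa using this

theorem smoothSphere_zero (d : ℕ) : SmoothSphere (0 : UnitSphere d → ℂ) :=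
  contMDiff_const (c := (0 : ℂ))

theorem SmoothSphere.add {d : ℕ} {f g : UnitSphere d → ℂ} (hf : SmoothSphere f)
    (hg : SmoothSphere g) : SmoothSphere (f + g) := ContMDiff.add hf hg

theorem SmoothSphere.smul {d : ℕ} {f : UnitSphere d → ℂ} (hf : SmoothSphere f)
    (c : ℂ) : SmoothSphere (c • f) := 
  ContMDiff.comp (I' := 𝓘(ℝ, ℂ)) (g := fun z : ℂ => c • z) (contDiff_const_smul c).contMDiff hf

theorem homExt_add {d : ℕ} (f g : UnitSphere d → ℂ) : homExt (f + g) = homExt f + homExt g := by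
  funext x
  by_cases hx : x = 0 <;> simp [homExt, hx]

theorem homExt_const_smul {d : ℕ} (c : ℂ) (f : UnitSphere d → ℂ) :
    homExt (c • f) = c • homExt f := by
  funext x
  by_cases hx : x = 0 <;> simp [homExt, hx]

theorem sphereLaplacian_add {d : ℕ} {f g : UnitSphere d → ℂ} (hf : SmoothSphere f)
    (hg : SmoothSphere g) :
    sphereLaplacian (f + g) = sphereLaplacian f + sphereLaplacian g := by
  funext θ
  have h := ContDiffAt.laplacian_add
    ((contDiffAt_homExt hf (sphere_ne_zero θ)).of_le two_le_smooth)
    ((contDiffAt_homExt hg (sphere_ne_zero θ)).of_le two_le_smooth)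
  simp only [sphereLaplacian, homExt_add, Pi.add_apply]
  rw [h]; ring

theorem sphereLaplacian_smul {d : ℕ} {f : UnitSphere d → ℂ} (hf : SmoothSphere f) (c : ℂ) :
    sphereLaplacian (c • f) = c • sphereLaplacian f := by
  funext θ
  have h := InnerProductSpace.laplacian_smul c
    ((contDiffAt_homExt hf (sphere_ne_zero θ)).of_le two_le_smooth)
  simp only [sphereLaplacian, homExt_const_smul, Pi.smul_apply]
  rw [h]; simp

/-- A polynomial as a function on the ambient space. -/
def ambientPoly {d : ℕ} (p : MvPolynomial (Fin (d + 1)) ℂ) (x : Ambient d) : ℂ :=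
  MvPolynomial.eval (fun i => (x i : ℂ)) p

theorem contDiff_coord {d : ℕ} (i : Fin (d + 1)) :
    ContDiff ℝ ∞ (fun x : Ambient d => (x i : ℂ)) :=
  (Complex.ofRealCLM.comp (EuclideanSpace.proj i : Ambient d →L[ℝ] ℝ)).contDiff

theorem contDiff_ambientPoly {d : ℕ} (p : MvPolynomial (Fin (d + 1)) ℂ) :
    ContDiff ℝ ∞ (ambientPoly p) := by
  induction p using MvPolynomial.induction_on with
  | C a =>
    have e : ambientPoly (d := d) (MvPolynomial.C a) = fun _ => a := by
      funext x; simp [ambientPoly]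
    rw [e]; exact contDiff_const
  | add p q hp hq =>
    have e : ambientPoly (p + q) = fun x => ambientPoly p x + ambientPoly q x := by
      funext x; simp [ambientPoly]
    rw [e]; exact hp.add hq
  | mul_X p i hp =>
    have e : ambientPoly (p * MvPolynomial.X i) = fun x => ambientPoly p x * (x i : ℂ) := by
      funext x; simp [ambientPoly]
    rw [e]; exact hp.mul (contDiff_coord i)

theorem partialDeriv_coord {d : ℕ} (i j : Fin (d + 1)) (x : Ambient d) :
    partialDeriv i (fun y : Ambient d => (y j : ℂ)) x = if i = j then 1 else 0 := by
  have h : HasFDerivAt (fun y : Ambient d => (y j : ℂ))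
    (Complex.ofRealCLM.comp (EuclideanSpace.proj j : Ambient d →L[ℝ] ℝ)) x :=
    (Complex.ofRealCLM.comp (EuclideanSpace.proj j : Ambient d →L[ℝ] ℝ)).hasFDerivAt
  unfold partialDeriv
  rw [h.fderiv]
  by_cases hij : i = j
  · subst hij; simp
  · simp [hij, Ne.symm hij]

theorem partialDeriv_ambientPoly {d : ℕ} (i : Fin (d + 1)) (p : MvPolynomial (Fin (d + 1)) ℂ) :
    partialDeriv i (ambientPoly p) = ambientPoly (MvPolynomial.pderiv i p) := by
  funext x
  induction p using MvPolynomial.induction_on with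
  | C a =>
    have e : ambientPoly (d := d) (MvPolynomial.C a) = fun _ => a := by
      funext x; simp [ambientPoly]
    rw [e]; simp [partialDeriv, ambientPoly]
  | add p q hp hq =>
    have e : ambientPoly (p + q) = fun x => ambientPoly p x + ambientPoly q x := by
      funext x; simp [ambientPoly]
    unfold partialDeriv at hp hq ⊢
    rw [e, fderiv_fun_add ((contDiff_ambientPoly p).differentiable (by simp) x)
      ((contDiff_ambientPoly q).differentiable (by simp) x), add_apply, hp, hq]
    simp [ambientPoly]
  | mul_X p j hp =>
    have e : ambientPoly (p * MvPolynomial.X j) = fun x => ambientPoly p x * (x j : ℂ) := by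
      funext x; simp [ambientPoly]
    rw [e, partialDeriv_mul ((contDiff_ambientPoly p).differentiable (by simp) x)
      ((contDiff_coord j).differentiable (by simp) x), hp, partialDeriv_coord]
    simp only [ambientPoly, Derivation.leibniz, MvPolynomial.pderiv_X, smul_eq_mul, map_add,
      map_mul, MvPolynomial.eval_X, Pi.single_apply]
    by_cases hij : i = j
    · subst hij; simp; ring
    · simp [hij, Ne.symm hij]; ring

/-- The polynomial Laplacian. -/
def polyLaplacian {d : ℕ} (p : MvPolynomial (Fin (d + 1)) ℂ) : MvPolynomial (Fin (d + 1)) ℂ :=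
  ∑ i, MvPolynomial.pderiv i (MvPolynomial.pderiv i p)

theorem laplacian_ambientPoly {d : ℕ} (p : MvPolynomial (Fin (d + 1)) ℂ) (x : Ambient d) :
    Laplacian.laplacian (ambientPoly p) x = ambientPoly (polyLaplacian p) x := by
  rw [laplacian_eq_sum_partialDeriv ((contDiff_ambientPoly p).contDiffAt.of_le two_le_smooth)]
  simp only [partialDeriv_ambientPoly]
  simp [ambientPoly, polyLaplacian]

theorem ambientPoly_smul {d k : ℕ} {p : MvPolynomial (Fin (d + 1)) ℂ} (hp : p.IsHomogeneous k)
    (s : ℝ) (x : Ambient d) : ambientPoly p (s • x) = (s : ℂ) ^ k * ambientPoly p x := by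
  unfold ambientPoly
  rw [MvPolynomial.eval_eq', MvPolynomial.eval_eq', Finset.mul_sum]
  refine Finset.sum_congr rfl fun m hm => ?_
  have hdeg : ∑ i, m i = k := by
    have := hp (MvPolynomial.mem_support_iff.mp hm)
    rw [← this, Finsupp.weight_apply, Finsupp.sum_fintype _ _ (by simp)]
    simp
  simp only [PiLp.smul_apply, smul_eq_mul, Complex.ofReal_mul, mul_pow, Finset.prod_mul_distrib]
  rw [Finset.prod_pow_eq_pow_sum, hdeg]
  ring

/-- Powers of `|x|²`. -/
def normSqPow {d : ℕ} (a : ℝ) (x : Ambient d) : ℂ := (((‖x‖ ^ 2) ^ a : ℝ) : ℂ)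

theorem contDiffAt_normSqPow {d : ℕ} (a : ℝ) {x : Ambient d} (hx : x ≠ 0) :
    ContDiffAt ℝ ∞ (normSqPow (d := d) a) x :=
  Complex.ofRealCLM.contDiff.contDiffAt.comp x
    ((contDiff_norm_sq ℝ).contDiffAt.rpow_const_of_ne (by simpa using hx))

theorem partialDeriv_normSqPow {d : ℕ} (a : ℝ) {x : Ambient d} (hx : x ≠ 0) (i : Fin (d + 1)) :
    partialDeriv i (normSqPow a) x = 2 * a * (normSqPow (a - 1) x * (x i : ℂ)) := by
  have h1 : HasFDerivAt (fun y : Ambient d => ‖y‖ ^ 2) (2 • innerSL ℝ x) x :=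
    (hasStrictFDerivAt_norm_sq x).hasFDerivAt
  have h2 : HasDerivAt (fun y : ℝ => y ^ a) (a * (‖x‖ ^ 2) ^ (a - 1)) (‖x‖ ^ 2) :=
    Real.hasDerivAt_rpow_const (Or.inl (by simpa using hx))
  have h3 := Complex.ofRealCLM.hasFDerivAt.comp x (h2.comp_hasFDerivAt x h1)
  have h4 : fderiv ℝ (normSqPow a) x = _ := h3.fderiv
  unfold partialDeriv
  rw [h4]
  simp [EuclideanSpace.inner_single_right, normSqPow]
  ring

theorem sum_coord_sq {d : ℕ} (θ : UnitSphere d) :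
    ∑ i, (((θ : Ambient d) i : ℝ) : ℂ) ^ 2 = 1 := by
  have h1 : ‖(θ : Ambient d)‖ ^ 2 = 1 := by simp
  rw [EuclideanSpace.norm_sq_eq] at h1
  simp only [Real.norm_eq_abs, sq_abs] at h1
  exact_mod_cast h1

theorem normSqPow_coe {d : ℕ} (a : ℝ) (θ : UnitSphere d) : normSqPow a (θ : Ambient d) = 1 := by
  simp [normSqPow]

theorem laplacian_normSqPow_coe {d : ℕ} (a : ℝ) (θ : UnitSphere d) :
    Laplacian.laplacian (normSqPow a) (θ : Ambient d) = 2 * a * (2 * a + d - 1) := by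
  have hθ := sphere_ne_zero θ
  rw [laplacian_eq_sum_partialDeriv ((contDiffAt_normSqPow a hθ).of_le two_le_smooth)]
  have h1 : ∀ i, partialDeriv i (partialDeriv i (normSqPow a)) (θ : Ambient d)
      = 2 * a * (2 * (a - 1) * (((θ : Ambient d) i : ℝ) : ℂ) ^ 2 + 1) := by
    intro i
    have h2 : partialDeriv i (normSqPow a) =ᶠ[𝓝 (θ : Ambient d)]
        fun x => ((2 * a : ℝ) : ℂ) * (normSqPow (a - 1) x * (x i : ℂ)) := by
      filter_upwards [isOpen_ne.mem_nhds hθ] with x hx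
      rw [partialDeriv_normSqPow a hx]; push_cast; rfl
    have d1 := (contDiffAt_normSqPow (a - 1) hθ).differentiableAt (by simp)
    have d2 := (contDiff_coord i).differentiable (by simp) (θ : Ambient d)
    have h3 : partialDeriv i (partialDeriv i (normSqPow a)) (θ : Ambient d)
        = partialDeriv i (fun x => ((2 * a : ℝ) : ℂ) * (normSqPow (a - 1) x * (x i : ℂ))) θ := by
      conv_lhs => unfold partialDeriv
      conv_rhs => unfold partialDeriv
      exact congrArg (fun L : Ambient d →L[ℝ] ℂ => L (EuclideanSpace.single i 1)) h2.fderiv_eq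
    rw [h3, partialDeriv_mul (F := fun _ => ((2 * a : ℝ) : ℂ))
      (differentiableAt_const _) (d1.fun_mul d2), partialDeriv_mul d1 d2,
      partialDeriv_normSqPow _ hθ, partialDeriv_coord, normSqPow_coe, normSqPow_coe]
    have h4 : partialDeriv i (fun _ : Ambient d => ((2 * a : ℝ) : ℂ)) θ = 0 := by
      simp [partialDeriv]
    rw [h4]
    simp only [if_true]
    push_cast
    ring
  simp only [h1, ← Finset.mul_sum, Finset.sum_add_distrib]
  rw [sum_coord_sq]
  simp
  left; ring

/-- Restriction of polynomials to the sphere. -/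
def spherePoly (d : ℕ) : MvPolynomial (Fin (d + 1)) ℂ →ₗ[ℂ] (UnitSphere d → ℂ) where
  toFun p θ := ambientPoly p θ
  map_add' p q := by funext θ; simp [ambientPoly]
  map_smul' c p := by funext θ; simp [ambientPoly, MvPolynomial.smul_eval]

theorem spherePoly_apply {d : ℕ} (p : MvPolynomial (Fin (d + 1)) ℂ) (θ : UnitSphere d) :
    spherePoly d p θ = ambientPoly p (θ : Ambient d) := rfl

theorem smoothSphere_spherePoly {d : ℕ} (p : MvPolynomial (Fin (d + 1)) ℂ) :
    SmoothSphere (spherePoly d p) :=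
  ContMDiff.comp (I' := 𝓘(ℝ, Ambient d)) (f := (Subtype.val : UnitSphere d → Ambient d))
    (contDiff_ambientPoly p).contMDiff (contMDiff_sphere_coe d)

/-- The Laplacian of the restriction of a homogeneous polynomial. -/
theorem sphereLaplacian_spherePoly {d k : ℕ} {p : MvPolynomial (Fin (d + 1)) ℂ}
    (hp : p.IsHomogeneous k) :
    sphereLaplacian (spherePoly d p)
      = spherePoly d (((k : ℂ) * (k + d - 1)) • p
        - (∑ i, MvPolynomial.X i ^ 2) * polyLaplacian p) := by
  funext θ
  have hθ := sphere_ne_zero θ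
  have hF := contDiffAt_homExt (smoothSphere_spherePoly p) hθ
  have hQ := contDiffAt_normSqPow (d := d) ((k : ℝ) / 2) hθ
  -- Homogeneity gives `p(x) = |x|^k p(x/|x|)`. In the Laplacian of this product the cross term
  -- vanishes, `∇|x|^k` being radial, and `Δ|x|^k = k(k + d - 1)` on the sphere.
  have e1 : ambientPoly p =ᶠ[𝓝 (θ : Ambient d)]
      fun x => normSqPow ((k : ℝ) / 2) x * homExt (spherePoly d p) x := by
    filter_upwards [isOpen_ne.mem_nhds hθ] with x hx
    have hx' : 0 < ‖x‖ := norm_pos_iff.mpr hx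
    have e : x = ‖x‖ • (radialProj x : Ambient d) := by
      simp only [radialProj, show x ≠ 0 from hx, dif_neg, not_false_eq_true]
      rw [smul_smul, mul_inv_cancel₀ hx'.ne', one_smul]
    rw [homExt_eq _ hx, spherePoly_apply]
    conv_lhs => rw [e, ambientPoly_smul hp]
    congr 1
    rw [normSqPow, ← Real.rpow_natCast, ← Real.rpow_mul hx'.le]
    push_cast
    rw [mul_div_cancel₀ _ (two_ne_zero), Real.rpow_natCast]
    push_cast; rfl
  have h1 := laplacian_mul (hQ.of_le two_le_smooth) (hF.of_le two_le_smooth)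
  rw [← (InnerProductSpace.laplacian_congr_nhds e1).eq_of_nhds, laplacian_ambientPoly, laplacian_normSqPow_coe,
    normSqPow_coe, homExt_coe] at h1
  have h2 : ∑ i, partialDeriv i (normSqPow ((k : ℝ) / 2)) (θ : Ambient d)
      * partialDeriv i (homExt (spherePoly d p)) θ = 0 := by
    have h3 := sum_mul_partialDeriv_homExt (smoothSphere_spherePoly p) hθ
    simp only [partialDeriv_normSqPow _ hθ, normSqPow_coe, mul_assoc, one_mul, ← Finset.mul_sum]
    rw [h3]; simp
  rw [h2] at h1
  have h4 : ambientPoly ((∑ i, MvPolynomial.X i ^ 2) * polyLaplacian p) (θ : Ambient d)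
      = ambientPoly (polyLaplacian p) (θ : Ambient d) := by
    have := sum_coord_sq θ
    simp only [ambientPoly, map_mul, map_sum, map_pow, MvPolynomial.eval_X]
    rw [this, one_mul]
  rw [map_sub, map_smul, Pi.sub_apply, Pi.smul_apply, spherePoly_apply _ θ, spherePoly_apply _ θ, h4, h1,
    sphereLaplacian, spherePoly_apply]
  simp only [smul_eq_mul]
  push_cast
  ring

/-! ### Eigenfunctions of the sphere Laplacian -/

/-- Smooth eigenfunctions of the sphere Laplacian. -/
def IsSphereEigenfunction {d : ℕ} (lam : ℝ) (Y : UnitSphere d → ℂ) : Prop :=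
  SmoothSphere Y ∧ sphereLaplacian Y = (lam : ℂ) • Y

/-- All eigenfunctions with nonnegative eigenvalue. -/
def sphereEigenfunctions (d : ℕ) : Set (UnitSphere d → ℂ) :=
  {Y | ∃ lam : ℝ, 0 ≤ lam ∧ IsSphereEigenfunction lam Y}

/-- Restrictions to the sphere of homogeneous polynomials of degree `k`. -/
def sphereHomPoly (d k : ℕ) : Submodule ℂ (UnitSphere d → ℂ) :=
  (MvPolynomial.homogeneousSubmodule (Fin (d + 1)) ℂ k).map (spherePoly d)

instance (d k : ℕ) : FiniteDimensional ℂ (sphereHomPoly d k) :=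
  Module.Finite.iff_fg.mpr ((MvPolynomial.homogeneousSubmodule_fg (σ := Fin (d + 1)) (R := ℂ) k).map _)

theorem smoothSphere_of_mem {d k : ℕ} {f : UnitSphere d → ℂ} (hf : f ∈ sphereHomPoly d k) :
    SmoothSphere f := by
  obtain ⟨p, -, rfl⟩ := hf
  exact smoothSphere_spherePoly p

theorem isHomogeneous_polyLaplacian {d k : ℕ} {p : MvPolynomial (Fin (d + 1)) ℂ}
    (hp : p.IsHomogeneous k) :
    ((∑ i, MvPolynomial.X i ^ 2) * polyLaplacian p).IsHomogeneous k := by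
  have hX : (∑ i, MvPolynomial.X i ^ 2 : MvPolynomial (Fin (d + 1)) ℂ).IsHomogeneous 2 :=
    MvPolynomial.IsHomogeneous.sum _ _ _ fun i _ => MvPolynomial.isHomogeneous_X_pow i 2
  have hL : (polyLaplacian p).IsHomogeneous (k - 1 - 1) :=
    MvPolynomial.IsHomogeneous.sum _ _ _ fun i _ => hp.pderiv.pderiv
  have hC : ∀ (j : Fin (d + 1)) {q : MvPolynomial (Fin (d + 1)) ℂ}, q.IsHomogeneous 0 →
      MvPolynomial.pderiv j q = 0 := fun j q hq => by
    rw [MvPolynomial.totalDegree_eq_zero_iff_eq_C.mp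
      (Nat.le_zero.mp hq.totalDegree_le), MvPolynomial.pderiv_C]
  -- For `k = 0` and `k = 1` the subtraction `k - 1 - 1` truncates and the degrees would not add up
  -- to `k`; there the polynomial Laplacian is zero.
  rcases k with _ | _ | k
  · have : polyLaplacian p = 0 := Finset.sum_eq_zero fun i _ => by rw [hC i hp, map_zero]
    rw [this, mul_zero]; exact MvPolynomial.isHomogeneous_zero _ _ _
  · have : polyLaplacian p = 0 := Finset.sum_eq_zero fun i _ => hC i hp.pderiv
    rw [this, mul_zero]; exact MvPolynomial.isHomogeneous_zero _ _ _
  · have := hX.mul hL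
    rwa [show 2 + (k + 1 + 1 - 1 - 1) = k + 1 + 1 by omega] at this

theorem sphereLaplacian_mem {d k : ℕ} {f : UnitSphere d → ℂ} (hf : f ∈ sphereHomPoly d k) :
    sphereLaplacian f ∈ sphereHomPoly d k := by
  obtain ⟨p, hp, rfl⟩ := hf
  rw [sphereLaplacian_spherePoly hp]
  exact ⟨_, Submodule.sub_mem _ (Submodule.smul_mem _ _ hp) (isHomogeneous_polyLaplacian hp), rfl⟩

/-- The sphere Laplacian on restrictions of homogeneous polynomials. -/
def sphereLaplacianEnd (d k : ℕ) : Module.End ℂ (sphereHomPoly d k) where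
  toFun f := ⟨sphereLaplacian f, sphereLaplacian_mem f.2⟩
  map_add' f g := Subtype.ext
    (sphereLaplacian_add (smoothSphere_of_mem f.2) (smoothSphere_of_mem g.2))
  map_smul' c f := Subtype.ext (sphereLaplacian_smul (smoothSphere_of_mem f.2) c)

/-- By Green's formula `⟨ΔY, Y⟩ = μ‖Y‖²` is a nonnegative real number. -/
theorem eigenvalue_nonneg {d : ℕ} {Y : UnitSphere d → ℂ} (hY : SmoothSphere Y) (hY0 : Y ≠ 0)
    {μ : ℂ} (h : sphereLaplacian Y = μ • Y) : ∃ lam : ℝ, 0 ≤ lam ∧ μ = lam := by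
  obtain ⟨e, he, hint⟩ := exists_integral_sphereLaplacian_self hY
  have h1 : ∀ θ, sphereLaplacian Y θ * conj (Y θ) = μ * ((‖Y θ‖ ^ 2 : ℝ) : ℂ) := fun θ => by
    rw [h, Pi.smul_apply, smul_eq_mul, mul_assoc, Complex.mul_conj, Complex.normSq_eq_norm_sq]
  simp_rw [h1] at hint
  rw [integral_const_mul, integral_complex_ofReal] at hint
  set n := ∫ θ, ‖Y θ‖ ^ 2 ∂(surfaceMeasure d) with hn
  have hn0 : 0 ≤ n := integral_nonneg fun θ => by positivity
  have hn1 : n ≠ 0 := by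
    intro h0
    apply hY0
    refine eq_zero_of_integral_mul_conj_self hY.continuous ?_
    have h2 : ∀ θ, Y θ * conj (Y θ) = ((‖Y θ‖ ^ 2 : ℝ) : ℂ) := fun θ => by
      rw [Complex.mul_conj, Complex.normSq_eq_norm_sq]
    simp_rw [h2]
    rw [integral_complex_ofReal, ← hn, h0, Complex.ofReal_zero]
  refine ⟨e / n, by positivity, ?_⟩
  have : (n : ℂ) ≠ 0 := by exact_mod_cast hn1
  push_cast
  rw [eq_div_iff this, hint]

/-- A symmetric operator has no Jordan blocks. If `g = (Δ - μ)f` were nonzero, `μ` would be an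
eigenvalue, hence real, and then `‖g‖² = ⟨(Δ - μ)f, g⟩ = ⟨f, (Δ - μ)g⟩ = 0`. -/
theorem sphereLaplacian_sub_smul_sq {d k : ℕ} (μ : ℂ) (f : sphereHomPoly d k)
    (h : (sphereLaplacianEnd d k - algebraMap ℂ _ μ)
      ((sphereLaplacianEnd d k - algebraMap ℂ _ μ) f) = 0) :
    (sphereLaplacianEnd d k - algebraMap ℂ _ μ) f = 0 := by
  set T := sphereLaplacianEnd d k with hT
  set g := (T - algebraMap ℂ _ μ) f with hg
  by_contra hg0
  have hgE : sphereLaplacian (g : UnitSphere d → ℂ) = μ • (g : UnitSphere d → ℂ) := by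
    have h1 : T g - μ • g = 0 := by simpa using h
    have h2 := congrArg Subtype.val (sub_eq_zero.mp h1)
    exact h2
  have hgS := smoothSphere_of_mem g.2
  have hfS := smoothSphere_of_mem f.2
  obtain ⟨lam, -, hlam⟩ := eigenvalue_nonneg hgS (fun h0 => hg0 (Subtype.ext h0)) hgE
  apply hg0
  apply Subtype.ext
  refine eq_zero_of_integral_mul_conj_self hgS.continuous ?_
  have hgf : (g : UnitSphere d → ℂ) = fun θ => sphereLaplacian f θ - μ * (f : UnitSphere d → ℂ) θ := by
    rw [hg]; funext θ
    simp [hT, sphereLaplacianEnd]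
  have hsymm := integral_sphereLaplacian_symm hfS hgS
  have hi1 : Integrable (fun θ => sphereLaplacian f θ * conj ((g : UnitSphere d → ℂ) θ))
      (surfaceMeasure d) :=
    integrable_sphere ((continuous_sphereLaplacian hfS).mul
      (Complex.continuous_conj.comp hgS.continuous))
  have hi2 : Integrable (fun θ => μ * (f : UnitSphere d → ℂ) θ * conj ((g : UnitSphere d → ℂ) θ))
      (surfaceMeasure d) :=
    integrable_sphere ((continuous_const.mul hfS.continuous).mul
      (Complex.continuous_conj.comp hgS.continuous))
  calc ∫ θ, (g : UnitSphere d → ℂ) θ * conj ((g : UnitSphere d → ℂ) θ) ∂(surfaceMeasure d)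
      = ∫ θ, (sphereLaplacian f θ * conj ((g : UnitSphere d → ℂ) θ)
          - μ * (f : UnitSphere d → ℂ) θ * conj ((g : UnitSphere d → ℂ) θ)) ∂(surfaceMeasure d) := by
        refine integral_congr_ae (ae_of_all _ fun θ => ?_)
        simp only
        rw [← sub_mul]
        exact congrArg (· * _) (congrFun hgf θ)
    _ = 0 := by
        rw [integral_sub hi1 hi2, hsymm, sub_eq_zero, hgE]
        congr 1; funext θ
        rw [Pi.smul_apply, smul_eq_mul, map_mul, hlam, Complex.conj_ofReal]
        ring

/-- Over `ℂ` a finite-dimensional space is the span of generalized eigenspaces, and here these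
consist of genuine eigenvectors. -/
theorem mem_span_sphereEigenfunctions {d k : ℕ} {f : UnitSphere d → ℂ}
    (hf : f ∈ sphereHomPoly d k) : f ∈ Submodule.span ℂ (sphereEigenfunctions d) := by
  set T := sphereLaplacianEnd d k with hT
  have hmem : ∀ (μ : ℂ) (n : ℕ) (x : sphereHomPoly d k),
      ((T - algebraMap ℂ _ μ) ^ (n + 1)) x = 0 → (T - algebraMap ℂ _ μ) x = 0 := by
    intro μ n
    induction n with
    | zero => intro x hx; simpa using hx
    | succ n ih =>
      intro x hx
      apply sphereLaplacian_sub_smul_sq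
      apply ih
      rwa [← Module.End.mul_apply, ← pow_succ]
  have htop := Module.End.iSup_maxGenEigenspace_eq_top T
  have hle : ⨆ μ, T.maxGenEigenspace μ ≤
      (Submodule.span ℂ (sphereEigenfunctions d)).comap (sphereHomPoly d k).subtype := by
    refine iSup_le fun μ x hx => ?_
    rw [Module.End.mem_maxGenEigenspace] at hx
    obtain ⟨n, hn⟩ := hx
    have h1 : (T - algebraMap ℂ _ μ) x = 0 := by
      apply hmem μ n
      have e : T - algebraMap ℂ _ μ = T - μ • 1 := by rw [Algebra.algebraMap_eq_smul_one]
      rw [e, pow_succ', Module.End.mul_apply, hn, map_zero]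
    have h2 : sphereLaplacian (x : UnitSphere d → ℂ) = μ • (x : UnitSphere d → ℂ) := by
      have h1 : T x - μ • x = 0 := by simpa using h1
      exact congrArg Subtype.val (sub_eq_zero.mp h1)
    by_cases hx0 : (x : UnitSphere d → ℂ) = 0
    · rw [Submodule.mem_comap, Submodule.subtype_apply, hx0]; exact Submodule.zero_mem _
    · have hxS := smoothSphere_of_mem x.2
      obtain ⟨lam, hlam, rfl⟩ := eigenvalue_nonneg hxS hx0 h2
      exact Submodule.subset_span ⟨lam, hlam, hxS, h2⟩
  rw [htop] at hle
  exact hle (Submodule.mem_top (x := (⟨f, hf⟩ : sphereHomPoly d k)))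

theorem spherePoly_mem_span {d : ℕ} (p : MvPolynomial (Fin (d + 1)) ℂ) :
    spherePoly d p ∈ Submodule.span ℂ (sphereEigenfunctions d) := by
  rw [← MvPolynomial.sum_homogeneousComponent p, map_sum]
  exact Submodule.sum_mem _ fun k _ => mem_span_sphereEigenfunctions (k := k)
    ⟨_, MvPolynomial.homogeneousComponent_isHomogeneous k p, rfl⟩

/-! ### Density -/

/-- The algebra of polynomials on the sphere. -/
def spherePolyAlgebra (d : ℕ) : StarSubalgebra ℂ C(UnitSphere d, ℂ) where
  carrier := {f | ∃ p, ∀ θ, f θ = spherePoly d p θ}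
  mul_mem' := by
    rintro f g ⟨p, hp⟩ ⟨q, hq⟩
    exact ⟨p * q, fun θ => by simp [hp, hq, spherePoly_apply, ambientPoly]⟩
  add_mem' := by
    rintro f g ⟨p, hp⟩ ⟨q, hq⟩
    exact ⟨p + q, fun θ => by simp [hp, hq]⟩
  algebraMap_mem' c := ⟨MvPolynomial.C c, fun θ => by simp [spherePoly_apply, ambientPoly]⟩
  star_mem' := by
    rintro f ⟨p, hp⟩
    -- The coordinates are real on the sphere, so conjugating the values amounts to conjugating the
    -- coefficients.
    refine ⟨MvPolynomial.map (starRingEnd ℂ) p, fun θ => ?_⟩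
    rw [ContinuousMap.star_apply, hp, spherePoly_apply, spherePoly_apply, ambientPoly, ambientPoly,
      MvPolynomial.eval_map, ← MvPolynomial.coe_eval₂Hom]
    change conj _ = _
    rw [MvPolynomial.eval, MvPolynomial.coe_eval₂Hom, MvPolynomial.coe_eval₂Hom,
      MvPolynomial.hom_eval₂]
    congr 1
    funext i; simp

theorem spherePolyAlgebra_dense (d : ℕ) :
    Dense (spherePolyAlgebra d : Set C(UnitSphere d, ℂ)) := by
  have h := ContinuousMap.starSubalgebra_topologicalClosure_eq_top_of_separatesPoints
    (spherePolyAlgebra d) (by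
      intro θ ρ hne
      obtain ⟨i, hi⟩ : ∃ i, (θ : Ambient d) i ≠ (ρ : Ambient d) i := by
        by_contra! hcon
        exact hne (Subtype.ext (PiLp.ext hcon))
      refine ⟨fun x => spherePoly d (MvPolynomial.X i) x, ⟨⟨spherePoly d (MvPolynomial.X i),
        (smoothSphere_spherePoly _).continuous⟩, ⟨_, fun _ => rfl⟩, rfl⟩, ?_⟩
      simpa [spherePoly_apply, ambientPoly] using hi)
  rw [dense_iff_closure_eq, ← StarSubalgebra.topologicalClosure_coe, h]
  rfl

/-- A continuous function orthogonal to all eigenfunctions vanishes. -/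
theorem eq_zero_of_orthogonal_eigenfunctions {d : ℕ} {v : UnitSphere d → ℂ} (hv : Continuous v)
    (h : ∀ Y ∈ sphereEigenfunctions d, ∫ θ, v θ * conj (Y θ) ∂(surfaceMeasure d) = 0) : v = 0 := by
  have hspan : ∀ f ∈ Submodule.span ℂ (sphereEigenfunctions d), Continuous f ∧
      ∫ θ, v θ * conj (f θ) ∂(surfaceMeasure d) = 0 := by
    intro f hf
    induction hf using Submodule.span_induction with
    | mem Y hY => exact ⟨hY.choose_spec.2.1.continuous, h Y hY⟩
    | zero => exact ⟨continuous_const, by simp⟩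
    | add f g _ _ hf hg =>
      refine ⟨hf.1.add hg.1, ?_⟩
      simp only [Pi.add_apply, map_add, mul_add]
      rw [integral_add, hf.2, hg.2, add_zero]
      · exact integrable_sphere (hv.mul (Complex.continuous_conj.comp hf.1))
      · exact integrable_sphere (hv.mul (Complex.continuous_conj.comp hg.1))
    | smul c f _ hf =>
      refine ⟨hf.1.const_smul c, ?_⟩
      simp only [Pi.smul_apply, smul_eq_mul, map_mul, mul_left_comm _ (conj c)]
      rw [integral_const_mul, hf.2, mul_zero]
  refine eq_zero_of_integral_mul_conj_self hv ?_
  set I := ∫ θ, v θ * conj (v θ) ∂(surfaceMeasure d) with hI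
  set vc : C(UnitSphere d, ℂ) := ⟨v, hv⟩
  set M := ‖vc‖ * (surfaceMeasure d).real univ with hM
  have hM0 : 0 ≤ M := by positivity
  -- Since `v` is orthogonal to every polynomial `f`, `⟨v, v⟩ = ⟨v, v - f⟩`, which is small when `f`
  -- is uniformly close to `v`.
  have hle : ∀ ε : ℝ, 0 < ε → ‖I‖ ≤ M * ε := by
    intro ε hε
    obtain ⟨f, ⟨p, hp⟩, hfε⟩ := (spherePolyAlgebra_dense d).exists_dist_lt vc hε
    have h1 : ∫ θ, v θ * conj (f θ) ∂(surfaceMeasure d) = 0 := by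
      simp_rw [hp]
      exact (hspan _ (spherePoly_mem_span p)).2
    have h2 : I = ∫ θ, v θ * conj (v θ - f θ) ∂(surfaceMeasure d) := by
      simp only [map_sub, mul_sub]
      rw [integral_sub, h1, sub_zero]
      · exact integrable_sphere (hv.mul (Complex.continuous_conj.comp hv))
      · exact integrable_sphere (hv.mul (Complex.continuous_conj.comp f.continuous))
    have h3 := norm_integral_le_of_norm_le_const (μ := surfaceMeasure d) (C := ‖vc‖ * ε)
      (f := fun θ => v θ * conj (v θ - f θ)) (ae_of_all _ fun θ => by
        rw [norm_mul, RCLike.norm_conj]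
        have e1 : ‖v θ‖ ≤ ‖vc‖ := vc.norm_coe_le_norm θ
        have e2 : ‖v θ - f θ‖ ≤ ε := by
          rw [dist_eq_norm] at hfε
          exact ((vc - f).norm_coe_le_norm θ).trans hfε.le
        gcongr)
    rw [h2]
    refine h3.trans (le_of_eq (by rw [hM]; ring))
  have hlim : Tendsto (fun ε : ℝ => M * ε) (𝓝[>] 0) (𝓝 0) := by
    have : Tendsto (fun ε : ℝ => M * ε) (𝓝 0) (𝓝 (M * 0)) := tendsto_id.const_mul M
    rw [mul_zero] at this
    exact this.mono_left nhdsWithin_le_nhds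
  exact norm_le_zero_iff.mp (ge_of_tendsto hlim (by
    filter_upwards [self_mem_nhdsWithin] with ε hε using hle ε hε))

/-! ### The resolvent of the sphere Laplacian -/

theorem exists_dist_nonneg_real_pos {c : ℂ} (hc : ∀ lam : ℝ, 0 ≤ lam → c ≠ lam) :
    ∃ δ : ℝ, 0 < δ ∧ ∀ lam : ℝ, 0 ≤ lam → δ ≤ ‖(lam : ℂ) - c‖ := by
  set S : Set ℂ := (fun x : ℝ => (x : ℂ)) '' Ici 0
  have hS : IsClosed S := Complex.isometry_ofReal.isClosedEmbedding.isClosedMap _ isClosed_Ici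
  have hne : S.Nonempty := ⟨0, 0, by simp, by simp⟩
  have hcS : c ∉ S := by
    rintro ⟨x, hx, rfl⟩
    exact hc x hx rfl
  refine ⟨Metric.infDist c S, (hS.notMem_iff_infDist_pos hne).mp hcS, fun lam hlam => ?_⟩
  have := Metric.infDist_le_dist_of_mem (x := c) (s := S) ⟨lam, hlam, rfl⟩
  rwa [dist_comm, dist_eq_norm] at this

theorem exists_solution_of_mem_span {d : ℕ} {c : ℂ} (hc : ∀ lam : ℝ, 0 ≤ lam → c ≠ lam)
    {f : UnitSphere d → ℂ} (hf : f ∈ Submodule.span ℂ (sphereEigenfunctions d)) :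
    ∃ ψ : UnitSphere d → ℂ, SmoothSphere ψ ∧ sphereLaplacian ψ - c • ψ = f := by
  induction hf using Submodule.span_induction with
  | mem Y hY =>
    obtain ⟨lam, hlam, hYs, hYe⟩ := hY
    have h0 : (lam : ℂ) - c ≠ 0 := sub_ne_zero.mpr (hc lam hlam).symm
    refine ⟨((lam : ℂ) - c)⁻¹ • Y, hYs.smul _, ?_⟩
    rw [sphereLaplacian_smul hYs, hYe, smul_comm c, ← smul_sub, ← sub_smul, smul_smul,
      inv_mul_cancel₀ h0, one_smul]
  | zero =>
    refine ⟨0, smoothSphere_zero d, ?_⟩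
    have := sphereLaplacian_smul (smoothSphere_zero d) 0
    simpa using this
  | add f g _ _ hf hg =>
    obtain ⟨φ, hφ, rfl⟩ := hf
    obtain ⟨ψ, hψ, rfl⟩ := hg
    refine ⟨φ + ψ, hφ.add hψ, ?_⟩
    rw [sphereLaplacian_add hφ hψ, smul_add]; abel
  | smul a f _ hf =>
    obtain ⟨φ, hφ, rfl⟩ := hf
    refine ⟨a • φ, hφ.smul a, ?_⟩
    rw [sphereLaplacian_smul hφ, smul_sub, smul_comm c]

/-- The lower bound `δ‖f‖ ≤ ‖Af‖`, with `δ` a lower bound for the distance from `c` to `[0,∞)`,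
passes to the closure of the graph. It gives uniqueness and closed range; the range is dense because
it contains all spherical polynomials. -/
theorem invertibleOnSphere_sphereLaplacian_sub {d : ℕ} {c : ℂ}
    (hc : ∀ lam : ℝ, 0 ≤ lam → c ≠ lam) {A : (UnitSphere d → ℂ) → (UnitSphere d → ℂ)}
    (hA : ∀ φ, SmoothSphere φ → A φ = sphereLaplacian φ - c • φ) : InvertibleOnSphere A := by
  obtain ⟨δ, hδ, hdist⟩ := exists_dist_nonneg_real_pos hc
  let H := Lp ℂ 2 (surfaceMeasure d)
  let S : AddSubgroup (H × H) :=
    { carrier := {p | ∃ φ : UnitSphere d → ℂ, SmoothSphere φ ∧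
        p.1 =ᵐ[surfaceMeasure d] φ ∧ p.2 =ᵐ[surfaceMeasure d] A φ}
      add_mem' := by
        rintro p q ⟨φ, hφ, h1, h2⟩ ⟨ψ, hψ, h3, h4⟩
        refine ⟨φ + ψ, hφ.add hψ, (Lp.coeFn_add _ _).trans (h1.add h3),
          (Lp.coeFn_add _ _).trans ((h2.add h4).trans (Eventually.of_forall fun θ => ?_))⟩
        rw [hA _ hφ, hA _ hψ, hA _ (hφ.add hψ), sphereLaplacian_add hφ hψ]
        simp; ring
      zero_mem' := by
        refine ⟨0, smoothSphere_zero d, Lp.coeFn_zero _ _ _, (Lp.coeFn_zero _ _ _).trans ?_⟩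
        have := sphereLaplacian_smul (smoothSphere_zero d) 0
        rw [hA _ (smoothSphere_zero d)]
        simp only [zero_smul] at this
        rw [this]; simp
      neg_mem' := by
        rintro p ⟨φ, hφ, h1, h2⟩
        have e : (-1 : ℂ) • φ = -φ := by simp
        refine ⟨(-1 : ℂ) • φ, hφ.smul _, ?_, ?_⟩
        · rw [e]; exact (Lp.coeFn_neg _).trans h1.neg
        · refine (Lp.coeFn_neg _).trans (h2.neg.trans (Eventually.of_forall fun θ => ?_))
          rw [hA _ hφ, hA _ (hφ.smul _), sphereLaplacian_smul hφ]
          simp; ring }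
  have hest : ∀ p ∈ S, δ * ‖p.1‖ ≤ ‖p.2‖ := by
    rintro p ⟨φ, hφ, h1, h2⟩
    obtain ⟨e, he, hint⟩ := exists_integral_sphereLaplacian_self hφ
    have hn : (‖p.1‖ ^ 2 : ℂ) = ∫ θ, φ θ * conj (φ θ) ∂(surfaceMeasure d) := by
      have h3 := inner_self_eq_norm_sq_to_K (𝕜 := ℂ) p.1
      rw [L2.inner_def] at h3
      refine Eq.trans h3.symm (integral_congr_ae ?_)
      filter_upwards [h1] with θ hθ
      rw [hθ]; exact RCLike.inner_apply _ _
    have hin : inner ℂ p.1 p.2 = (e : ℂ) - c * ‖p.1‖ ^ 2 := by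
      rw [L2.inner_def, hn, ← hint, ← integral_const_mul, ← integral_sub]
      · refine integral_congr_ae ?_
        filter_upwards [h1, h2] with θ hθ1 hθ2
        rw [hθ1, hθ2, hA _ hφ]
        simp; ring
      · exact integrable_sphere ((continuous_sphereLaplacian hφ).mul
          (Complex.continuous_conj.comp hφ.continuous))
      · exact integrable_sphere (continuous_const.mul (hφ.continuous.mul
          (Complex.continuous_conj.comp hφ.continuous)))
    have hcs := norm_inner_le_norm (𝕜 := ℂ) p.1 p.2
    by_cases h0 : ‖p.1‖ = 0
    · rw [h0, mul_zero]; exact norm_nonneg _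
    · have hpos : 0 < ‖p.1‖ := lt_of_le_of_ne (norm_nonneg _) (Ne.symm h0)
      have hpos' : (‖p.1‖ : ℂ) ≠ 0 := by exact_mod_cast h0
      -- The Rayleigh quotient `e / ‖f‖²` is a nonnegative real number, hence at distance at least
      -- `δ` from `c`; Cauchy–Schwarz then bounds `‖f‖` by `‖Af‖`.
      have h3 := hdist (e / ‖p.1‖ ^ 2) (by positivity)
      have h4 : (e : ℂ) - c * ‖p.1‖ ^ 2 = (((e / ‖p.1‖ ^ 2 : ℝ) : ℂ) - c) * ‖p.1‖ ^ 2 := by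
        push_cast; field_simp
      rw [hin, h4, norm_mul] at hcs
      have h5 : ‖((‖p.1‖ : ℂ)) ^ 2‖ = ‖p.1‖ ^ 2 := by simp
      rw [h5] at hcs
      have h6 : δ * ‖p.1‖ ^ 2 ≤ ‖p.1‖ * ‖p.2‖ := by
        refine le_trans ?_ hcs
        gcongr
      nlinarith
  have hestc : ∀ p ∈ S.topologicalClosure, δ * ‖p.1‖ ≤ ‖p.2‖ := by
    have hcl : IsClosed {p : H × H | δ * ‖p.1‖ ≤ ‖p.2‖} :=
      isClosed_le (by fun_prop) (by fun_prop)
    intro p hp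
    exact closure_minimal hest hcl hp
  have hdense : Dense (Prod.snd '' (S : Set (H × H))) := by
    have h1 : Dense ((ContinuousMap.toLp (E := ℂ) 2 (surfaceMeasure d) ℂ) ''
        (spherePolyAlgebra d : Set C(UnitSphere d, ℂ))) :=
      (ContinuousMap.toLp_denseRange ℂ (surfaceMeasure d) ℂ (by simp)).dense_image
        (ContinuousMap.toLp (E := ℂ) 2 (surfaceMeasure d) ℂ).continuous (spherePolyAlgebra_dense d)
    refine h1.mono ?_
    rintro _ ⟨f, ⟨q, hq⟩, rfl⟩
    obtain ⟨ψ, hψ, hψf⟩ := exists_solution_of_mem_span hc (spherePoly_mem_span q)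
    refine ⟨(ContinuousMap.toLp (E := ℂ) 2 (surfaceMeasure d) ℂ ⟨ψ, hψ.continuous⟩,
      ContinuousMap.toLp (E := ℂ) 2 (surfaceMeasure d) ℂ f), ⟨ψ, hψ, ?_, ?_⟩, rfl⟩
    · exact ContinuousMap.coeFn_toLp (𝕜 := ℂ) (surfaceMeasure d) _
    · refine (ContinuousMap.coeFn_toLp (𝕜 := ℂ) (surfaceMeasure d) f).trans
        (Eventually.of_forall fun θ => ?_)
      rw [hA _ hψ, hψf, hq]
  -- On the closed graph, which is complete, the second projection expands distances up to a
  -- constant, so its image is closed.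
  have hanti : AntilipschitzWith (Real.toNNReal (1 + δ⁻¹))
      (fun p : S.topologicalClosure => (p : H × H).2) := by
    refine AntilipschitzWith.of_le_mul_dist fun p q => ?_
    have h1 := hestc _ (S.topologicalClosure.sub_mem p.2 q.2)
    rw [Real.coe_toNNReal _ (by positivity), Subtype.dist_eq, dist_eq_norm, dist_eq_norm,
      Prod.norm_def]
    have h2 : ‖((p : H × H) - q).1‖ ≤ δ⁻¹ * ‖((p : H × H) - q).2‖ := by
      rw [inv_mul_eq_div, le_div_iff₀ hδ]; linarith
    have h3 : ((p : H × H) - q).2 = (p : H × H).2 - (q : H × H).2 := rfl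
    rw [h3] at h2 ⊢
    have h4 := norm_nonneg ((p : H × H).2 - (q : H × H).2)
    have h5 : 0 ≤ δ⁻¹ * ‖(p : H × H).2 - (q : H × H).2‖ := by positivity
    apply max_le <;> nlinarith
  have hcomplete : CompleteSpace S.topologicalClosure :=
    S.isClosed_topologicalClosure.completeSpace_coe
  have hrange : IsClosed (range fun p : S.topologicalClosure => (p : H × H).2) :=
    hanti.isClosed_range (uniformContinuous_snd.comp uniformContinuous_subtype_val)
  have hall : ∀ g : H, ∃ p ∈ S.topologicalClosure, p.2 = g := by
    intro g
    have h1 : Prod.snd '' (S : Set (H × H)) ⊆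
        range fun p : S.topologicalClosure => (p : H × H).2 := by
      rintro _ ⟨p, hp, rfl⟩
      exact ⟨⟨p, S.le_topologicalClosure hp⟩, rfl⟩
    have h2 : g ∈ closure (range fun p : S.topologicalClosure => (p : H × H).2) :=
      hdense.mono h1 g
    rw [hrange.closure_eq] at h2
    obtain ⟨p, rfl⟩ := h2
    exact ⟨p, p.2, rfl⟩
  intro g
  obtain ⟨p, hp, rfl⟩ := hall g
  refine ⟨p.1, hp, fun f hf => ?_⟩
  have h1 := hestc _ (S.topologicalClosure.sub_mem (x := (f, p.2)) hf hp)
  simp only [Prod.snd_sub, sub_self, norm_zero] at h1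
  have h2 : ‖f - p.1‖ ≤ 0 := by
    have h3 : δ * ‖f - p.1‖ ≤ 0 := h1
    by_contra! hcon
    nlinarith
  exact sub_eq_zero.mp (norm_le_zero_iff.mp h2)

/-! ### Square roots -/

theorem sqrt_sq_eq (z : ℂ) : Complex.sqrt z ^ 2 = z := by
  unfold Complex.sqrt
  rw [← Complex.cpow_nat_mul]
  simp

/-- Off `(-∞, 0]` the argument lies strictly between `-π` and `π`, so half of it has positive
cosine. -/
theorem sqrt_re_pos {z : ℂ} (hz : ∀ x : ℝ, x ≤ 0 → z ≠ x) : 0 < (Complex.sqrt z).re := by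
  have h0 : z ≠ 0 := by simpa using hz 0 le_rfl
  have harg : z.arg ≠ Real.pi := by
    intro h
    have h1 := Complex.arg_eq_pi_iff.mp h
    exact hz z.re h1.1.le (Complex.ext (by simp) (by simpa using h1.2))
  unfold Complex.sqrt
  rw [Complex.cpow_def_of_ne_zero h0, Complex.exp_re]
  have him : (Complex.log z * 2⁻¹).im = z.arg / 2 := by
    have : (2⁻¹ : ℂ) = ((2⁻¹ : ℝ) : ℂ) := by push_cast; rfl
    rw [this, Complex.im_mul_ofReal, Complex.log_im]; ring
  rw [him]
  refine mul_pos (Real.exp_pos _) (Real.cos_pos_of_mem_Ioo ⟨?_, ?_⟩)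
  · have := Complex.neg_pi_lt_arg z; linarith
  · have := lt_of_le_of_ne (Complex.arg_le_pi z) harg; linarith

/-- Adding a nonnegative number to the square increases the real part of the root. -/
theorem abs_re_le_of_sq_eq_add {w ν : ℂ} {lam : ℝ} (hlam : 0 ≤ lam) (h : w ^ 2 = ν ^ 2 + lam) :
    |ν.re| ≤ |w.re| := by
  have hre := congrArg Complex.re h
  have him := congrArg Complex.im h
  simp only [pow_two, Complex.mul_re, Complex.mul_im, Complex.add_re, Complex.add_im,
    Complex.ofReal_re, Complex.ofReal_im, add_zero] at hre him
  rw [← sq_le_sq]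
  -- If the real part shrank, the real part of the identity would make the imaginary part shrink
  -- strictly as well, although the imaginary part of the identity fixes their product.
  by_contra! hlt
  have h1 : w.re * w.im = ν.re * ν.im := by linarith
  have h3 : w.im ^ 2 = ν.im ^ 2 - lam - (ν.re ^ 2 - w.re ^ 2) := by nlinarith
  have h4 : w.re ^ 2 * w.im ^ 2 = ν.re ^ 2 * ν.im ^ 2 := by
    have : (w.re * w.im) ^ 2 = (ν.re * ν.im) ^ 2 := by rw [h1]
    nlinarith
  have h5 : w.im ^ 2 < ν.im ^ 2 := by linarith
  have h6 : 0 ≤ w.im ^ 2 := sq_nonneg _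
  have h7 : 0 ≤ w.re ^ 2 := sq_nonneg _
  nlinarith

/-! ### The edge normal operator -/

/-- The edge normal operator of `r² (□ + r⁻² V₀)`, where `Z` is the value of `V₀` at the frozen
point. -/
def edgeNormal {d : ℕ} (Z : ℂ) (w : SpaceTimeFun d) : SpaceTimeFun d :=
  fun t r θ =>
    (r : ℂ) ^ 2 * (iteratedDeriv 2 (fun s => w s r θ) t - iteratedDeriv 2 (fun s => w t s θ) r
      - ((d : ℂ) / (r : ℂ)) * deriv (fun s => w t s θ) r)
      + sphereLaplacian (fun η => w t r η) θ + Z * w t r θ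

theorem iteratedDeriv_two_eq (f : ℝ → ℂ) : iteratedDeriv 2 f = deriv (deriv f) := by
  rw [iteratedDeriv_succ, iteratedDeriv_one]

theorem deriv_comp_affine (f : ℝ → ℂ) (a ε : ℝ) :
    deriv (fun s => f ((s - a) / ε)) = fun s => (ε : ℂ)⁻¹ * deriv f ((s - a) / ε) := by
  funext s
  have e : (fun s => f ((s - a) / ε)) = fun s => (fun y => f (ε⁻¹ * y)) (s - a) := by
    funext s; congr 1; rw [div_eq_inv_mul]
  rw [e, deriv_comp_sub_const (f := fun y => f (ε⁻¹ * y)), deriv_comp_mul_left]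
  simp [div_eq_inv_mul]

theorem iteratedDeriv_two_comp_affine (f : ℝ → ℂ) (a ε s : ℝ) :
    iteratedDeriv 2 (fun s => f ((s - a) / ε)) s
      = ((ε : ℂ) ^ 2)⁻¹ * iteratedDeriv 2 f ((s - a) / ε) := by
  rw [iteratedDeriv_two_eq, iteratedDeriv_two_eq, deriv_comp_affine, deriv_const_mul_field,
    deriv_comp_affine]
  simp only
  rw [pow_two, mul_inv, mul_assoc]

/-- All terms other than `V₀` are exactly invariant under the dilations: the factors `ε⁻²` and `ε⁻¹`
from the chain rule cancel against `(εr)²`. Only `V₀` has a genuine limit, by continuity up to `r =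
0`. -/
theorem isEdgeNormalOperator_edgeNormal {d : ℕ} {V₀ : SpaceTimeFun d}
    (hV₀ : SmoothSpaceTimeOn (Ici 0) V₀) {t₀ : ℝ} {Z : ℂ} (hZ : ∀ θ, V₀ t₀ 0 θ = Z) :
    IsEdgeNormalOperator (minkowskiBoxAddPotential V₀) t₀ (edgeNormal Z) := by
  intro w _ t r θ hr
  have hr0 : (r : ℂ) ≠ 0 := by exact_mod_cast hr.ne'
  have hcont : Tendsto (fun ε : ℝ => V₀ (t₀ + ε * t) (ε * r) θ) (𝓝[>] 0) (𝓝 Z) := by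
    have h1 := (ContMDiffOn.continuousOn hV₀) (t₀, 0, θ) ⟨mem_univ _, mem_Ici.mpr le_rfl, mem_univ _⟩
    have h2 : Tendsto (fun ε : ℝ => ((t₀ + ε * t, ε * r, θ) : ℝ × ℝ × UnitSphere d)) (𝓝[>] 0)
        (𝓝[univ ×ˢ Ici 0 ×ˢ univ] (t₀, 0, θ)) := by
      refine tendsto_nhdsWithin_iff.mpr ⟨?_, ?_⟩
      · have h3 : Continuous (fun ε : ℝ => ((t₀ + ε * t, ε * r, θ) : ℝ × ℝ × UnitSphere d)) := by
          fun_prop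
        have h4 := h3.tendsto 0
        simp only [zero_mul, add_zero] at h4
        exact h4.mono_left nhdsWithin_le_nhds
      · filter_upwards [self_mem_nhdsWithin] with ε hε
        exact ⟨mem_univ _, mul_nonneg (le_of_lt hε) hr.le, mem_univ _⟩
    have h3 := h1.tendsto.comp h2
    simp only [hZ] at h3
    exact h3
  have hlim : Tendsto (fun ε : ℝ => (r : ℂ) ^ 2 * (iteratedDeriv 2 (fun s => w s r θ) t
      - iteratedDeriv 2 (fun s => w t s θ) r - ((d : ℂ) / (r : ℂ)) * deriv (fun s => w t s θ) r)
      + sphereLaplacian (fun η => w t r η) θ + V₀ (t₀ + ε * t) (ε * r) θ * w t r θ) (𝓝[>] 0)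
      (𝓝 (edgeNormal Z w t r θ)) := tendsto_const_nhds.add (hcont.mul_const _)
  refine hlim.congr' ?_
  filter_upwards [self_mem_nhdsWithin] with ε hε
  have hε : 0 < ε := hε
  have hε0 : (ε : ℂ) ≠ 0 := by exact_mod_cast hε.ne'
  have e1 : (t₀ + ε * t - t₀) / ε = t := by field_simp; ring
  have e2 : ε * r / ε = r := by field_simp
  unfold minkowskiBoxAddPotential minkowskiBox
  simp only [e1, e2]
  have e3 := iteratedDeriv_two_comp_affine (fun s => w s r θ) t₀ ε (t₀ + ε * t)
  have e4 := iteratedDeriv_two_comp_affine (fun s => w t s θ) 0 ε (ε * r)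
  have e5 := congrFun (deriv_comp_affine (fun s => w t s θ) 0 ε) (ε * r)
  simp only [sub_zero, e1, e2] at e3 e4 e5
  rw [e3, e4, e5]
  push_cast
  field_simp

theorem indicialFamily_edgeNormal {d : ℕ} (Z ξ : ℂ) {f : UnitSphere d → ℂ} :
    indicialFamily (edgeNormal Z) ξ f
      = sphereLaplacian f - (ξ ^ 2 + ((d : ℂ) - 1) * ξ - Z) • f := by
  funext θ
  have hd : ∀ r : ℝ, 0 < r → ∀ a b : ℂ,
      HasDerivAt (fun s : ℝ => (s : ℂ) ^ a * b) (a * (r : ℂ) ^ (a - 1) * b) r := by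
    intro r hr a b
    have := (((hasDerivAt_id' (r : ℂ)).cpow_const (c := a)
      (Complex.ofReal_mem_slitPlane.mpr hr)).mul_const b).comp_ofReal
    simpa using this
  have e1 : deriv (fun s : ℝ => (s : ℂ) ^ ξ * f θ) =ᶠ[𝓝 1]
      fun s : ℝ => (s : ℂ) ^ (ξ - 1) * (ξ * f θ) := by
    filter_upwards [lt_mem_nhds one_pos] with r hr
    rw [(hd r hr ξ (f θ)).deriv]; ring
  have e2 : deriv (fun s : ℝ => (s : ℂ) ^ ξ * f θ) 1 = ξ * f θ := by
    rw [(hd 1 one_pos ξ (f θ)).deriv]; simp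
  have e3 : deriv (deriv (fun s : ℝ => (s : ℂ) ^ ξ * f θ)) 1 = (ξ - 1) * (ξ * f θ) := by
    rw [e1.deriv_eq, (hd 1 one_pos _ _).deriv]; simp
  simp only [indicialFamily, spectralFamily, edgeNormal]
  simp only [mul_zero, zero_mul, neg_zero, Complex.exp_zero, one_mul, iteratedDeriv_two_eq,
    deriv_const', Complex.ofReal_one, Complex.one_cpow, one_pow, div_one]
  rw [e2, e3]
  simp only [Pi.sub_apply, Pi.smul_apply, smul_eq_mul]
  ring

theorem reducedNormalOperator_edgeNormal {d : ℕ} (Z σ : ℂ) (u : RadFun d) {r : ℝ} (hr : 0 < r)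
    (θ : UnitSphere d) :
    reducedNormalOperator (edgeNormal Z) σ u r θ
      = ((r : ℂ) ^ 2)⁻¹ * (sphereLaplacian (u r) θ + Z * u r θ) - radDeriv (radDeriv u) r θ
        - (d : ℂ) / r * radDeriv u r θ - σ ^ 2 * u r θ := by
  have hr0 : (r : ℂ) ≠ 0 := by exact_mod_cast hr.ne'
  have hd : ∀ b : ℂ, ∀ t : ℝ, HasDerivAt (fun s : ℝ => Complex.exp (-(Complex.I * σ * s)) * b)
      (Complex.exp (-(Complex.I * σ * t)) * (-(Complex.I * σ) * b)) t := by
    intro b t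
    have := ((((hasDerivAt_id' (t : ℂ)).const_mul (Complex.I * σ)).fun_neg.cexp).mul_const
      b).comp_ofReal
    refine this.congr_deriv ?_
    ring
  have e1 : ∀ b : ℂ, deriv (fun s : ℝ => Complex.exp (-(Complex.I * σ * s)) * b)
      = fun t : ℝ => Complex.exp (-(Complex.I * σ * t)) * (-(Complex.I * σ) * b) := fun b =>
    funext fun t => (hd b t).deriv
  have e2 : iteratedDeriv 2 (fun s : ℝ => Complex.exp (-(Complex.I * σ * s)) * u r θ) 0
      = -σ ^ 2 * u r θ := by
    rw [iteratedDeriv_two_eq, e1, e1]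
    simp only [Complex.ofReal_zero, mul_zero, neg_zero, Complex.exp_zero, one_mul]
    linear_combination σ ^ 2 * u r θ * Complex.I_sq
  simp only [reducedNormalOperator, spectralFamily, edgeNormal]
  rw [e2]
  simp only [Complex.ofReal_zero, mul_zero, neg_zero, Complex.exp_zero, one_mul,
    iteratedDeriv_two_eq, radDeriv]
  have e3 : (fun η => u r η) = u r := rfl
  have e4 : deriv (deriv fun s => u s θ) = deriv (fun r => deriv (fun s => u s θ) r) := rfl
  rw [e3, ← e4]
  field_simp
  ring

/-! ### Radial modes -/

/-- Smoothness of `u` on `(0,∞) × 𝕊`, expressed through the homogeneous extension. -/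
def SmoothExt {d : ℕ} (u : RadFun d) : Prop :=
  ∀ r : ℝ, 0 < r → ∀ x : Ambient d, x ≠ 0 →
    ContDiffAt ℝ ∞ (fun p : ℝ × Ambient d => homExt (u p.1) p.2) (r, x)

section smoothExt
variable {d : ℕ} {u : RadFun d} (hu : SmoothExt u)
include hu

theorem SmoothExt.hasDerivAt {r : ℝ} (hr : 0 < r) (θ : UnitSphere d) :
    HasDerivAt (fun s => u s θ) (radDeriv u r θ) r := by
  have h1 : DifferentiableAt ℝ (fun p : ℝ × Ambient d => homExt (u p.1) p.2) (r, (θ : Ambient d)) :=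
    (hu r hr θ (sphere_ne_zero θ)).differentiableAt (by simp)
  have h2 : DifferentiableAt ℝ (fun s : ℝ => homExt (u s) (θ : Ambient d)) r :=
    DifferentiableAt.comp r (g := fun p : ℝ × Ambient d => homExt (u p.1) p.2)
      (f := fun s : ℝ => (s, (θ : Ambient d))) h1 (by fun_prop)
  simp only [homExt_coe] at h2
  exact h2.hasDerivAt

theorem SmoothExt.radDeriv : SmoothExt (radDeriv u) := by
  intro r hr x hx
  have h1 : ContDiffAt ℝ ∞ (fun p : ℝ × Ambient d =>
      fderiv ℝ (fun p : ℝ × Ambient d => homExt (u p.1) p.2) p (1, 0)) (r, x) :=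
    ((hu r hr x hx).fderiv_right (m := ∞) (by simp)).clm_apply contDiffAt_const
  refine h1.congr_of_eventuallyEq ?_
  have e1 : ∀ᶠ p : ℝ × Ambient d in 𝓝 (r, x), 0 < p.1 :=
    (continuousAt_fst (p := (r, x))).eventually (lt_mem_nhds hr)
  have e2 : ∀ᶠ p : ℝ × Ambient d in 𝓝 (r, x), p.2 ≠ 0 :=
    (continuousAt_snd (p := (r, x))).eventually_ne hx
  filter_upwards [e1, e2] with p hp1 hp2
  rw [homExt_eq _ hp2]
  have h2 : HasFDerivAt (fun p : ℝ × Ambient d => homExt (u p.1) p.2)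
      (fderiv ℝ (fun p : ℝ × Ambient d => homExt (u p.1) p.2) p) (p.1, p.2) :=
    ((hu p.1 hp1 p.2 hp2).differentiableAt (by simp)).hasFDerivAt
  have h3 : HasDerivAt (fun s : ℝ => ((s, p.2) : ℝ × Ambient d)) (1, 0) p.1 :=
    (hasDerivAt_id p.1).prodMk (hasDerivAt_const _ _)
  have h4 := h2.comp_hasDerivAt p.1 h3
  have h5 : ((fun p : ℝ × Ambient d => homExt (u p.1) p.2) ∘ fun s : ℝ => (s, p.2))
      = fun s => u s (radialProj p.2) := funext fun s => homExt_eq _ hp2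
  rw [h5] at h4
  exact h4.deriv

theorem SmoothExt.mul_radial {g : ℝ → ℂ} (hg : ContDiff ℝ ∞ g) :
    SmoothExt (fun r θ => g r * u r θ) := by
  intro r hr x hx
  have h1 : ContDiffAt ℝ ∞ (fun p : ℝ × Ambient d => g p.1 * homExt (u p.1) p.2) (r, x) :=
    (hg.comp contDiff_fst).contDiffAt.mul (hu r hr x hx)
  refine h1.congr_of_eventuallyEq ?_
  have e2 : ∀ᶠ p : ℝ × Ambient d in 𝓝 (r, x), p.2 ≠ 0 :=
    (continuousAt_snd (p := (r, x))).eventually_ne hx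
  filter_upwards [e2] with p hp2
  rw [homExt_eq _ hp2, homExt_eq _ hp2]

theorem SmoothExt.radEuler : SmoothExt (radEuler u) :=
  hu.radDeriv.mul_radial Complex.ofRealCLM.contDiff

theorem SmoothExt.iterate_radEuler (j : ℕ) : SmoothExt (_root_.radEuler^[j] u) := by
  induction j with
  | zero => exact hu
  | succ j ih => rw [Function.iterate_succ_apply']; exact ih.radEuler

theorem SmoothExt.continuousOn :
    ContinuousOn (fun q : ℝ × UnitSphere d => u q.1 q.2) (Ioi 0 ×ˢ univ) := by
  rintro ⟨r, θ⟩ ⟨hr, -⟩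
  have h1 : ContinuousAt (fun p : ℝ × Ambient d => homExt (u p.1) p.2) (r, (θ : Ambient d)) :=
    (hu r hr θ (sphere_ne_zero θ)).continuousAt
  have h2 : ContinuousAt (fun q : ℝ × UnitSphere d => homExt (u q.1) (q.2 : Ambient d)) (r, θ) :=
    ContinuousAt.comp (g := fun p : ℝ × Ambient d => homExt (u p.1) p.2)
      (f := fun q : ℝ × UnitSphere d => (q.1, (q.2 : Ambient d))) h1 (by fun_prop)
  simp only [homExt_coe] at h2
  exact h2.continuousWithinAt

theorem SmoothExt.continuous {r : ℝ} (hr : 0 < r) : Continuous (u r) := by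
  have := hu.continuousOn.comp_continuous (f := fun θ : UnitSphere d => (r, θ)) (by fun_prop)
    (fun θ => ⟨hr, mem_univ _⟩)
  exact this

end smoothExt

/-- The coefficient of `u` with respect to `Y`. -/
def radialMode {d : ℕ} (u : RadFun d) (Y : UnitSphere d → ℂ) (r : ℝ) : ℂ :=
  ∫ θ, u r θ * conj (Y θ) ∂(surfaceMeasure d)

theorem hasDerivAt_radialMode {d : ℕ} {u : RadFun d} (hu : SmoothExt u) {Y : UnitSphere d → ℂ}
    (hY : Continuous Y) {r : ℝ} (hr : 0 < r) :
    HasDerivAt (radialMode u Y) (radialMode (radDeriv u) Y r) r := by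
  have hYc : Continuous fun θ => conj (Y θ) := Complex.continuous_conj.comp hY
  have hs : Ioo (r / 2) (2 * r) ∈ 𝓝 r := Ioo_mem_nhds (by linarith) (by linarith)
  have hpos : ∀ x ∈ Ioo (r / 2) (2 * r), 0 < x := fun x hx => by have := hx.1; linarith
  have hK : IsCompact (Icc (r / 2) (2 * r) ×ˢ (univ : Set (UnitSphere d))) :=
    isCompact_Icc.prod isCompact_univ
  obtain ⟨B, hB⟩ := hK.exists_bound_of_continuousOn (hu.radDeriv.continuousOn.mono (by
    rintro ⟨s, θ⟩ ⟨h, -⟩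
    exact ⟨by have := h.1; simp only [mem_Ioi]; linarith, mem_univ _⟩))
  exact (hasDerivAt_integral_of_dominated_loc_of_deriv_le (μ := surfaceMeasure d)
    (F := fun s θ => u s θ * conj (Y θ)) (F' := fun s θ => radDeriv u s θ * conj (Y θ))
    (bound := fun θ => B * ‖conj (Y θ)‖) hs
    (by filter_upwards [hs] with x hx using
          ((hu.continuous (hpos x hx)).mul hYc).aestronglyMeasurable)
    (integrable_sphere ((hu.continuous hr).mul hYc))
    ((hu.radDeriv.continuous hr).mul hYc).aestronglyMeasurable
    (ae_of_all _ fun θ x hx => by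
      rw [norm_mul]
      exact mul_le_mul_of_nonneg_right (hB (x, θ) ⟨⟨hx.1.le, hx.2.le⟩, mem_univ _⟩)
        (norm_nonneg _))
    ((hYc.norm.integrable_of_hasCompactSupport (HasCompactSupport.of_compactSpace _)).const_mul _)
    (ae_of_all _ fun θ x hx => (hu.hasDerivAt (hpos x hx) θ).mul_const _)).2

theorem hasDerivAt_radialMode_euler {d : ℕ} {u : RadFun d} (hu : SmoothExt u)
    {Y : UnitSphere d → ℂ} (hY : Continuous Y) {r : ℝ} (hr : 0 < r) :
    HasDerivAt (radialMode u Y) (radialMode (radEuler u) Y r / r) r := by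
  have hr0 : (r : ℂ) ≠ 0 := by exact_mod_cast hr.ne'
  refine (hasDerivAt_radialMode hu hY hr).congr_deriv ?_
  have : radialMode (radEuler u) Y r = r * radialMode (radDeriv u) Y r := by
    unfold radialMode
    rw [← integral_const_mul]
    congr 1; funext θ
    simp only [radEuler, radDeriv]; ring
  rw [this]; field_simp

theorem norm_radialMode_le {d : ℕ} {u : RadFun d} {Y : UnitSphere d → ℂ} (hY : Continuous Y)
    {r B : ℝ} (h : ∀ θ, ‖u r θ‖ ≤ B) :
    ‖radialMode u Y r‖ ≤ B * ∫ θ, ‖Y θ‖ ∂(surfaceMeasure d) := by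
  rw [← integral_const_mul]
  refine norm_integral_le_of_norm_le ((hY.norm.integrable_of_hasCompactSupport
    (HasCompactSupport.of_compactSpace _)).const_mul B) (ae_of_all _ fun θ => ?_)
  rw [norm_mul, RCLike.norm_conj]
  exact mul_le_mul_of_nonneg_right (h θ) (norm_nonneg _)

theorem radialMode_mul_radial {d : ℕ} (g : ℝ → ℂ) (u : RadFun d) (Y : UnitSphere d → ℂ) (r : ℝ) :
    radialMode (fun r θ => g r * u r θ) Y r = g r * radialMode u Y r := by
  unfold radialMode
  rw [← integral_const_mul]
  congr 1; funext θ; ring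

theorem smoothSphere_of_smoothRadOn {d : ℕ} {u : RadFun d} (hu : SmoothRadOn (Ioi 0) u) {r : ℝ}
    (hr : 0 < r) : SmoothSphere (u r) := by
  intro θ
  have h1 : ContMDiffAt (𝓘(ℝ, ℝ).prod (𝓡 d)) 𝓘(ℝ, ℂ) ∞
      (fun q : ℝ × UnitSphere d => u q.1 q.2) (r, θ) :=
    (hu (r, θ) ⟨hr, mem_univ _⟩).contMDiffAt
      ((isOpen_Ioi.prod isOpen_univ).mem_nhds ⟨hr, mem_univ _⟩)
  exact ContMDiffAt.comp θ (g := fun q : ℝ × UnitSphere d => u q.1 q.2)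
    (f := fun θ : UnitSphere d => (r, θ)) h1 (contMDiffAt_const.prodMk contMDiffAt_id)

/-- The radial equation satisfied by the modes of a solution. -/
theorem radialMode_ode {d : ℕ} {Z σ : ℂ} {u : RadFun d} (hu : SmoothRadOn (Ioi 0) u)
    (hue : SmoothExt u)
    (h : ∀ r θ, 0 < r → reducedNormalOperator (edgeNormal Z) σ u r θ = 0)
    {lam : ℝ} {Y : UnitSphere d → ℂ} (hY : IsSphereEigenfunction lam Y) {r : ℝ} (hr : 0 < r) :
    radialMode (radDeriv (radDeriv u)) Y r
      = ((Z + lam) / r ^ 2 - σ ^ 2) * radialMode u Y r - d / r * radialMode (radDeriv u) Y r := by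
  have hr0 : (r : ℂ) ≠ 0 := by exact_mod_cast hr.ne'
  have hYc : Continuous fun θ => conj (Y θ) := Complex.continuous_conj.comp hY.1.continuous
  have hus := smoothSphere_of_smoothRadOn hu hr
  -- Symmetry moves the Laplacian onto `Y`, and conjugation leaves the real eigenvalue unchanged.
  have hG : ∫ θ, sphereLaplacian (u r) θ * conj (Y θ) ∂(surfaceMeasure d)
      = lam * radialMode u Y r := by
    rw [integral_sphereLaplacian_symm hus hY.1, hY.2, radialMode, ← integral_const_mul]
    congr 1; funext θ
    simp; ring
  have hpt : ∀ θ, radDeriv (radDeriv u) r θ * conj (Y θ)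
      = ((r : ℂ) ^ 2)⁻¹ * (sphereLaplacian (u r) θ * conj (Y θ))
        + ((Z / r ^ 2 - σ ^ 2) * (u r θ * conj (Y θ))
          - d / r * (radDeriv u r θ * conj (Y θ))) := by
    intro θ
    have := h r θ hr
    rw [reducedNormalOperator_edgeNormal Z σ u hr] at this
    linear_combination (-conj (Y θ)) * this
  have i1 : Integrable (fun θ => sphereLaplacian (u r) θ * conj (Y θ)) (surfaceMeasure d) :=
    integrable_sphere ((continuous_sphereLaplacian hus).mul hYc)
  have i2 : Integrable (fun θ => u r θ * conj (Y θ)) (surfaceMeasure d) :=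
    integrable_sphere ((hue.continuous hr).mul hYc)
  have i3 : Integrable (fun θ => radDeriv u r θ * conj (Y θ)) (surfaceMeasure d) :=
    integrable_sphere ((hue.radDeriv.continuous hr).mul hYc)
  have i4 : Integrable (fun θ => (Z / r ^ 2 - σ ^ 2) * (u r θ * conj (Y θ))
      - d / r * (radDeriv u r θ * conj (Y θ))) (surfaceMeasure d) :=
    (i2.const_mul _).sub (i3.const_mul _)
  unfold radialMode at hG ⊢
  simp_rw [hpt]
  rw [integral_add (i1.const_mul _) i4,
    integral_sub (i2.const_mul _) (i3.const_mul _), integral_const_mul, integral_const_mul,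
    integral_const_mul, hG]
  field_simp
  ring

/-! ### Weak solutions of the radial equation -/

theorem integrable_of_eq_zero_off_tsupport {χ : ℝ → ℝ} (hχ : HasCompactSupport χ) {U : Set ℝ}
    (hU : tsupport χ ⊆ U) {f : ℝ → ℂ} (hf : ContinuousOn f U) (h0 : ∀ x, x ∉ tsupport χ → f x = 0) :
    Integrable f := by
  have h1 : IntegrableOn f (tsupport χ) := (hf.mono hU).integrableOn_compact hχ
  rwa [integrableOn_iff_integrable_of_support_subset] at h1
  intro x hx
  by_contra h
  exact hx (h0 x h)

/-- A twice differentiable weak solution of the radial equation is a classical solution. -/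
theorem strong_of_weak_radial {d : ℕ} {c m m₁ m₂ : ℝ → ℂ} (hc : ContinuousOn c (Ioi 0))
    (hm : ∀ r, 0 < r → HasDerivAt m (m₁ r) r) (hm₁ : ∀ r, 0 < r → HasDerivAt m₁ (m₂ r) r)
    (hm₂ : ContinuousOn m₂ (Ioi 0))
    (hw : ∀ χ : ℝ → ℝ, ContDiff ℝ ∞ χ → HasCompactSupport χ → tsupport χ ⊆ Ioi 0 →
      ∫ r in Ioi (0 : ℝ), m r * (c r * χ r - (deriv (deriv χ) r : ℝ)
        - d / r * (deriv χ r : ℝ)) * (r : ℂ) ^ d = 0) {r : ℝ} (hr : 0 < r) :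
    m₂ r = c r * m r - d / r * m₁ r := by
  have hmc : ContinuousOn m (Ioi 0) := fun x hx => (hm x hx).continuousAt.continuousWithinAt
  have hm₁c : ContinuousOn m₁ (Ioi 0) := fun x hx => (hm₁ x hx).continuousAt.continuousWithinAt
  have hid : ContinuousOn (fun x : ℝ => (x : ℂ)) (Ioi 0) := Complex.continuous_ofReal.continuousOn
  have hinv : ContinuousOn (fun x : ℝ => (d : ℂ) / x) (Ioi 0) :=
    continuousOn_const.div hid fun x hx => by exact_mod_cast (ne_of_gt hx)
  set q : ℝ → ℂ := fun x => (x : ℂ) ^ d * (c x * m x - d / x * m₁ x - m₂ x) with hq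
  have hqc : ContinuousOn q (Ioi 0) :=
    (hid.pow d).mul (((hc.mul hmc).sub (hinv.mul hm₁c)).sub hm₂)
  have hae : ∀ᵐ x : ℝ, x ∈ Ioi (0 : ℝ) → q x = 0 := by
    refine isOpen_Ioi.ae_eq_zero_of_integral_contDiff_smul_eq_zero
      (hqc.locallyIntegrableOn measurableSet_Ioi) fun χ hχ hχc hχs => ?_
    have hχ1 : ContDiff ℝ ∞ (deriv χ) := ((contDiff_infty_iff_deriv).mp hχ).2
    have hχ2 : ContDiff ℝ ∞ (deriv (deriv χ)) := ((contDiff_infty_iff_deriv).mp hχ1).2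
    have hd0 : ∀ x, HasDerivAt (fun x => (χ x : ℂ)) ((deriv χ x : ℝ) : ℂ) x := fun x =>
      ((hχ.differentiable (by simp)) x).hasDerivAt.ofReal_comp
    have hd1 : ∀ x, HasDerivAt (fun x => ((deriv χ x : ℝ) : ℂ)) ((deriv (deriv χ) x : ℝ) : ℂ) x :=
      fun x => ((hχ1.differentiable (by simp)) x).hasDerivAt.ofReal_comp
    have hz0 : ∀ x, x ∉ tsupport χ → χ x = 0 := fun x hx => image_eq_zero_of_notMem_tsupport hx
    have hz1 : ∀ x, x ∉ tsupport χ → deriv χ x = 0 := fun x hx =>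
      image_eq_zero_of_notMem_tsupport fun h => hx (tsupport_deriv_subset h)
    have hz2 : ∀ x, x ∉ tsupport χ → deriv (deriv χ) x = 0 := fun x hx =>
      image_eq_zero_of_notMem_tsupport fun h =>
        hx (tsupport_deriv_subset (tsupport_deriv_subset h))
    have c0 : ContinuousOn (fun x => (χ x : ℂ)) (Ioi 0) :=
      (Complex.continuous_ofReal.comp hχ.continuous).continuousOn
    have c1 : ContinuousOn (fun x => ((deriv χ x : ℝ) : ℂ)) (Ioi 0) :=
      (Complex.continuous_ofReal.comp hχ1.continuous).continuousOn
    have c2 : ContinuousOn (fun x => ((deriv (deriv χ) x : ℝ) : ℂ)) (Ioi 0) :=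
      (Complex.continuous_ofReal.comp hχ2.continuous).continuousOn
    -- The boundary expression of two integrations by parts: the weak integrand equals `χ q - W'`,
    -- and `∫ W' = 0` by compact support. Thus `∫ χ q = 0` for all `χ`, where `q` is `r^d` times the
    -- residual of the classical equation.
    let W : ℝ → ℂ := fun x => (x : ℂ) ^ d * (m x * (deriv χ x : ℝ) - m₁ x * χ x)
    let W' : ℝ → ℂ := fun x => (x : ℂ) ^ d * (d / x * (m x * (deriv χ x : ℝ) - m₁ x * χ x)
      + (m x * (deriv (deriv χ) x : ℝ) - m₂ x * χ x))
    have hW : ∀ x, HasDerivAt W (W' x) x := by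
      intro x
      by_cases hx : x ∈ tsupport χ
      · have hx0 : 0 < x := hχs hx
        have hxc : (x : ℂ) ≠ 0 := by exact_mod_cast hx0.ne'
        have hp : HasDerivAt (fun x : ℝ => (x : ℂ) ^ d) (d / x * (x : ℂ) ^ d) x := by
          have := (hasDerivAt_pow d (x : ℂ)).comp_ofReal
          refine this.congr_deriv ?_
          cases d with
          | zero => simp
          | succ k => simp only [Nat.add_sub_cancel, pow_succ]; field_simp
        refine (hp.mul (((hm x hx0).mul (hd1 x)).sub ((hm₁ x hx0).mul (hd0 x)))).congr_deriv ?_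
        simp only [W']
        simp only [Pi.sub_apply, Pi.mul_apply]
        ring
      · have h1 : W =ᶠ[𝓝 x] fun _ => 0 := by
          filter_upwards [(isClosed_tsupport χ).isOpen_compl.mem_nhds hx] with y hy
          simp [W, hz0 y hy, hz1 y hy]
        have h2 : W' x = 0 := by simp [W', hz0 x hx, hz1 x hx, hz2 x hx]
        rw [h2]
        exact (hasDerivAt_const x (0 : ℂ)).congr_of_eventuallyEq h1
    have iW' : Integrable W' := integrable_of_eq_zero_off_tsupport hχc hχs
      ((hid.pow d).mul ((hinv.mul ((hmc.mul c1).sub (hm₁c.mul c0))).add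
        ((hmc.mul c2).sub (hm₂.mul c0))))
      fun x hx => by simp [W', hz0 x hx, hz1 x hx, hz2 x hx]
    have iW : Integrable W := integrable_of_eq_zero_off_tsupport hχc hχs
      ((hid.pow d).mul ((hmc.mul c1).sub (hm₁c.mul c0)))
      fun x hx => by simp [W, hz0 x hx, hz1 x hx]
    have iq : Integrable fun x => χ x • q x := integrable_of_eq_zero_off_tsupport hχc hχs
      (hχ.continuous.continuousOn.smul hqc) fun x hx => by simp [hz0 x hx]
    have hint := integral_eq_zero_of_hasDerivAt_of_integrable hW iW' iW
    have hsub : ∫ x, (χ x • q x - W' x) = 0 := by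
      rw [← hw χ hχ hχc hχs, ← integral_indicator measurableSet_Ioi]
      refine integral_congr_ae (ae_of_all _ fun x => ?_)
      by_cases hx : x ∈ Ioi (0 : ℝ)
      · simp only [indicator_of_mem hx, W', hq, Complex.real_smul]
        ring
      · have hx' : x ∉ tsupport χ := fun h => hx (hχs h)
        simp [indicator_of_notMem hx, W', hz0 x hx', hz1 x hx', hz2 x hx']
    rwa [integral_sub iq iW', hint, sub_zero] at hsub
  have hq0 : q r = 0 := by
    have h1 : q =ᵐ[volume.restrict (Ioi 0)] fun _ => (0 : ℂ) :=
      (ae_restrict_iff' measurableSet_Ioi).mpr hae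
    exact Measure.eqOn_open_of_ae_eq h1 isOpen_Ioi hqc continuousOn_const hr
  have hr0 : (r : ℂ) ≠ 0 := by exact_mod_cast hr.ne'
  have := (mul_eq_zero.mp hq0).resolve_left (pow_ne_zero d hr0)
  exact (sub_eq_zero.mp this).symm

theorem isTestFunction_radial_mul {d : ℕ} {χ : ℝ → ℝ} (hχ : ContDiff ℝ ∞ χ)
    (hχc : HasCompactSupport χ) (hχs : tsupport χ ⊆ Ioi 0) {Y : UnitSphere d → ℂ}
    (hY : SmoothSphere Y) : IsTestFunction (fun r θ => (χ r : ℂ) * Y θ) := by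
  refine ⟨?_, ?_⟩
  · have h1 : ContMDiff (𝓘(ℝ, ℝ).prod (𝓡 d)) 𝓘(ℝ, ℂ) ∞
        (fun q : ℝ × UnitSphere d => (χ q.1 : ℂ)) :=
      ((Complex.ofRealCLM.contDiff.comp hχ).contMDiff).comp contMDiff_fst
    have h2 : ContMDiff (𝓘(ℝ, ℝ).prod (𝓡 d)) 𝓘(ℝ, ℂ) ∞
        (fun q : ℝ × UnitSphere d => Y q.2) := ContMDiff.comp hY contMDiff_snd
    exact ((contDiff_mul (𝕜 := ℝ) (𝔸 := ℂ) (n := ∞)).contMDiff.comp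
      (h1.prodMk_space h2)).contMDiffOn
  · rcases (tsupport χ).eq_empty_or_nonempty with he | hne
    · refine ⟨1, 1, one_pos, fun r θ _ => ?_⟩
      have : χ r = 0 := image_eq_zero_of_notMem_tsupport (by simp [he])
      simp [this]
    · obtain ⟨a, ha, hla⟩ := hχc.isCompact.exists_isLeast hne
      obtain ⟨b, hb, hlb⟩ := hχc.isCompact.exists_isGreatest hne
      refine ⟨a, b, hχs ha, fun r θ hr => ?_⟩
      have : χ r = 0 := image_eq_zero_of_notMem_tsupport fun h => hr ⟨hla h, hlb h⟩
      simp [this]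

/-- The radial equation satisfied by the modes of an element of the kernel of the adjoint. -/
theorem radialMode_ode_of_adjoint {d : ℕ} {Z σ : ℂ} {u : RadFun d} (hue : SmoothExt u)
    (h : AdjointApplyEq (reducedNormalOperator (edgeNormal Z) σ) u (fun _ _ => 0))
    {lam : ℝ} {Y : UnitSphere d → ℂ} (hY : IsSphereEigenfunction lam Y) {r : ℝ} (hr : 0 < r) :
    radialMode (radDeriv (radDeriv u)) Y r
      = conj ((Z + lam) / (r : ℂ) ^ 2 - σ ^ 2) * radialMode u Y r
        - d / r * radialMode (radDeriv u) Y r := by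
  have hYc := hY.1.continuous
  have hid : ContinuousOn (fun x : ℝ => (x : ℂ) ^ 2) (Ioi 0) := by fun_prop
  refine strong_of_weak_radial (c := fun r : ℝ => conj ((Z + lam) / (r : ℂ) ^ 2 - σ ^ 2))
    (Complex.continuous_conj.comp_continuousOn ((continuousOn_const.div hid fun x hx =>
      pow_ne_zero 2 (by exact_mod_cast (ne_of_gt hx))).sub continuousOn_const))
    (fun r hr => hasDerivAt_radialMode hue hYc hr)
    (fun r hr => hasDerivAt_radialMode hue.radDeriv hYc hr)
    (fun x hx =>
      (hasDerivAt_radialMode hue.radDeriv.radDeriv hYc hx).continuousAt.continuousWithinAt)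
    (fun χ hχ hχc hχs => ?_) hr
  -- Testing against `χ(r) Y(θ)` with real `χ` isolates one mode. The pairing conjugates its second
  -- argument, which is why the conjugated coefficient appears.
  have h1 := h _ (isTestFunction_radial_mul hχ hχc hχs hY.1)
  have h2 : radPairing (fun _ _ => 0) (fun r θ => (χ r : ℂ) * Y θ) = 0 := by simp [radPairing]
  rw [h2] at h1
  rw [h1, radPairing]
  refine setIntegral_congr_fun measurableSet_Ioi fun x hx => ?_
  have hχ1 : ContDiff ℝ ∞ (deriv χ) := ((contDiff_infty_iff_deriv).mp hχ).2
  have e1 : radDeriv (fun r θ => (χ r : ℂ) * Y θ) = fun r θ => ((deriv χ r : ℝ) : ℂ) * Y θ := by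
    funext r θ
    exact (((hχ.differentiable (by simp)) r).hasDerivAt.ofReal_comp.mul_const (Y θ)).deriv
  have e2 : radDeriv (fun r θ => ((deriv χ r : ℝ) : ℂ) * Y θ)
      = fun r θ => ((deriv (deriv χ) r : ℝ) : ℂ) * Y θ := by
    funext r θ
    exact (((hχ1.differentiable (by simp)) r).hasDerivAt.ofReal_comp.mul_const (Y θ)).deriv
  have e3 : sphereLaplacian (fun θ => (χ x : ℂ) * Y θ) = fun θ => (χ x : ℂ) * (lam * Y θ) := by
    have := sphereLaplacian_smul hY.1 (χ x : ℂ)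
    rw [hY.2] at this
    exact this
  have e4 : ∀ θ, reducedNormalOperator (edgeNormal Z) σ (fun r θ => (χ r : ℂ) * Y θ) x θ
      = (((Z + lam) / (x : ℂ) ^ 2 - σ ^ 2) * χ x - (deriv (deriv χ) x : ℝ)
        - d / x * (deriv χ x : ℝ)) * Y θ := by
    intro θ
    rw [reducedNormalOperator_edgeNormal Z σ _ hx, e1, e2, e3]
    ring
  simp only [e4]
  congr 1
  rw [radialMode, ← integral_mul_const]
  refine integral_congr_ae (ae_of_all _ fun θ => ?_)
  simp only [map_mul, map_sub, Complex.conj_ofReal, map_div₀, Complex.conj_natCast]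
  ring

/-! ### Spectral admissibility -/

theorem hasDerivAt_conj {f : ℝ → ℂ} {f' : ℂ} {r : ℝ} (h : HasDerivAt f f' r) :
    HasDerivAt (fun s => conj (f s)) (conj f') r :=
  Complex.conjCLE.toContinuousLinearMap.hasFDerivAt.comp_hasDerivAt r h

theorem isSymbolAtTop_of_chain {C : ℝ} (f : ℕ → ℝ → ℂ)
    (hd : ∀ j r, 0 < r → HasDerivAt (f j) (f (j + 1) r / r) r)
    (hb : ∀ j, ∃ K : ℝ, ∀ r : ℝ, 1 ≤ r → ‖f j r‖ ≤ K * r ^ C) : IsSymbolAtTop C (f 0) :=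
  isSymbolAtTop_of_seq f (fun j => f (j + 1))
    (fun j => Submodule.subset_span (mem_range_self (j + 1))) hd hb 0

/-- Taking modes commutes with `r ∂_r`, so the modes of `(r∂_r)^j v` form a chain with one common
order `C`; no angular derivatives are needed. The conjugated version serves the adjoint. -/
theorem isSymbolAtTop_radialMode {d : ℕ} {v : RadFun d} (hv : SmoothExt v)
    (hc : ConormalNearInfinity v) {Y : UnitSphere d → ℂ} (hY : Continuous Y) :
    ∃ C, IsSymbolAtTop C (radialMode v Y) ∧ IsSymbolAtTop C (fun r => conj (radialMode v Y r)) := by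
  obtain ⟨C, hC⟩ := hc
  have hd : ∀ j r, 0 < r → HasDerivAt (radialMode (radEuler^[j] v) Y)
      (radialMode (radEuler^[j + 1] v) Y r / r) r := fun j r hr => by
    rw [Function.iterate_succ_apply']
    exact hasDerivAt_radialMode_euler (hv.iterate_radEuler j) hY hr
  have hb : ∀ j, ∃ K : ℝ, ∀ r : ℝ, 1 ≤ r → ‖radialMode (radEuler^[j] v) Y r‖ ≤ K * r ^ C := by
    intro j
    obtain ⟨K, hK⟩ := hC j []
    refine ⟨K * ∫ θ, ‖Y θ‖ ∂(surfaceMeasure d), fun r hr => ?_⟩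
    refine (norm_radialMode_le hY (fun θ => hK r hr θ)).trans_eq ?_
    ring
  refine ⟨C, isSymbolAtTop_of_chain (fun j => radialMode (radEuler^[j] v) Y) hd hb,
    isSymbolAtTop_of_chain (fun j r => conj (radialMode (radEuler^[j] v) Y r))
      (fun j r hr => ?_) (fun j => ?_)⟩
  · refine (hasDerivAt_conj (hd j r hr)).congr_deriv ?_
    rw [map_div₀, Complex.conj_ofReal]
  · obtain ⟨K, hK⟩ := hb j
    exact ⟨K, fun r hr => by rw [RCLike.norm_conj]; exact hK r hr⟩

theorem exists_radialMode_bound {d : ℕ} {κ : ℝ} {u : RadFun d} (hu : ConormalNearZero κ u)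
    {Y : UnitSphere d → ℂ} (hY : Continuous Y) :
    ∃ B, ∀ r ∈ Ioc (0 : ℝ) 1, ‖radialMode u Y r‖ ≤ B * r ^ κ := by
  obtain ⟨K, hK⟩ := hu 0 []
  refine ⟨K * ∫ θ, ‖Y θ‖ ∂(surfaceMeasure d), fun r hr => ?_⟩
  exact (norm_radialMode_le hY (fun θ => hK r hr θ)).trans_eq (by ring)

theorem exists_radialMode_decay {d : ℕ} {u : RadFun d} (hu : RapidDecayNearInfinity u)
    {Y : UnitSphere d → ℂ} (hY : Continuous Y) (N : ℝ) :
    ∃ B, ∀ r, 1 ≤ r → ‖radialMode u Y r‖ ≤ B * r ^ (-N)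
      ∧ ‖radialMode (radDeriv u) Y r‖ ≤ B * r ^ (-N) := by
  obtain ⟨K, hK⟩ := hu 0 [] N
  obtain ⟨K', hK'⟩ := hu 1 [] N
  have hp : ∀ r : ℝ, 1 ≤ r → 0 ≤ r ^ (-N) := fun r hr => Real.rpow_nonneg (by linarith) _
  refine ⟨max K K' * ∫ θ, ‖Y θ‖ ∂(surfaceMeasure d), fun r hr => ⟨?_, ?_⟩⟩
  · exact (norm_radialMode_le hY (fun θ => (hK r hr θ).trans
      (mul_le_mul_of_nonneg_right (le_max_left K K') (hp r hr)))).trans_eq (by ring)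
  · exact (norm_radialMode_le hY (fun θ => (hK' r hr θ).trans
      (mul_le_mul_of_nonneg_right (le_max_right K K') (hp r hr)))).trans_eq (by ring)

/-- Roots of `ν₀ ^ 2 + lam` with real part bounded below by that of `ν₀`. -/
theorem exists_sq_eq_add {ν₀ : ℂ} (h0 : 0 < ν₀.re) {lam : ℝ} (hlam : 0 ≤ lam) :
    ∃ ν : ℂ, ν ^ 2 = ν₀ ^ 2 + lam ∧ ν₀.re ≤ ν.re := by
  have h1 := sqrt_sq_eq (ν₀ ^ 2 + lam)
  have h2 := abs_re_le_of_sq_eq_add hlam h1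
  rw [abs_of_pos h0] at h2
  rcases le_total 0 (Complex.sqrt (ν₀ ^ 2 + lam)).re with h | h
  · exact ⟨_, h1, by rwa [abs_of_nonneg h] at h2⟩
  · refine ⟨-Complex.sqrt (ν₀ ^ 2 + lam), by rw [neg_sq, h1], ?_⟩
    rwa [abs_of_nonpos h] at h2

theorem contDiff_cexp_mul_ofReal (a : ℂ) : ContDiff ℝ ∞ (fun r : ℝ => Complex.exp (a * r)) :=
  (contDiff_const.mul Complex.ofRealCLM.contDiff).cexp

theorem eq_zero_of_radialMode_eq_zero {d : ℕ} {u : RadFun d} (hu : SmoothExt u)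
    (h : ∀ Y ∈ sphereEigenfunctions d, ∀ r, 0 < r → radialMode u Y r = 0) :
    ∀ r θ, 0 < r → u r θ = 0 := fun r θ hr =>
  congrFun (eq_zero_of_orthogonal_eigenfunctions (hu.continuous hr) fun Y hY => h Y hY r hr) θ

section admissible
variable {d : ℕ} {Z ν₀ σ : ℂ} {ℓ : ℝ} (hν₀ : ν₀ ^ 2 = (((d : ℂ) - 1) / 2) ^ 2 + Z)
  (hpos : 0 < ν₀.re)
include hν₀ hpos

/-- Completing the square, a parameter `λ ≥ 0` corresponds to `(ξ + (d-1)/2)² = ν₀² + λ`. On the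
line considered, `ξ + (d-1)/2` has real part `ℓ - 1`, smaller in modulus than `ν₀.re`. -/
theorem nonIndicialWeight_edgeNormal (hℓ : ℓ ∈ Ioo (1 - ν₀.re) (1 + ν₀.re)) :
    NonIndicialWeight (edgeNormal (d := d) Z) (ℓ - ((d : ℝ) + 1) / 2) := by
  intro ξ hξ
  refine invertibleOnSphere_sphereLaplacian_sub (c := ξ ^ 2 + ((d : ℂ) - 1) * ξ - Z)
    (fun lam hlam hc => ?_) (fun φ _ => indicialFamily_edgeNormal Z ξ)
  have h1 : (ξ + ((d : ℂ) - 1) / 2) ^ 2 = ν₀ ^ 2 + lam := by rw [hν₀, ← hc]; ring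
  have h2 := abs_re_le_of_sq_eq_add hlam h1
  have h3 : (ξ + ((d : ℂ) - 1) / 2).re = ℓ - 1 := by
    have : ((d : ℂ) - 1) / 2 = ((((d : ℝ) - 1) / 2 : ℝ) : ℂ) := by push_cast; ring
    rw [this, Complex.add_re, hξ, Complex.ofReal_re]
    ring
  rw [h3, abs_of_pos hpos] at h2
  have h4 : |ℓ - 1| < ν₀.re := abs_lt.mpr ⟨by linarith [hℓ.1], by linarith [hℓ.2]⟩
  linarith

/-- Each mode falls under `radial_solution_eq_zero` with `ζ = -iσ`, for which `ζ² = -σ²` and `Re ζ =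
Im σ`. The weight exceeds the singular exponent precisely because `ℓ > 1 - ν₀.re ≥ 1 - ν.re`. -/
theorem reducedNormalOperator_injective (hℓ : 1 - ν₀.re < ℓ) (him : 0 ≤ σ.im) (hσ : ‖σ‖ = 1)
    {u : RadFun d} (hu : SmoothRadOn (Ioi 0) u)
    (h : ∀ r θ, 0 < r → reducedNormalOperator (edgeNormal Z) σ u r θ = 0)
    (hz : ConormalNearZero (ℓ - ((d : ℝ) + 1) / 2) u)
    (hosc : σ.im = 0 → ConormalNearInfinity
      (fun r θ => Complex.exp (-(Complex.I * σ * (r : ℂ))) * u r θ))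
    (hdec : 0 < σ.im → RapidDecayNearInfinity u) : ∀ r θ, 0 < r → u r θ = 0 := by
  have hue : SmoothExt u := fun r hr x hx => contDiffAt_homExt_rad hu hr hx
  refine eq_zero_of_radialMode_eq_zero hue ?_
  rintro Y ⟨lam, hlam, hY⟩
  have hYc := hY.1.continuous
  obtain ⟨ν, hν, hre⟩ := exists_sq_eq_add hpos hlam
  have hζ : (-(Complex.I * σ)).re = σ.im := by simp
  have hexp : ∀ r : ℝ, Complex.exp (-(Complex.I * σ * (r : ℂ)))
      = Complex.exp (-(Complex.I * σ) * r) := fun r => by rw [neg_mul]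
  refine radial_solution_eq_zero (ν := ν) (ζ := -(Complex.I * σ)) (by linarith) (by rwa [hζ])
    (by simpa using hσ) d (u₁ := radialMode (radDeriv u) Y)
    (fun r hr => hasDerivAt_radialMode hue hYc hr) (fun r hr => ?_)
    (κ := ℓ - ((d : ℝ) + 1) / 2) (by linarith) (exists_radialMode_bound hz hYc)
    (fun h0 => ?_) (fun h0 => exists_radialMode_decay (hdec (by rwa [hζ] at h0)) hYc)
  · refine (hasDerivAt_radialMode hue.radDeriv hYc hr).congr_deriv ?_
    rw [radialMode_ode hu hue h hY hr, hν, hν₀]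
    linear_combination (-σ ^ 2 * radialMode u Y r) * Complex.I_sq
  · have hosc' := hosc (by rwa [hζ] at h0)
    simp only [hexp] at hosc'
    obtain ⟨C, hC, -⟩ := isSymbolAtTop_radialMode (Y := Y)
      (hue.mul_radial (contDiff_cexp_mul_ofReal _)) hosc' hYc
    exact ⟨C, _, hC, fun r _ => radialMode_mul_radial _ u Y r⟩

/-- Conjugating a mode undoes the conjugation of the adjoint's coefficients and leads back to the
equation with the same `ν` and `ζ`. The dual weight exceeds the singular exponent when `ℓ < 1 +
ν.re`. For real `σ`, conjugation turns `e^{iσr}u` into `e^{ζr}ū`. -/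
theorem reducedNormalOperator_adjoint_injective (hℓ : ℓ < 1 + ν₀.re) (him : 0 ≤ σ.im)
    (hσ : ‖σ‖ = 1) {u : RadFun d} (hu : SmoothRadOn (Ioi 0) u)
    (h : AdjointApplyEq (reducedNormalOperator (edgeNormal Z) σ) u (fun _ _ => 0))
    (hz : ConormalNearZero (-((((d : ℝ) + 1) - 4) / 2) - ℓ) u)
    (hosc : σ.im = 0 → ConormalNearInfinity
      (fun r θ => Complex.exp (Complex.I * σ * (r : ℂ)) * u r θ))
    (hdec : 0 < σ.im → RapidDecayNearInfinity u) : ∀ r θ, 0 < r → u r θ = 0 := by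
  have hue : SmoothExt u := fun r hr x hx => contDiffAt_homExt_rad hu hr hx
  refine eq_zero_of_radialMode_eq_zero hue ?_
  rintro Y ⟨lam, hlam, hY⟩
  have hYc := hY.1.continuous
  obtain ⟨ν, hν, hre⟩ := exists_sq_eq_add hpos hlam
  have hζ : (-(Complex.I * σ)).re = σ.im := by simp
  have hmain := radial_solution_eq_zero (ν := ν) (ζ := -(Complex.I * σ)) (by linarith)
    (by rwa [hζ]) (by simpa using hσ) d (u := fun r => conj (radialMode u Y r))
    (u₁ := fun r => conj (radialMode (radDeriv u) Y r))
    (fun r hr => hasDerivAt_conj (hasDerivAt_radialMode hue hYc hr)) (fun r hr => ?_)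
    (κ := -((((d : ℝ) + 1) - 4) / 2) - ℓ) (by linarith) ?_
    (fun h0 => ?_) (fun h0 => ?_)
  · intro r hr
    simpa using hmain r hr
  · refine (hasDerivAt_conj (hasDerivAt_radialMode hue.radDeriv hYc hr)).congr_deriv ?_
    rw [radialMode_ode_of_adjoint hue h hY hr, hν, hν₀]
    simp only [map_sub, map_mul, Complex.conj_conj, map_div₀, Complex.conj_ofReal,
      Complex.conj_natCast]
    linear_combination (-σ ^ 2 * conj (radialMode u Y r)) * Complex.I_sq
  · obtain ⟨B, hB⟩ := exists_radialMode_bound hz hYc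
    exact ⟨B, fun r hr => by rw [RCLike.norm_conj]; exact hB r hr⟩
  · rw [hζ] at h0
    have hσc : conj σ = σ := Complex.conj_eq_iff_im.mpr h0
    obtain ⟨C, -, hC⟩ := isSymbolAtTop_radialMode (Y := Y)
      (hue.mul_radial (contDiff_cexp_mul_ofReal (Complex.I * σ))) (hosc h0) hYc
    refine ⟨C, _, hC, fun r _ => ?_⟩
    rw [radialMode_mul_radial (fun r : ℝ => Complex.exp (Complex.I * σ * (r : ℂ))), map_mul,
      ← Complex.exp_conj]
    simp only [map_mul, Complex.conj_I, hσc, Complex.conj_ofReal, neg_mul]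
  · intro N
    obtain ⟨B, hB⟩ := exists_radialMode_decay (hdec (by rwa [hζ] at h0)) hYc N
    exact ⟨B, fun r hr => by simpa only [RCLike.norm_conj] using hB r hr⟩

end admissible

end

/-- Spatial dimension `n = d + 1`. -/
theorem lemma4p7 (d : ℕ) (V₀ : SpaceTimeFun d) (hV₀ : SmoothSpaceTimeOn (Ici 0) V₀)
    (v₀ : ℝ → ℂ) (hv₀ : ∀ (t : ℝ) (θ : UnitSphere d), V₀ t 0 θ = v₀ t) (t₀ : ℝ)
    (ht₀ : v₀ t₀ ∉ (fun x : ℝ => (x : ℂ)) '' Iic (-(((((d : ℝ) + 1) - 2) / 2) ^ 2)))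
    (μ : ℝ)
    (hμ : μ = (Complex.sqrt (((((((d : ℝ) + 1) - 2) / 2) ^ 2 : ℝ) : ℂ) + v₀ t₀)).re)
    (ℓ : ℝ) (hℓ : ℓ ∈ Ioo (1 - μ) (1 + μ)) :
    SpectrallyAdmissible (minkowskiBoxAddPotential V₀) t₀ ℓ := by
  subst hμ
  have hν₀ : (Complex.sqrt (((((((d : ℝ) + 1) - 2) / 2) ^ 2 : ℝ) : ℂ) + v₀ t₀)) ^ 2
      = (((d : ℂ) - 1) / 2) ^ 2 + v₀ t₀ := by
    rw [sqrt_sq_eq]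
    push_cast
    ring
  -- Shifted by `((n-2)/2)²`, the excluded ray becomes `(-∞, 0]`.
  have hpos := sqrt_re_pos (z := ((((((d : ℝ) + 1) - 2) / 2) ^ 2 : ℝ) : ℂ) + v₀ t₀)
    fun x hx hxz => ht₀ ⟨x - ((((d : ℝ) + 1) - 2) / 2) ^ 2, by
      rw [mem_Iic]; linarith, by
      simp only
      rw [Complex.ofReal_sub, ← hxz]; ring⟩
  exact ⟨edgeNormal (v₀ t₀), isEdgeNormalOperator_edgeNormal hV₀ (hv₀ t₀),
    nonIndicialWeight_edgeNormal hν₀ hpos hℓ, fun σ him hσ u hu =>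
      ⟨fun h hz hosc hdec =>
        reducedNormalOperator_injective hν₀ hpos hℓ.1 him hσ hu h hz hosc hdec,
      fun h hz hosc hdec =>
        reducedNormalOperator_adjoint_injective hν₀ hpos hℓ.2 him hσ hu h hz hosc hdec⟩⟩
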